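/- **Setting.** Let $N\ge 2$, let $X=(X_1,\dots,X_m)$ be locally Lipschitz vector fields on $\mathbb R^N$, and write $Xu=(X_1u,\dots,X_mu)$, $X_ju=X_j\cdot\nabla u$, for $u\in C^1$. Let $\Omega\subset\mathbb R^N$ be open and bounded. An absolutely continuous path $\gamma$ on $[0,T]$ is *$X$-subunit* if for a.e. $t$ one has $\dot\gamma(t)=\sum_j\theta_j(t)X_j(\gamma(t))$ with $\sum_j\theta_j(t)^2\le1$ ($\theta$ measurable). Let $d_X(x,y)$ be the infimum of the $T>0$ for which an $X$-subunit path $\gamma:[0,T]\to\mathbb R^N$ with $\gamma(0)=x$, $\gamma(T)=y$ exists. Let $U\subset\mathbb R^N$ be an open set such that either $U=\Omega$ or $\overline\Omega\subset U$ (for instance $U=\mathbb R^N$), and for $x\in U$, $r>0$ let $B_r=B_r(x)=\{y\in U: d_X(x,y)<r\}$. Assume that for some $Q>2$: * any two points of $U$ are joined by an $X$-subunit path in $U$, and for $x\in U$, $d_X(x,y)\to0$ as $y\to x$ in $U$; * $0<|B_{2r}|\le 2^Q|B_r|$ for all $x\in U$, $r>0$ (Lebesgue measure); * there are $C_P,\nu>0$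 such that $\displaystyle\frac1{|B_r|}\int_{B_r}|u-u_r|\,dx\le C_P\,r\,\frac1{|B_{\nu r}|}\int_{B_{\nu r}}|Xu|\,dx$, with $u_r=\frac1{|B_r|}\int_{B_r}u\,dx$ and $B_{\nu r}=B_{\nu r}(x)$, for all $x\in U$, $r>0$ and all $u\in C^1_c(\mathbb R^N)$. For $1\le q<Q$, $W^{1,q}_0(\Omega,X)$ is the closure of $C_c^\infty(\Omega)$ in the norm $\|Xu\|_{L^q(\Omega)}$; it is realized as the set of $u\in L^q(\Omega)$ for which there are $\varphi_k\in C^\infty_c(\Omega)$ and $G\in L^q(\Omega)^m$ with $\varphi_k\to u$ and $X\varphi_k\to G$ in $L^q(\Omega)$, and then $Xu:=G$. Let $A$ be a bounded measurable (not necessarily symmetric) $m\times m$ matrix field on $\Omega$ with $\alpha|\eta|^2\le A(x)\eta\cdot\eta\le\beta|\eta|^2$ for all $\eta\in\mathbb R^m$ and a.e. $x\in\Omega$, where $0<\alpha<\beta$. For $g\in L^\infty(\Omega)$, $w\in W^{1,2}_0(\Omega,X)$ is a weak solution of $X^*(A\,Xw)=g$ in $\Omega$, $w=0$ on $\partial\Omega$,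 if $\int_\Omega A\,Xw\cdot Xv=\int_\Omega g\,v$ for all $v\in W^{1,2}_0(\Omega,X)$. For $f\in L^1(\Omega)$ let $f_n=\max(-n,\min(n,f))$ and let $u_n$ be a weak solution with datum $f_n$, $n\in\mathbb N$. A function $u\in L^1(\Omega)$ is a *solution found by approximation* of $$X^*(A\,Xu)=f\ \text{ in }\Omega,\qquad u=0\ \text{ on }\partial\Omega,$$ if for such a sequence $(u_n)$ some subsequence converges to $u$ in $L^1(\Omega)$. **Theorem.** Let $1<p<\frac{2Q}{Q+2}$ and $p^*=\frac{pQ}{Q-p}$. There is a constant $C>0$, depending only on $X,\Omega,U,Q,p,\alpha$ (not on $\beta$, $A$, $f$), such that for every $A$ as above and every $f\in L^p(\Omega)$ a solution found by approximation exists, and every solution $u$ found by approximation belongs to $W^{1,p^*}_0(\Omega,X)$ and satisfies $$\|Xu\|_{L^{p^*}(\Omega)}\le C\,\|f\|_{L^p(\Omega)}.$$ -/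

import Mathlib

open MeasureTheory Set Filter Topology
open scoped ENNReal ContDiff Matrix

noncomputable section

namespace XElliptic

/-- `ℝ^n` with its Euclidean norm. -/
abbrev E (n : ℕ) : Type := EuclideanSpace ℝ (Fin n)

variable {N m : ℕ}

/-- The `X`-gradient `Xu = (X₁u, …, X_m u)` of a (differentiable) function, `X_j u = X_j · ∇u`. -/
def xGrad (X : Fin m → E N → E N) (u : E N → ℝ) (x : E N) : E m :=
  WithLp.toLp 2 (fun j => fderiv ℝ u x (X j x))

/-- `γ : [0,T] → D` is an `X`-subunit path: it is absolutely continuous and, for a.e. `t`,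
`γ'(t) = ∑ j, θ_j(t) X_j(γ(t))` with `∑ j, θ_j(t)² ≤ 1`.
(Only the values of `γ` on `[0,T]` matter.) -/
def IsSubunit (X : Fin m → E N → E N) (D : Set (E N)) (T : ℝ) (γ : ℝ → E N) : Prop :=
  AbsolutelyContinuousOnInterval γ 0 T ∧ (∀ t ∈ Icc 0 T, γ t ∈ D) ∧
    ∃ θ : ℝ → Fin m → ℝ, Measurable θ ∧
      ∀ᵐ t : ℝ, t ∈ Icc 0 T →
        ∑ j, θ t j ^ 2 ≤ 1 ∧ HasDerivAt γ (∑ j, θ t j • X j (γ t)) t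

/-- `U` is `X`-connected: any two of its points are joined by an `X`-subunit path in `U`. -/
def XConnected (X : Fin m → E N → E N) (U : Set (E N)) : Prop :=
  ∀ x ∈ U, ∀ y ∈ U, ∃ T : ℝ, 0 < T ∧ ∃ γ : ℝ → E N, IsSubunit X U T γ ∧ γ 0 = x ∧ γ T = y

/-- The control (Carnot–Carathéodory) distance: the infimum of the times `T > 0` for which there
is an `X`-subunit path `γ : [0,T] → ℝ^N` from `x` to `y` (`∞` if there is none). -/
def ccDist (X : Fin m → E N → E N) (x y : E N) : ℝ≥0∞ :=
  ⨅ (T : ℝ) (_ : 0 < T ∧ ∃ γ : ℝ → E N, IsSubunit X univ T γ ∧ γ 0 = x ∧ γ T = y),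
    ENNReal.ofReal T

/-- The ball of centre `x` and radius `r` in the metric space `(U, d_X)`. -/
def ccBall (X : Fin m → E N → E N) (U : Set (E N)) (x : E N) (r : ℝ) : Set (E N) :=
  {y | y ∈ U ∧ ccDist X x y < ENNReal.ofReal r}

/-- The structural assumptions on the vector fields `X` in the open set `U`, with exponent `Q`. -/
structure IsAdmissible (X : Fin m → E N → E N) (U : Set (E N)) (Q : ℝ) : Prop where
  /-- The set `U` is `X`-connected, so that `d_X` is a (finite) metric on `U`. -/
  connected : XConnected X U
  /-- `|y - x| → 0` implies `d_X(x, y) → 0`. -/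
  equivalent : ∀ x ∈ U, Tendsto (fun y => ccDist X x y) (𝓝[U] x) (𝓝 0)
  /-- `(U, d_X)` with the Lebesgue measure is a doubling space. -/
  ball_pos : ∀ x ∈ U, ∀ r : ℝ, 0 < r → 0 < volume (ccBall X U x r)
  /-- `|B_{2r}| ≤ 2^Q |B_r|`. -/
  doubling : ∀ x ∈ U, ∀ r : ℝ, 0 < r →
    volume (ccBall X U x (2 * r)) ≤ ENNReal.ofReal ((2 : ℝ) ^ Q) * volume (ccBall X U x r)
  /-- The Poincaré inequality. It is required only of restrictions of `C¹_c(ℝ^N)` functions, which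
  all belong to `C¹` of the closed ball (a function that is `C¹` near a compact closed ball
  coincides there with such a function). -/
  poincare : ∃ CP : ℝ, 0 < CP ∧ ∃ ν : ℝ, 0 < ν ∧ ∀ x ∈ U, ∀ r : ℝ, 0 < r →
    ∀ u : E N → ℝ, ContDiff ℝ 1 u → HasCompactSupport u →
      ⨍ y in ccBall X U x r, |u y - ⨍ z in ccBall X U x r, u z| ≤
        CP * r * ⨍ y in ccBall X U x (ν * r), ‖xGrad X u y‖

/-- `u ∈ W₀^{1,q}(Ω,X)` and `G = Xu` is its `X`-gradient: `(u, G)` is a limit in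
`L^q(Ω) × L^q(Ω)^m` of pairs `(φ_k, Xφ_k)` with `φ_k ∈ C^∞_c(Ω)`. (In the setting of the theorem
`‖φ‖_{L^q(Ω)} ≤ c ‖Xφ‖_{L^q(Ω)}` on `C^∞_c(Ω)`, so this is the closure for the norm
`‖Xφ‖_{L^q(Ω)}`, realized as a space of functions.) -/
def IsW0 (X : Fin m → E N → E N) (Ω : Set (E N)) (q : ℝ≥0∞) (u : E N → ℝ) (G : E N → E m) :
    Prop :=
  MemLp u q (volume.restrict Ω) ∧ MemLp G q (volume.restrict Ω) ∧
    ∃ φ : ℕ → E N → ℝ,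
      (∀ k, ContDiff ℝ ∞ (φ k) ∧ HasCompactSupport (φ k) ∧ tsupport (φ k) ⊆ Ω) ∧
      Tendsto (fun k => eLpNorm (fun x => φ k x - u x) q (volume.restrict Ω)) atTop (𝓝 0) ∧
      Tendsto (fun k => eLpNorm (fun x => xGrad X (φ k) x - G x) q (volume.restrict Ω))
        atTop (𝓝 0)

/-- `A` is a bounded measurable matrix field on `Ω` with
`α |η|² ≤ A(x) η · η ≤ β |η|²` for all `η`; it need not be symmetric. -/
structure IsElliptic (Ω : Set (E N)) (α β : ℝ) (A : E N → Matrix (Fin m) (Fin m) ℝ) : Prop where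
  measurable : ∀ i j, AEMeasurable (fun x => A x i j) (volume.restrict Ω)
  bounded : ∃ M : ℝ, ∀ᵐ x ∂(volume.restrict Ω), ∀ i j, |A x i j| ≤ M
  elliptic : ∀ᵐ x ∂(volume.restrict Ω), ∀ η : Fin m → ℝ,
    α * (η ⬝ᵥ η) ≤ (A x *ᵥ η) ⬝ᵥ η ∧ (A x *ᵥ η) ⬝ᵥ η ≤ β * (η ⬝ᵥ η)

/-- `u ∈ W₀^{1,2}(Ω,X)` is a weak solution of `X^*(A Xu) = f` in `Ω`, `u = 0` on `∂Ω`. -/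
def IsWeakSol (X : Fin m → E N → E N) (Ω : Set (E N)) (A : E N → Matrix (Fin m) (Fin m) ℝ)
    (f u : E N → ℝ) : Prop :=
  ∃ G : E N → E m, IsW0 X Ω 2 u G ∧
    ∀ (v : E N → ℝ) (H : E N → E m), IsW0 X Ω 2 v H →
      ∫ x in Ω, (A x *ᵥ (G x).ofLp) ⬝ᵥ (H x).ofLp = ∫ x in Ω, f x * v x

/-- The truncation `T_k` at height `k ≥ 0`. -/
def trunc (k s : ℝ) : ℝ := max (-k) (min k s)

/-- `u` is a solution found by approximation of `X^*(A Xu) = f` in `Ω`, `u = 0` on `∂Ω`: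
if `u_n` is the weak solution with datum `T_n(f)`, then a subsequence of `(u_n)` converges to `u`
in `L¹(Ω)`. -/
def IsApproxSol (X : Fin m → E N → E N) (Ω : Set (E N)) (A : E N → Matrix (Fin m) (Fin m) ℝ)
    (f u : E N → ℝ) : Prop :=
  MemLp u 1 (volume.restrict Ω) ∧
    ∃ un : ℕ → E N → ℝ, (∀ n : ℕ, IsWeakSol X Ω A (fun x => trunc n (f x)) (un n)) ∧
      ∃ κ : ℕ → ℕ, StrictMono κ ∧
        Tendsto (fun n => eLpNorm (fun x => un (κ n) x - u x) 1 (volume.restrict Ω)) atTop (𝓝 0)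

end XElliptic

end

/-! The theorem combines a Sobolev inequality `‖φ‖_{2Q/(Q-2)} ≤ S ‖Xφ‖_2` on test functions with a
nonlinear test-function argument; most of the work goes into the former.

Sobolev inequality. Since `Ω` is bounded for the control distance (`exists_subset_ccBall`),
Poincaré's inequality on the balls of radius `R / 2^i` about `x ∈ Ω` bounds the deviation of `φ x`
from a fixed average by a weighted sum of averages of `|Xφ|`. Hedberg's splitting
(`sum_half_pow_mul_le`) turns the sum into `‖Xφ‖_2^{2/Q} (M|Xφ|)^{1-2/Q}`, and the maximal function
`M` is bounded on `L²` by doubling and Vitali's covering lemma. This proves the inequality up to an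
additive constant `a` (`exists_eLpNorm_sub_const_le`). Comparing with a ball outside `Ω` cannot
remove `a`, because `U = Ω` is allowed. Instead `(φ - a)²` is transported along a subunit path from
a point of `Ω` towards an open set off `Ω`, where it equals `a²`. A shrinking bump and the bounded
divergence of Lipschitz fields control the distortion (`integral_mul_sqPos_le`,
`exists_sq_le_mul_integral`).

A priori estimate. Write `a = 2Q/(Q-2)`, `s = pQ/(Q-2p)`, `q = pQ/(Q-p)`, `I = ∫ (1+u²)^{s/2}` and
`J = ∫ |Xu|² (1+u²)^{γ-1}`, for a datum `g` with `‖g‖_p ≤ 1`. Testing the equation with `u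
(1+u²)^{γ-1}` gives `J ≲ I^{1/p'}`; Sobolev's inequality for `(1+u²)^{γ/2} - 1` gives `I ≲ 1 +
J^{a/2}`. As `a/(2p') < 1` the loop closes, and Hölder's inequality bounds `∫ |Xu|^q`. The exponent
`γ` is the one for which the same power `s` appears each time. Only the lower ellipticity bound
enters the constant, so `β` does not.

Passage to the limit. The equation is linear, so the estimate applies to differences of approximate
solutions: they form a Cauchy sequence together with their gradients. The whole sequence converges,
hence every subsequential `L¹` limit is the limit just found. -/

namespace XElliptic

variable {N m : ℕ}

/-! ### Absolutely continuous paths. -/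

section AbsolutelyContinuous

/-- A Lipschitz function of an absolutely continuous path is absolutely continuous. -/
theorem absolutelyContinuousOnInterval_comp {Y Z : Type*} [PseudoMetricSpace Y]
    [PseudoMetricSpace Z] {γ : ℝ → Y} {h : Y → Z} {K : NNReal} {s : Set Y} {a b : ℝ}
    (hh : LipschitzOnWith K h s) (hγ : AbsolutelyContinuousOnInterval γ a b)
    (hs : ∀ t ∈ uIcc a b, γ t ∈ s) :
    AbsolutelyContinuousOnInterval (fun t => h (γ t)) a b := by
  rw [absolutelyContinuousOnInterval_iff] at hγ ⊢
  intro ε hε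
  -- `K + 1` instead of `K`, since the Lipschitz constant may vanish.
  obtain ⟨δ, hδ, H⟩ := hγ (ε / (K + 1)) (by positivity)
  refine ⟨δ, hδ, fun I hI hIδ => ?_⟩
  have h1 := H I hI hIδ
  rw [lt_div_iff₀ (by positivity)] at h1
  calc ∑ i ∈ Finset.range I.1, dist (h (γ (I.2 i).1)) (h (γ (I.2 i).2))
      ≤ ∑ i ∈ Finset.range I.1, (K + 1) * dist (γ (I.2 i).1) (γ (I.2 i).2) := by
        refine Finset.sum_le_sum fun i hi => ?_
        have h2 := hI.1 i hi
        refine (hh.dist_le_mul _ (hs _ h2.1) _ (hs _ h2.2)).trans ?_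
        gcongr
        simp
    _ = (∑ i ∈ Finset.range I.1, dist (γ (I.2 i).1) (γ (I.2 i).2)) * (K + 1) := by
        rw [← Finset.mul_sum, mul_comm]
    _ < ε := h1

/-- This is the fundamental theorem of calculus for absolutely continuous functions. It serves for
the speed of subunit paths and for the Grönwall step of the transport estimate. -/
theorem sub_le_of_ae_hasDerivAt_le {h : ℝ → ℝ} {a b c : ℝ} (hab : a ≤ b)
    (hh : AbsolutelyContinuousOnInterval h a b)
    (hd : ∀ᵐ t : ℝ, t ∈ Icc a b → ∃ d ≤ c, HasDerivAt h d t) : h b - h a ≤ c * (b - a) := by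
  rw [← hh.integral_deriv_eq_sub]
  have : ∫ _ in a..b, c = c * (b - a) := by simp [mul_comm]
  rw [← this]
  refine intervalIntegral.integral_mono_ae_restrict hab hh.intervalIntegrable_deriv (by simp) ?_
  rw [EventuallyLE, ae_restrict_iff' measurableSet_Icc]
  filter_upwards [hd] with t ht htm
  obtain ⟨d, hdc, hdd⟩ := ht htm
  rwa [hdd.deriv]

/-- Pairing the path with the fixed vector `γ b - γ a` reduces the bound to the scalar case. -/
theorem norm_sub_le_of_ae_hasDerivAt_norm_le {H : Type*} [NormedAddCommGroup H]
    [InnerProductSpace ℝ H] {γ : ℝ → H} {a b M : ℝ} (hab : a ≤ b)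
    (hγ : AbsolutelyContinuousOnInterval γ a b)
    (hd : ∀ᵐ t : ℝ, t ∈ Icc a b → ∃ v, ‖v‖ ≤ M ∧ HasDerivAt γ v t) :
    ‖γ b - γ a‖ ≤ M * (b - a) := by
  set w := γ b - γ a with hw
  have h1 : AbsolutelyContinuousOnInterval (fun t => (innerSL ℝ w) (γ t)) a b :=
    absolutelyContinuousOnInterval_comp ((innerSL ℝ w).lipschitz.lipschitzOnWith (s := univ)) hγ
      fun _ _ => mem_univ _
  have h2 := sub_le_of_ae_hasDerivAt_le (c := ‖w‖ * M) hab h1 (by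
    filter_upwards [hd] with t ht htm
    obtain ⟨v, hv, hvd⟩ := ht htm
    refine ⟨_, ?_, (innerSL ℝ w).hasFDerivAt.comp_hasDerivAt t hvd⟩
    exact (real_inner_le_norm w v).trans (by gcongr))
  have h3 : innerSL ℝ w (γ b) - innerSL ℝ w (γ a) = ‖w‖ * ‖w‖ := by
    rw [← map_sub, ← hw, innerSL_apply_apply, real_inner_self_eq_norm_mul_norm]
  simp only [h3] at h2
  rcases (norm_nonneg w).eq_or_lt with h0 | h0
  -- If the displacement vanishes, only the sign of `M` matters; for `a < b` it is read off at any
  -- time where the bounded derivative exists.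
  · rw [← h0]
    rcases hab.eq_or_lt with rfl | hab'
    · simp
    have : ∃ t, t ∈ Icc a b ∧ (t ∈ Icc a b → ∃ v, ‖v‖ ≤ M ∧ HasDerivAt γ v t) := by
      have h4 : (volume.restrict (Icc a b)) ≠ 0 := by
        rw [Ne, Measure.restrict_eq_zero, Real.volume_Icc]
        simpa using hab'
      have : NeBot (ae (volume.restrict (Icc a b))) := ae_neBot.2 h4
      exact ((ae_restrict_mem measurableSet_Icc).and (ae_restrict_of_ae hd)).exists
    obtain ⟨t, ht, h5⟩ := this
    obtain ⟨v, hv, -⟩ := h5 ht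
    have := (norm_nonneg v).trans hv
    exact mul_nonneg this (by linarith)
  · rw [mul_assoc] at h2
    exact le_of_mul_le_mul_left h2 h0

/-- First hitting time of a level by a continuous function. -/
theorem exists_first_hit {f : ℝ → ℝ} {T c : ℝ} (hT : 0 ≤ T) (hf : ContinuousOn f (Icc 0 T))
    (h0 : f 0 < c) (hc : c ≤ f T) : ∃ t, 0 < t ∧ t ≤ T ∧ f t = c ∧ ∀ s ∈ Icc 0 t, f s ≤ c := by
  set S : Set ℝ := Icc 0 T ∩ f ⁻¹' Ici c with hS
  have hSc : IsClosed S := hf.preimage_isClosed_of_isClosed isClosed_Icc isClosed_Ici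
  have hSne : S.Nonempty := ⟨T, ⟨hT, le_rfl⟩, hc⟩
  have hSb : BddBelow S := ⟨0, fun t ht => ht.1.1⟩
  have hmem := hSc.csInf_mem hSne hSb
  set t := sInf S
  have hpos : 0 < t := by
    rcases hmem.1.1.eq_or_lt with h | h
    · have := hmem.2
      rw [← h] at this
      exact absurd this (not_le.2 h0)
    · exact h
  have hlt : ∀ s ∈ Ico 0 t, f s < c := fun s hs => by
    by_contra hcs
    exact absurd (csInf_le hSb ⟨⟨hs.1, hs.2.le.trans hmem.1.2⟩, not_lt.1 hcs⟩) (not_le.2 hs.2)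
  have hle : f t ≤ c := by
    have hcw : ContinuousWithinAt f (Ico 0 t) t :=
      (hf t hmem.1).mono fun s hs => ⟨hs.1, hs.2.le.trans hmem.1.2⟩
    have : t ∈ closure (Ico 0 t) := by
      rw [closure_Ico hpos.ne]
      exact ⟨hpos.le, le_rfl⟩
    have := mem_closure_iff_nhdsWithin_neBot.1 this
    exact le_of_tendsto hcw (by filter_upwards [self_mem_nhdsWithin] with s hs using (hlt s hs).le)
  refine ⟨t, hpos, hmem.1.2, le_antisymm hle hmem.2, fun s hs => ?_⟩
  rcases hs.2.eq_or_lt with h | h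
  · rwa [h]
  · exact (hlt s ⟨hs.1, h⟩).le

end AbsolutelyContinuous

/-! ### Subunit paths: speed, restriction, reversal, concatenation. -/

section Subunit

variable {X : Fin m → E N → E N} {D : Set (E N)}

theorem norm_sum_smul_le {θ : Fin m → ℝ} (hθ : ∑ j, θ j ^ 2 ≤ 1) (v : Fin m → E N) :
    ‖∑ j, θ j • v j‖ ≤ ∑ j, ‖v j‖ := by
  refine (norm_sum_le _ _).trans (Finset.sum_le_sum fun j _ => ?_)
  rw [norm_smul]
  refine mul_le_of_le_one_left (norm_nonneg _) ?_
  rw [Real.norm_eq_abs, ← sq_le_one_iff_abs_le_one]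
  exact (Finset.single_le_sum (f := fun j => θ j ^ 2) (fun i _ => sq_nonneg _)
    (Finset.mem_univ j)).trans hθ

theorem exists_sum_norm_le (hX : ∀ j, LocallyLipschitz (X j)) {K : Set (E N)} (hK : IsCompact K) :
    ∃ M, 0 < M ∧ ∀ x ∈ K, ∑ j, ‖X j x‖ ≤ M := by
  have hc : Continuous fun x => ∑ j, ‖X j x‖ :=
    continuous_finsetSum _ fun j _ => (hX j).continuous.norm
  obtain ⟨M, hM⟩ := hK.bddAbove_image hc.continuousOn
  exact ⟨max M 1, by positivity, fun x hx => (hM (mem_image_of_mem _ hx)).trans (le_max_left _ _)⟩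

theorem IsSubunit.mono {T S : ℝ} {γ : ℝ → E N} {D' : Set (E N)} (h : IsSubunit X D T γ)
    (hS : 0 ≤ S) (hST : S ≤ T) (hD : ∀ t ∈ Icc 0 S, γ t ∈ D') : IsSubunit X D' S γ := by
  obtain ⟨h1, -, θ, hθ, h3⟩ := h
  refine ⟨h1.mono ?_, hD, θ, hθ, ?_⟩
  · rw [uIcc_of_le hS, uIcc_of_le (hS.trans hST)]
    exact Icc_subset_Icc_right hST
  · filter_upwards [h3] with t ht htm using ht ⟨htm.1, htm.2.trans hST⟩

theorem IsSubunit.continuousOn {T : ℝ} {γ : ℝ → E N} (h : IsSubunit X D T γ) (hT : 0 ≤ T) :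
    ContinuousOn γ (Icc 0 T) := by
  simpa [uIcc_of_le hT] using h.1.continuousOn

theorem IsSubunit.norm_sub_le {T M : ℝ} {γ : ℝ → E N} (h : IsSubunit X D T γ)
    (hM : ∀ t ∈ Icc 0 T, ∑ j, ‖X j (γ t)‖ ≤ M) {s t : ℝ} (hs : 0 ≤ s) (hst : s ≤ t) (ht : t ≤ T) :
    ‖γ t - γ s‖ ≤ M * (t - s) := by
  obtain ⟨h1, -, θ, hθ, h3⟩ := h
  refine norm_sub_le_of_ae_hasDerivAt_norm_le hst (h1.mono ?_) ?_
  · rw [uIcc_of_le hst, uIcc_of_le (by linarith)]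
    exact Icc_subset_Icc hs ht
  · filter_upwards [h3] with r hr hrm
    have hr' : r ∈ Icc 0 T := ⟨hs.trans hrm.1, hrm.2.trans ht⟩
    exact ⟨_, (norm_sum_smul_le (hr hr').1 _).trans (hM r hr'), (hr hr').2⟩

/-- The image of the path is compact and the fields are bounded on it. Having a Lipschitz bound
makes reversal and concatenation easy, since such bounds add up across a junction. -/
theorem IsSubunit.exists_norm_sub_le (hX : ∀ j, LocallyLipschitz (X j)) {T : ℝ} {γ : ℝ → E N}
    (h : IsSubunit X D T γ) (hT : 0 ≤ T) :
    ∃ M, 0 < M ∧ ∀ s t, 0 ≤ s → s ≤ t → t ≤ T → ‖γ t - γ s‖ ≤ M * (t - s) := by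
  obtain ⟨M, hM, hMb⟩ := exists_sum_norm_le hX (isCompact_Icc.image_of_continuousOn
    (h.continuousOn hT))
  exact ⟨M, hM, fun s t hs hst ht => h.norm_sub_le
    (fun r hr => hMb _ (mem_image_of_mem _ hr)) hs hst ht⟩

theorem absolutelyContinuousOnInterval_of_norm_sub_le {γ : ℝ → E N} {T M : ℝ} (hT : 0 ≤ T)
    (hM : 0 < M) (h : ∀ s t, 0 ≤ s → s ≤ t → t ≤ T → ‖γ t - γ s‖ ≤ M * (t - s)) :
    AbsolutelyContinuousOnInterval γ 0 T := by
  refine LipschitzOnWith.absolutelyContinuousOnInterval (K := M.toNNReal) ?_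
  rw [uIcc_of_le hT]
  refine LipschitzOnWith.of_dist_le_mul fun s hs t ht => ?_
  rw [Real.coe_toNNReal _ hM.le]
  rcases le_total s t with hst | hst
  · rw [dist_comm, dist_eq_norm, dist_comm s, Real.dist_eq, abs_of_nonneg (by linarith)]
    exact h s t hs.1 hst ht.2
  · rw [dist_eq_norm, Real.dist_eq, abs_of_nonneg (by linarith)]
    exact h t s ht.1 hst hs.2

theorem IsSubunit.reverse (hX : ∀ j, LocallyLipschitz (X j)) {T : ℝ} {γ : ℝ → E N}
    (h : IsSubunit X D T γ) (hT : 0 ≤ T) : IsSubunit X D T (fun t => γ (T - t)) := by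
  obtain ⟨M, hM, hMb⟩ := h.exists_norm_sub_le hX hT
  obtain ⟨h1, h2, θ, hθ, h3⟩ := h
  refine ⟨absolutelyContinuousOnInterval_of_norm_sub_le hT hM fun s t hs hst ht => ?_,
    fun t ht => h2 _ ⟨by linarith [ht.2], by linarith [ht.1]⟩, fun t j => -θ (T - t) j, ?_, ?_⟩
  · rw [norm_sub_rev]
    refine (hMb (T - t) (T - s) (by linarith) (by linarith) (by linarith)).trans (le_of_eq ?_)
    ring
  · exact measurable_pi_iff.2 fun j =>
      ((measurable_pi_apply j).comp (hθ.comp (measurable_const.sub measurable_id))).neg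
  · have h4 := (Measure.measurePreserving_sub_left (volume : Measure ℝ) T).quasiMeasurePreserving.ae h3
    filter_upwards [h4] with t ht htm
    obtain ⟨h5, h6⟩ := ht ⟨by linarith [htm.2], by linarith [htm.1]⟩
    refine ⟨by simpa using h5, ?_⟩
    have h7 := HasDerivAt.scomp t h6 ((hasDerivAt_id t).const_sub T)
    simpa [Function.comp_def, Finset.sum_neg_distrib] using h7

theorem IsSubunit.concat (hX : ∀ j, LocallyLipschitz (X j)) {S T : ℝ} {γ δ : ℝ → E N}
    (h : IsSubunit X D S γ) (h' : IsSubunit X D T δ) (hS : 0 ≤ S) (hT : 0 ≤ T) (hγδ : γ S = δ 0) :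
    IsSubunit X D (S + T) (fun t => if t ≤ S then γ t else δ (t - S)) := by
  obtain ⟨M, hM, hMb⟩ := h.exists_norm_sub_le hX hS
  obtain ⟨M', hM', hMb'⟩ := h'.exists_norm_sub_le hX hT
  obtain ⟨h1, h2, θ, hθ, h3⟩ := h
  obtain ⟨h1', h2', θ', hθ', h3'⟩ := h'
  refine ⟨absolutelyContinuousOnInterval_of_norm_sub_le (add_nonneg hS hT)
    (lt_max_of_lt_left hM : 0 < max M M') fun s t hs hst ht => ?_, fun t ht => ?_,
    fun t => if t ≤ S then θ t else θ' (t - S), ?_, ?_⟩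
  · by_cases h4 : t ≤ S
    · simp only [h4, hst.trans h4, if_true]
      refine (hMb s t hs hst h4).trans ?_
      gcongr
      exact le_max_left _ _
    · by_cases h5 : s ≤ S
      · simp only [h4, h5, if_true, if_false]
        have h6 := hMb s S hs h5 le_rfl
        have h7 := hMb' 0 (t - S) le_rfl (by linarith) (by linarith)
        have h8 : δ (t - S) - γ s = (δ (t - S) - δ 0) + (γ S - γ s) := by
          rw [hγδ]
          abel
        rw [h8]
        refine (norm_add_le _ _).trans ((add_le_add h7 h6).trans ?_)
        have h9 : M' * (t - S - 0) ≤ max M M' * (t - S) := by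
          rw [sub_zero]
          gcongr
          · linarith
          · exact le_max_right _ _
        have h10 : M * (S - s) ≤ max M M' * (S - s) := by
          gcongr
          exact le_max_left _ _
        linarith
      · simp only [h4, h5, if_false]
        refine (hMb' (s - S) (t - S) (by linarith) (by linarith) (by linarith)).trans ?_
        rw [sub_sub_sub_cancel_right]
        gcongr
        exact le_max_right _ _
  · by_cases h4 : t ≤ S
    · simpa only [h4, if_true] using h2 t ⟨ht.1, h4⟩
    · simpa only [h4, if_false] using h2' (t - S) ⟨by linarith, by linarith [ht.2]⟩
  · exact Measurable.ite measurableSet_Iic hθ (hθ'.comp (measurable_id.sub_const S))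
  · have h4 := (measurePreserving_sub_right (volume : Measure ℝ) S).quasiMeasurePreserving.ae h3'
    have h5 : ∀ᵐ t : ℝ, t ≠ S := by simp [ae_iff]
    filter_upwards [h3, h4, h5] with t ht ht' htS htm
    rcases lt_or_gt_of_ne htS with h6 | h6
    · simp only [h6.le, if_true]
      obtain ⟨h7, h8⟩ := ht ⟨htm.1, h6.le⟩
      refine ⟨h7, h8.congr_of_eventuallyEq ?_⟩
      filter_upwards [gt_mem_nhds h6] with r hr
      simp [hr.le]
    · simp only [not_le.2 h6, if_false]
      obtain ⟨h7, h8⟩ := ht' ⟨by linarith, by linarith [htm.2]⟩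
      refine ⟨h7, ((HasDerivAt.comp_sub_const t S h8)).congr_of_eventuallyEq ?_⟩
      filter_upwards [lt_mem_nhds h6] with r hr
      simp [not_le.2 hr]

end Subunit

/-! ### The control distance. -/

section Distance

variable {X : Fin m → E N → E N}

theorem ccDist_lt_iff {x y : E N} {r : ℝ≥0∞} : ccDist X x y < r ↔
    ∃ T : ℝ, 0 < T ∧ ENNReal.ofReal T < r ∧
      ∃ γ : ℝ → E N, IsSubunit X univ T γ ∧ γ 0 = x ∧ γ T = y := by
  simp only [ccDist, iInf_lt_iff]
  constructor
  · rintro ⟨T, ⟨hT, hγ⟩, h⟩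
    exact ⟨T, hT, h, hγ⟩
  · rintro ⟨T, hT, h, hγ⟩
    exact ⟨T, ⟨hT, hγ⟩, h⟩

theorem ccDist_lt_top {U : Set (E N)} (hU : XConnected X U) {x y : E N} (hx : x ∈ U) (hy : y ∈ U) :
    ccDist X x y < ⊤ := by
  obtain ⟨T, hT, γ, hγ, h0, h1⟩ := hU x hx y hy
  exact ccDist_lt_iff.2 ⟨T, hT, ENNReal.ofReal_lt_top, γ,
    hγ.mono hT.le le_rfl (fun _ _ => mem_univ _), h0, h1⟩

theorem ccDist_self (x : E N) : ccDist X x x = 0 := by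
  refine nonpos_iff_eq_zero.1 (le_of_forall_gt fun r hr => ?_)
  obtain ⟨T, hT, hTr⟩ : ∃ T : ℝ, 0 < T ∧ ENNReal.ofReal T < r := by
    obtain ⟨q, hq, hqr⟩ := ENNReal.lt_iff_exists_nnreal_btwn.1 hr
    exact ⟨q, by simpa using hq, by simpa using hqr⟩
  refine ccDist_lt_iff.2 ⟨T, hT, hTr, fun _ => x, ⟨?_, fun _ _ => mem_univ _, fun _ _ => 0,
    measurable_const, ?_⟩, rfl, rfl⟩
  · exact absolutelyContinuousOnInterval_of_norm_sub_le (M := 1) hT.le one_pos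
      (fun s t _ h _ => by simpa using h)
  · exact Eventually.of_forall fun t _ => ⟨by simp, by simpa using hasDerivAt_const t x⟩

theorem ccDist_comm (hX : ∀ j, LocallyLipschitz (X j)) (x y : E N) :
    ccDist X x y = ccDist X y x := by
  have key : ∀ x y : E N, ccDist X y x ≤ ccDist X x y := fun x y => by
    refine le_of_forall_gt fun r hr => ?_
    obtain ⟨T, hT, hTr, γ, hγ, h0, h1⟩ := ccDist_lt_iff.1 hr
    exact ccDist_lt_iff.2 ⟨T, hT, hTr, _, hγ.reverse hX hT.le, by simpa using h1, by simpa using h0⟩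
  exact le_antisymm (key _ _) (key _ _)

theorem ccDist_triangle (hX : ∀ j, LocallyLipschitz (X j)) (x y z : E N) :
    ccDist X x z ≤ ccDist X x y + ccDist X y z := by
  refine le_of_forall_gt fun r hr => ?_
  obtain ⟨a, b, ha, hb, hab⟩ : ∃ a b, ccDist X x y < a ∧ ccDist X y z < b ∧ a + b ≤ r := by
    obtain ⟨a, ha, h1⟩ := ENNReal.lt_iff_exists_add_pos_lt.1 hr
    have h2 : ccDist X x y ≠ ⊤ := ne_top_of_le_ne_top hr.ne_top le_self_add
    have h3 : ccDist X y z ≠ ⊤ := ne_top_of_le_ne_top hr.ne_top le_add_self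
    have h4 : ((a : ℝ≥0∞) / 2) ≠ 0 := by simpa using ha.ne'
    refine ⟨ccDist X x y + a / 2, ccDist X y z + a / 2, ENNReal.lt_add_right h2 h4,
      ENNReal.lt_add_right h3 h4, le_of_eq_of_le ?_ h1.le⟩
    rw [add_add_add_comm, ENNReal.add_halves]
  obtain ⟨S, hS, hSr, γ, hγ, h0, h1⟩ := ccDist_lt_iff.1 ha
  obtain ⟨T, hT, hTr, δ, hδ, h0', h1'⟩ := ccDist_lt_iff.1 hb
  refine ccDist_lt_iff.2 ⟨S + T, by positivity, ?_, _,
    hγ.concat hX hδ hS.le hT.le (h1.trans h0'.symm), ?_, ?_⟩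
  · rw [ENNReal.ofReal_add hS.le hT.le]
    exact (ENNReal.add_lt_add hSr hTr).trans_le hab
  · simp [hS.le, h0]
  · simp [not_le.2 hT, h1']

/-- Until its first exit from the Euclidean ball of radius `ε` a subunit path has speed at most `M`,
so the exit takes time at least `ε / M`. Control balls therefore shrink to their centre in the
Euclidean sense. -/
theorem exists_norm_sub_lt_of_ccDist_lt (hX : ∀ j, LocallyLipschitz (X j)) (x : E N) {ε : ℝ}
    (hε : 0 < ε) : ∃ r : ℝ, 0 < r ∧ ∀ y, ccDist X x y < ENNReal.ofReal r → ‖y - x‖ < ε := by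
  obtain ⟨M, hM, hMb⟩ := exists_sum_norm_le hX (isCompact_closedBall x ε)
  refine ⟨ε / M, by positivity, fun y hy => ?_⟩
  obtain ⟨T, hT, hTr, γ, hγ, h0, h1⟩ := ccDist_lt_iff.1 hy
  rw [ENNReal.ofReal_lt_ofReal_iff (by positivity), lt_div_iff₀ hM] at hTr
  by_contra hcon
  obtain ⟨t, ht, htT, hte, htl⟩ := exists_first_hit (f := fun t => ‖γ t - x‖) (c := ε) hT.le
    ((hγ.continuousOn hT.le).sub continuousOn_const).norm (by simpa [h0] using hε)
    (by simpa [h1] using not_lt.1 hcon)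
  have hγ' := hγ.mono (D' := univ) ht.le htT (fun _ _ => mem_univ _)
  have h2 := hγ'.norm_sub_le (M := M) (fun s hs => hMb _ (by
    rw [mem_closedBall_iff_norm]; exact htl s hs)) le_rfl ht.le le_rfl
  rw [h0, hte, sub_zero] at h2
  nlinarith

end Distance

/-! ### Control balls: openness, doubling, and boundedness of `Ω`. -/

section Balls

variable {X : Fin m → E N → E N} {U : Set (E N)} {Q : ℝ}

theorem mem_ccBall_self {x : E N} (hx : x ∈ U) {r : ℝ} (hr : 0 < r) : x ∈ ccBall X U x r :=
  ⟨hx, by rw [ccDist_self]; exact ENNReal.ofReal_pos.2 hr⟩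

theorem ccBall_subset_left (x : E N) (r : ℝ) : ccBall X U x r ⊆ U := fun _ h => h.1

theorem ccBall_mono (x : E N) {r s : ℝ} (h : r ≤ s) : ccBall X U x r ⊆ ccBall X U x s :=
  fun _ hy => ⟨hy.1, hy.2.trans_le (ENNReal.ofReal_le_ofReal h)⟩

theorem ccBall_subset_ccBall (hX : ∀ j, LocallyLipschitz (X j)) {x y : E N} {r s : ℝ} (hr : 0 ≤ r)
    (hs : 0 ≤ s) (h : ccDist X x y ≤ ENNReal.ofReal s) : ccBall X U y r ⊆ ccBall X U x (s + r) := by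
  refine fun z hz => ⟨hz.1, (ccDist_triangle hX x y z).trans_lt ?_⟩
  rw [ENNReal.ofReal_add hs hr]
  exact ENNReal.add_lt_add_of_le_of_lt (ne_top_of_le_ne_top ENNReal.ofReal_ne_top h) h hz.2

theorem isOpen_ccBall (hX : ∀ j, LocallyLipschitz (X j)) (hU : IsOpen U)
    (hadm : IsAdmissible X U Q) (x : E N) (r : ℝ) : IsOpen (ccBall X U x r) := by
  rw [isOpen_iff_mem_nhds]
  rintro y ⟨hyU, hy⟩
  have h1 := hadm.equivalent y hyU
  rw [hU.nhdsWithin_eq hyU] at h1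
  filter_upwards [hU.mem_nhds hyU, h1 (gt_mem_nhds (tsub_pos_of_lt hy))] with z hzU hz
  refine ⟨hzU, (ccDist_triangle hX x y z).trans_lt ?_⟩
  rw [add_comm]
  exact lt_tsub_iff_right.1 hz

/-- Openness jointly in centre and point is what makes integrals over moving balls measurable
functions of the centre. -/
theorem isOpen_ccDist_lt (hX : ∀ j, LocallyLipschitz (X j)) (hU : IsOpen U)
    (hadm : IsAdmissible X U Q) (r : ℝ) :
    IsOpen {z : E N × E N | z.1 ∈ U ∧ z.2 ∈ ccBall X U z.1 r} := by
  rw [isOpen_iff_mem_nhds]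
  rintro ⟨x, y⟩ ⟨hxU, hyU, hy⟩
  simp only at hxU hyU hy
  obtain ⟨a, ha, hay⟩ := ENNReal.lt_iff_exists_add_pos_lt.1 hy
  have h2 : (0 : ℝ≥0∞) < a / 2 := by simpa using ha.ne'
  have h1 := hadm.equivalent y hyU
  have h1' := hadm.equivalent x hxU
  rw [hU.nhdsWithin_eq hyU] at h1
  rw [hU.nhdsWithin_eq hxU] at h1'
  rw [nhds_prod_eq]
  filter_upwards [Filter.prod_mem_prod (inter_mem (hU.mem_nhds hxU) (h1' (gt_mem_nhds h2)))
    (inter_mem (hU.mem_nhds hyU) (h1 (gt_mem_nhds h2)))]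
  rintro ⟨x', y'⟩ ⟨⟨hx1, hx2⟩, ⟨hy1, hy2⟩⟩
  refine ⟨hx1, hy1, lt_of_le_of_lt ?_ hay⟩
  have hx2' : ccDist X x x' < a / 2 := hx2
  have hy2' : ccDist X y y' < a / 2 := hy2
  rw [ccDist_comm hX] at hx2'
  calc ccDist X x' y' ≤ ccDist X x' x + (ccDist X x y + ccDist X y y') :=
        (ccDist_triangle hX _ x _).trans (by gcongr; exact ccDist_triangle hX _ _ _)
    _ ≤ a / 2 + (ccDist X x y + a / 2) := by gcongr
    _ = ccDist X x y + a := by rw [add_left_comm, ENNReal.add_halves]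

theorem measure_ccBall_two_pow_le (hadm : IsAdmissible X U Q) {x : E N} (hx : x ∈ U) {r : ℝ}
    (hr : 0 < r) (k : ℕ) : volume (ccBall X U x (2 ^ k * r)) ≤
      ENNReal.ofReal ((2 : ℝ) ^ Q) ^ k * volume (ccBall X U x r) := by
  induction k with
  | zero => simp
  | succ k ih =>
    rw [pow_succ', mul_assoc, pow_succ', mul_assoc]
    exact (hadm.doubling x hx _ (by positivity)).trans (by gcongr)

/-- A small control ball sits inside a Euclidean ball, and doubling carries finiteness to all radii.
-/
theorem measure_ccBall_lt_top (hX : ∀ j, LocallyLipschitz (X j)) (hadm : IsAdmissible X U Q)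
    {x : E N} (hx : x ∈ U) (r : ℝ) : volume (ccBall X U x r) < ⊤ := by
  obtain ⟨s, hs, hsb⟩ := exists_norm_sub_lt_of_ccDist_lt hX x one_pos
  have h1 : volume (ccBall X U x s) < ⊤ := by
    refine (measure_mono fun y hy => ?_).trans_lt (measure_ball_lt_top (x := x) (r := 1))
    rw [mem_ball_iff_norm]
    exact hsb y hy.2
  obtain ⟨k, hk⟩ := pow_unbounded_of_one_lt (r / s) (one_lt_two)
  rw [div_lt_iff₀ hs] at hk
  exact ((measure_mono (ccBall_mono x hk.le)).trans
    (measure_ccBall_two_pow_le hadm hx hs k)).trans_lt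
    (ENNReal.mul_lt_top (ENNReal.pow_lt_top ENNReal.ofReal_lt_top) h1)

/-- The increasing open balls about `x₀` exhaust `U`, so one of them contains the compact closure of
`Ω`. -/
theorem exists_ccDist_lt_of_closure_subset (hX : ∀ j, LocallyLipschitz (X j)) (hU : IsOpen U)
    (hadm : IsAdmissible X U Q) {Ω : Set (E N)} (hΩb : Bornology.IsBounded Ω)
    (hΩU : closure Ω ⊆ U) {x₀ : E N} (hx₀ : x₀ ∈ Ω) :
    ∃ n : ℕ, ∀ y ∈ Ω, ccDist X x₀ y < ENNReal.ofReal n := by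
  obtain ⟨n, hn⟩ := (hΩb.isCompact_closure).elim_directed_cover
    (fun n : ℕ => ccBall X U x₀ n) (fun n => isOpen_ccBall hX hU hadm _ _) (fun y hy => by
      have h1 := ccDist_lt_top hadm.connected (hΩU (subset_closure hx₀)) (hΩU hy)
      obtain ⟨n, hn⟩ := ENNReal.exists_nat_gt h1.ne
      exact mem_iUnion.2 ⟨n, hΩU hy, by simpa using hn⟩)
    (directed_of_isDirected_le fun i j hij => ccBall_mono x₀ (by exact_mod_cast hij))
  exact ⟨n, fun y hy => (hn (subset_closure hy)).2⟩

/-- A doubling space of finite measure is bounded; this is needed when `U = Ω`, where compactness is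
not available. With points `y` at distance `ρ ≥ 2n` from `x₀`, the balls `B(x₀, n)` and `B(y, ρ/2)`
are disjoint and doubling at `y` gives `(K² + 1) |B(x₀, n)| ≤ K² |U|`. Letting `n → ∞` contradicts
`0 < |U| < ∞`. -/
theorem exists_ccDist_lt_of_volume_lt_top (hX : ∀ j, LocallyLipschitz (X j)) (hU : IsOpen U)
    (hadm : IsAdmissible X U Q) (hUv : volume U < ⊤) {x₀ : E N} (hx₀ : x₀ ∈ U) :
    ∃ n : ℕ, ∀ y ∈ U, ccDist X x₀ y < ENNReal.ofReal n := by
  by_contra! hcon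
  set K := ENNReal.ofReal ((2 : ℝ) ^ Q) with hK
  have hmono : Monotone fun n : ℕ => ccBall X U x₀ n :=
    fun i j hij => ccBall_mono x₀ (by exact_mod_cast hij)
  have hun : ⋃ n : ℕ, ccBall X U x₀ n = U := by
    refine subset_antisymm (iUnion_subset fun n => ccBall_subset_left _ _) fun y hy => ?_
    obtain ⟨n, hn⟩ := ENNReal.exists_nat_gt (ccDist_lt_top hadm.connected hx₀ hy).ne
    exact mem_iUnion.2 ⟨n, hy, by simpa using hn⟩
  have hlim := tendsto_measure_iUnion_atTop (μ := volume) hmono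
  rw [hun] at hlim
  have key : ∀ᶠ n : ℕ in atTop,
      K ^ 2 * volume (ccBall X U x₀ n) + volume (ccBall X U x₀ n) ≤ K ^ 2 * volume U := by
    filter_upwards [eventually_ge_atTop 1] with n hn
    obtain ⟨y, hyU, hy⟩ := hcon (2 * n)
    have hfin := ccDist_lt_top hadm.connected hx₀ hyU
    set ρ := (ccDist X x₀ y).toReal with hρ
    have hρd : ccDist X x₀ y = ENNReal.ofReal ρ := (ENNReal.ofReal_toReal hfin.ne).symm
    have hnpos : (1 : ℝ) ≤ n := by exact_mod_cast hn
    have hρn : 2 * (n : ℝ) ≤ ρ := by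
      rw [hρd, ENNReal.ofReal_le_ofReal_iff ENNReal.toReal_nonneg] at hy
      simpa using hy
    have hdisj : Disjoint (ccBall X U x₀ n) (ccBall X U y (ρ / 2)) := by
      rw [Set.disjoint_left]
      rintro z ⟨-, hz1⟩ ⟨-, hz2⟩
      have h3 := ccDist_triangle hX x₀ z y
      rw [ccDist_comm hX z y, hρd] at h3
      have h4 := h3.trans_lt (ENNReal.add_lt_add hz1 hz2)
      rw [← ENNReal.ofReal_add (by positivity) (by positivity),
        ENNReal.ofReal_lt_ofReal_iff (by positivity)] at h4
      linarith
    -- `ρ + n ≤ 2ρ = 4 · (ρ/2)`, hence two doublings.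
    have h5 : volume (ccBall X U x₀ n) ≤ K ^ 2 * volume (ccBall X U y (ρ / 2)) := by
      refine (measure_mono ?_).trans (measure_ccBall_two_pow_le hadm hyU (by linarith) 2)
      refine (ccBall_subset_ccBall hX (by positivity) ENNReal.toReal_nonneg
        (le_of_eq ((ccDist_comm hX y x₀).trans hρd))).trans (ccBall_mono y ?_)
      linarith
    calc K ^ 2 * volume (ccBall X U x₀ n) + volume (ccBall X U x₀ n)
        ≤ K ^ 2 * volume (ccBall X U x₀ n) + K ^ 2 * volume (ccBall X U y (ρ / 2)) := by gcongr
      _ = K ^ 2 * volume (ccBall X U x₀ n ∪ ccBall X U y (ρ / 2)) := by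
        rw [measure_union hdisj (isOpen_ccBall hX hU hadm _ _).measurableSet, mul_add]
      _ ≤ K ^ 2 * volume U := by
        gcongr
        exact union_subset (ccBall_subset_left _ _) (ccBall_subset_left _ _)
  have hK2 : K ^ 2 ≠ ⊤ := (ENNReal.pow_lt_top ENNReal.ofReal_lt_top).ne
  have hfinal := le_of_tendsto
    ((ENNReal.Tendsto.const_mul hlim (Or.inr hK2)).add hlim) key
  have hpos : 0 < volume U :=
    (hadm.ball_pos x₀ hx₀ 1 one_pos).trans_le (measure_mono (ccBall_subset_left _ _))
  exact absurd hfinal (not_le.2 (ENNReal.lt_add_right (ENNReal.mul_lt_top hK2.lt_top hUv).ne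
    hpos.ne'))

/-- The set `Ω` is bounded for the control distance. -/
theorem exists_subset_ccBall (hX : ∀ j, LocallyLipschitz (X j)) (hU : IsOpen U)
    (hadm : IsAdmissible X U Q) {Ω : Set (E N)} (hΩb : Bornology.IsBounded Ω)
    (hΩU : U = Ω ∨ closure Ω ⊆ U) :
    ∃ R : ℝ, 0 < R ∧ ∀ x ∈ Ω, ∀ y ∈ Ω, ccDist X x y < ENNReal.ofReal R := by
  rcases Ω.eq_empty_or_nonempty with rfl | ⟨x₀, hx₀⟩
  · exact ⟨1, one_pos, by simp⟩
  obtain ⟨n, hn⟩ : ∃ n : ℕ, ∀ y ∈ Ω, ccDist X x₀ y < ENNReal.ofReal n := by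
    rcases hΩU with rfl | h
    · exact exists_ccDist_lt_of_volume_lt_top hX hU hadm hΩb.measure_lt_top hx₀
    · exact exists_ccDist_lt_of_closure_subset hX hU hadm hΩb h hx₀
  have hn0 : (0 : ℝ) < n := by
    have := zero_le.trans_lt (hn x₀ hx₀)
    exact ENNReal.ofReal_pos.1 this
  refine ⟨n + n, by positivity, fun x hx y hy => ?_⟩
  rw [ENNReal.ofReal_add hn0.le hn0.le]
  refine (ccDist_triangle hX x x₀ y).trans_lt (ENNReal.add_lt_add ?_ (hn y hy))
  rw [ccDist_comm hX]
  exact hn x hx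

theorem subset_of_eq_or_closure_subset {Ω : Set (E N)} (hΩU : U = Ω ∨ closure Ω ⊆ U) : Ω ⊆ U := by
  rcases hΩU with rfl | h
  · exact subset_rfl
  · exact subset_closure.trans h

end Balls

/-! ### The maximal function: weak type (1,1) and boundedness on `L²`. -/

section Maximal

variable {X : Fin m → E N → E N} {U : Set (E N)} {Q : ℝ}

/-- The maximal function over the control balls of radii `R / 2 ^ i`. -/
noncomputable def maxFn (X : Fin m → E N → E N) (U : Set (E N)) (R : ℝ) (g : E N → ℝ≥0∞)
    (x : E N) : ℝ≥0∞ :=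
  ⨆ i : ℕ, (∫⁻ y in ccBall X U x (R / 2 ^ i), g y) / volume (ccBall X U x (R / 2 ^ i))

/-- Tonelli's theorem on the open set of pairs whose second entry lies in the ball about the first.
The indicator of `U` is there because openness of balls is only known for centres in `U`. -/
theorem measurable_indicator_lintegral_ccBall (hX : ∀ j, LocallyLipschitz (X j)) (hU : IsOpen U)
    (hadm : IsAdmissible X U Q) (r : ℝ) {g : E N → ℝ≥0∞} (hg : Measurable g) :
    Measurable (U.indicator fun x => ∫⁻ y in ccBall X U x r, g y) := by
  have hS := (isOpen_ccDist_lt hX hU hadm r).measurableSet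
  have h1 : Measurable fun x => ∫⁻ y,
      {z : E N × E N | z.1 ∈ U ∧ z.2 ∈ ccBall X U z.1 r}.indicator (fun z => g z.2) (x, y) :=
    ((hg.comp measurable_snd).indicator hS).lintegral_prod_right'
  convert h1 using 1
  ext x
  by_cases hx : x ∈ U
  · rw [indicator_of_mem hx, ← lintegral_indicator (isOpen_ccBall hX hU hadm x r).measurableSet]
    congr 1
    ext y
    by_cases hy : y ∈ ccBall X U x r <;> simp [indicator, hx, hy]
  · simp [hx]

theorem measurable_indicator_maxFn (hX : ∀ j, LocallyLipschitz (X j)) (hU : IsOpen U)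
    (hadm : IsAdmissible X U Q) (R : ℝ) {g : E N → ℝ≥0∞} (hg : Measurable g) :
    Measurable (U.indicator (maxFn X U R g)) := by
  have h1 : U.indicator (maxFn X U R g) = fun x => ⨆ i : ℕ,
      (U.indicator (fun x => ∫⁻ y in ccBall X U x (R / 2 ^ i), g y) x) /
        (U.indicator (fun x => ∫⁻ _ in ccBall X U x (R / 2 ^ i), 1) x) := by
    ext x
    by_cases hx : x ∈ U
    · simp [hx, maxFn]
    · simp [hx]
  rw [h1]
  exact Measurable.iSup fun i => (measurable_indicator_lintegral_ccBall hX hU hadm _ hg).div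
    (measurable_indicator_lintegral_ccBall hX hU hadm _ measurable_const)

/-- The maximal function is of weak type `(1,1)`. -/
theorem mul_measure_maxFn_lt_le (hX : ∀ j, LocallyLipschitz (X j)) (hU : IsOpen U)
    (hadm : IsAdmissible X U Q) {R : ℝ} (hR : 0 < R) (g : E N → ℝ≥0∞) (t : ℝ≥0∞) :
    t * volume (U ∩ {x | t < maxFn X U R g x}) ≤
      ENNReal.ofReal ((2 : ℝ) ^ Q) ^ 3 * ∫⁻ y, g y := by
  set K := ENNReal.ofReal ((2 : ℝ) ^ Q) with hK
  set S := U ∩ {x | t < maxFn X U R g x} with hS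
  have h1 : ∀ x, ∃ i : ℕ, x ∈ S →
      t * volume (ccBall X U x (R / 2 ^ i)) ≤ ∫⁻ y in ccBall X U x (R / 2 ^ i), g y := fun x => by
    by_cases hx : x ∈ S
    · obtain ⟨i, hi⟩ := lt_iSup_iff.1 (show t < maxFn X U R g x from hx.2)
      exact ⟨i, fun _ => ENNReal.mul_le_of_le_div hi.le⟩
    · exact ⟨0, fun h => absurd h hx⟩
  choose i hi using h1
  set δ : E N → ℝ := fun x => R / 2 ^ i x with hδ
  have hδpos : ∀ x, 0 < δ x := fun x => by positivity
  set B : E N → Set (E N) := fun x => ccBall X U x (δ x) with hB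
  -- With enlargement factor `2`, each `a ∈ S` has a selected `b` whose ball meets that of `a` and
  -- with `δ a ≤ 2 δ b`. So the distance from `b` to `a` is less than `3 δ b`, well within the ball
  -- enlarged `2^3` times.
  obtain ⟨u, huS, hud, huc⟩ := Vitali.exists_disjoint_subfamily_covering_enlargement B S δ 2
    one_lt_two (fun x _ => (hδpos x).le) R
    (fun x _ => div_le_self hR.le (one_le_pow₀ one_le_two))
    (fun x hx => ⟨x, mem_ccBall_self hx.1 (hδpos x)⟩)
  have hBo : ∀ x, IsOpen (B x) := fun x => isOpen_ccBall hX hU hadm _ _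
  have hcount : u.Countable := hud.countable_of_isOpen (fun x _ => hBo x)
    (fun x hx => ⟨x, mem_ccBall_self (huS hx).1 (hδpos x)⟩)
  have hcov : S ⊆ ⋃ b ∈ u, ccBall X U b (2 ^ 3 * δ b) := fun a ha => by
    obtain ⟨b, hb, ⟨z, hza, hzb⟩, hab⟩ := huc a ha
    refine mem_biUnion hb ⟨ha.1, ?_⟩
    have h2 := hza.2
    rw [ccDist_comm hX] at h2
    refine ((ccDist_triangle hX b z a).trans_lt (ENNReal.add_lt_add hzb.2 h2)).trans_le ?_
    rw [← ENNReal.ofReal_add (hδpos b).le (hδpos a).le]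
    exact ENNReal.ofReal_le_ofReal (by linarith [hδpos b])
  calc t * volume S ≤ t * ∑' b : u, volume (ccBall X U (b : E N) (2 ^ 3 * δ b)) := by
        gcongr
        exact (measure_mono hcov).trans (measure_biUnion_le volume hcount _)
    _ ≤ t * ∑' b : u, K ^ 3 * volume (B b) := by
        gcongr with b
        exact measure_ccBall_two_pow_le hadm (huS b.2).1 (hδpos b) 3
    _ = K ^ 3 * ∑' b : u, t * volume (B b) := by
        rw [ENNReal.tsum_mul_left, ENNReal.tsum_mul_left, mul_left_comm]
    _ ≤ K ^ 3 * ∑' b : u, ∫⁻ y in B b, g y := by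
        gcongr with b
        exact hi b (huS b.2)
    _ = K ^ 3 * ∫⁻ y in ⋃ b ∈ u, B b, g y := by
        rw [lintegral_biUnion hcount (fun b _ => (hBo b).measurableSet) hud]
    _ ≤ K ^ 3 * ∫⁻ y, g y := by
        gcongr
        exact Measure.restrict_le_self

/-- For bounded `g` this guarantees that the maximal function is finite and may be read as a real
number. -/
theorem maxFn_le (hX : ∀ j, LocallyLipschitz (X j)) (hadm : IsAdmissible X U Q) {R : ℝ}
    (hR : 0 < R) {x : E N} (hx : x ∈ U) {g : E N → ℝ≥0∞} {c : ℝ≥0∞} (hg : ∀ y, g y ≤ c) :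
    maxFn X U R g x ≤ c := by
  refine iSup_le fun i => ?_
  have h0 := hadm.ball_pos x hx (R / 2 ^ i) (by positivity)
  have h1 := measure_ccBall_lt_top hX hadm hx (R / 2 ^ i)
  refine (ENNReal.div_le_iff h0.ne' h1.ne).2 ?_
  calc ∫⁻ y in ccBall X U x (R / 2 ^ i), g y ≤ ∫⁻ _ in ccBall X U x (R / 2 ^ i), c :=
        lintegral_mono hg
    _ = c * volume (ccBall X U x (R / 2 ^ i)) := by simp

/-- Off its large values, `g` contributes little to the maximal function. -/
theorem mul_measure_maxFn_lt_le_lintegral (hX : ∀ j, LocallyLipschitz (X j)) (hU : IsOpen U)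
    (hadm : IsAdmissible X U Q) {R : ℝ} (hR : 0 < R) (g : E N → ℝ≥0∞) (t : ℝ≥0∞) :
    t * volume (U ∩ {x | 2 * t < maxFn X U R g x}) ≤
      ENNReal.ofReal ((2 : ℝ) ^ Q) ^ 3 * ∫⁻ y, {y | t < g y}.indicator g y := by
  refine le_trans ?_ (mul_measure_maxFn_lt_le hX hU hadm hR ({y | t < g y}.indicator g) t)
  gcongr t * volume ?_
  refine fun x hx => ⟨hx.1, ?_⟩
  obtain ⟨i, hi⟩ := lt_iSup_iff.1 (show 2 * t < maxFn X U R g x from hx.2)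
  refine lt_of_lt_of_le ?_ (le_iSup (fun i : ℕ => (∫⁻ y in ccBall X U x (R / 2 ^ i),
    {y | t < g y}.indicator g y) / volume (ccBall X U x (R / 2 ^ i))) i)
  set B := ccBall X U x (R / 2 ^ i)
  have h0 : volume B ≠ 0 := (hadm.ball_pos x hx.1 (R / 2 ^ i) (by positivity)).ne'
  have h1 : volume B ≠ ⊤ := (measure_ccBall_lt_top hX hadm hx.1 (R / 2 ^ i)).ne
  rw [ENNReal.lt_div_iff_mul_lt (Or.inl h0) (Or.inl h1)] at hi ⊢
  by_contra hcon
  refine absurd hi (not_lt.2 ?_)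
  calc ∫⁻ y in B, g y ≤ ∫⁻ y in B, ({y | t < g y}.indicator g y + t) := by
        refine lintegral_mono fun y => ?_
        by_cases hy : t < g y
        · simp [indicator, hy]
        · simpa [indicator, hy] using not_lt.1 hy
    _ = (∫⁻ y in B, {y | t < g y}.indicator g y) + t * volume B := by
        rw [lintegral_add_right _ measurable_const]
        simp
    _ ≤ t * volume B + t * volume B := by gcongr; exact not_lt.1 hcon
    _ = 2 * t * volume B := by ring

/-- The maximal function is bounded on `L²`. -/
theorem lintegral_maxFn_sq_le (hX : ∀ j, LocallyLipschitz (X j)) (hU : IsOpen U)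
    (hadm : IsAdmissible X U Q) {R : ℝ} (hR : 0 < R) {g : E N → ℝ} (hg : Measurable g) {c : ℝ}
    (hg0 : ∀ y, 0 ≤ g y) (hgc : ∀ y, g y ≤ c) :
    ∫⁻ x in U, maxFn X U R (fun y => ENNReal.ofReal (g y)) x ^ 2 ≤
      8 * ENNReal.ofReal ((2 : ℝ) ^ Q) ^ 3 * ∫⁻ y, ENNReal.ofReal (g y ^ 2) := by
  set K := ENNReal.ofReal ((2 : ℝ) ^ Q) with hK
  set M := maxFn X U R (fun y => ENNReal.ofReal (g y)) with hM
  set f : E N → ℝ := fun x => (U.indicator M x).toReal with hf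
  have hfm : Measurable f := (measurable_indicator_maxFn hX hU hadm R hg.ennreal_ofReal).ennreal_toReal
  have hfin : ∀ x ∈ U, M x ≠ ⊤ := fun x hx => ne_top_of_le_ne_top ENNReal.ofReal_ne_top
    (maxFn_le hX hadm hR hx fun y => ENNReal.ofReal_le_ofReal (hgc y))
  have h1 : ∫⁻ x in U, M x ^ 2 = ∫⁻ x in U, ENNReal.ofReal (f x ^ (2 : ℝ)) := by
    refine setLIntegral_congr_fun hU.measurableSet fun x hx => ?_
    simp only [hf, indicator_of_mem hx]
    rw [Real.rpow_two, ENNReal.ofReal_pow ENNReal.toReal_nonneg, ENNReal.ofReal_toReal (hfin x hx)]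
  -- For fixed `y` the integrand, as a function of `t`, is `g y` on `(0, 2 g y)` and zero beyond,
  -- with integral `2 (g y)²`.
  have hswap : ∫⁻ t in Ioi (0 : ℝ), ∫⁻ y, {y | ENNReal.ofReal (t / 2) < ENNReal.ofReal (g y)}.indicator
      (fun y => ENNReal.ofReal (g y)) y = 2 * ∫⁻ y, ENNReal.ofReal (g y ^ 2) := by
    rw [lintegral_lintegral_swap]
    · rw [← lintegral_const_mul _ (hg.pow_const 2).ennreal_ofReal]
      refine lintegral_congr fun y => ?_
      have h2 : ∀ t ∈ Ioi (0 : ℝ),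
          {y | ENNReal.ofReal (t / 2) < ENNReal.ofReal (g y)}.indicator
            (fun y => ENNReal.ofReal (g y)) y =
          (Iio (2 * g y)).indicator (fun _ => ENNReal.ofReal (g y)) t := fun t ht => by
        have h3 : ENNReal.ofReal (t / 2) < ENNReal.ofReal (g y) ↔ t < 2 * g y := by
          rw [ENNReal.ofReal_lt_ofReal_iff_of_nonneg (by
            have : 0 < t := ht
            positivity)]
          constructor <;> intro h <;> linarith
        simp [indicator, h3]
      rw [setLIntegral_congr_fun measurableSet_Ioi h2, lintegral_indicator measurableSet_Iio,
        Measure.restrict_restrict measurableSet_Iio, lintegral_const, Measure.restrict_apply_univ,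
        Iio_inter_Ioi, Real.volume_Ioo, sub_zero, ← ENNReal.ofReal_mul (hg0 y),
        ← ENNReal.ofReal_ofNat, ← ENNReal.ofReal_mul (by norm_num)]
      congr 1
      ring
    · refine Measurable.aemeasurable ?_
      have h4 : MeasurableSet {z : ℝ × E N | ENNReal.ofReal (z.1 / 2) < ENNReal.ofReal (g z.2)} :=
        measurableSet_lt (measurable_fst.div_const 2).ennreal_ofReal
          (hg.comp measurable_snd).ennreal_ofReal
      exact ((hg.comp measurable_snd).ennreal_ofReal.indicator h4 :)
  -- Layer-cake formula; at height `t` the weak bound is applied to the part of `g` above `t/2`. The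
  -- constant `8` is the product of the layer-cake factor, the factor in `t = 2 (t/2)`, and the
  -- factor in `hswap`.
  rw [h1, lintegral_rpow_eq_lintegral_meas_lt_mul _ (Eventually.of_forall fun x =>
    ENNReal.toReal_nonneg) hfm.aemeasurable two_pos]
  calc ENNReal.ofReal 2 * ∫⁻ t in Ioi 0, (volume.restrict U) {a | t < f a} *
        ENNReal.ofReal (t ^ ((2 : ℝ) - 1))
      ≤ ENNReal.ofReal 2 * ∫⁻ t in Ioi (0 : ℝ), 2 * K ^ 3 * ∫⁻ y,
          {y | ENNReal.ofReal (t / 2) < ENNReal.ofReal (g y)}.indicator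
            (fun y => ENNReal.ofReal (g y)) y := by
        gcongr ENNReal.ofReal 2 * ?_
        refine setLIntegral_mono' measurableSet_Ioi fun t ht => ?_
        have ht0 : (0 : ℝ) < t := ht
        have h5 := mul_measure_maxFn_lt_le_lintegral hX hU hadm hR
          (fun y => ENNReal.ofReal (g y)) (ENNReal.ofReal (t / 2))
        have h6 : (2 : ℝ≥0∞) * ENNReal.ofReal (t / 2) = ENNReal.ofReal t := by
          rw [← ENNReal.ofReal_ofNat, ← ENNReal.ofReal_mul (by norm_num)]
          congr 1
          ring
        have h7 : (volume.restrict U) {a | t < f a} ≤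
            volume (U ∩ {x | 2 * ENNReal.ofReal (t / 2) < M x}) := by
          rw [Measure.restrict_apply (measurableSet_lt measurable_const hfm), h6]
          refine measure_mono fun x hx => ⟨hx.2, ?_⟩
          have h8 : t < (U.indicator M x).toReal := hx.1
          rw [indicator_of_mem hx.2] at h8
          exact (ENNReal.ofReal_lt_iff_lt_toReal ht0.le (hfin x hx.2)).2 h8
        have h9 : t ^ ((2 : ℝ) - 1) = t := by norm_num
        rw [h9, mul_assoc, ← h6]
        calc (volume.restrict U) {a | t < f a} * (2 * ENNReal.ofReal (t / 2))
            ≤ volume (U ∩ {x | 2 * ENNReal.ofReal (t / 2) < M x}) *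
              (2 * ENNReal.ofReal (t / 2)) := by gcongr
          _ = 2 * (ENNReal.ofReal (t / 2) *
              volume (U ∩ {x | 2 * ENNReal.ofReal (t / 2) < M x})) := by ring
          _ ≤ _ := by gcongr
    _ = 8 * K ^ 3 * ∫⁻ y, ENNReal.ofReal (g y ^ 2) := by
        rw [lintegral_const_mul', hswap, ENNReal.ofReal_ofNat]
        · ring
        · exact ENNReal.mul_ne_top (by norm_num) (ENNReal.pow_lt_top ENNReal.ofReal_lt_top).ne

end Maximal

/-! ### Hedberg's summation, averages over control balls, test-function gradients. -/

section Telescoping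

/-- Summation step of Hedberg's inequality. -/
theorem sum_half_pow_mul_le {q θ A M : ℝ} (hq : 1 < q) (hθ1 : θ < 1)
    (hqθ : q ^ θ = 2) (hA : 0 < A) (hM : 0 < M) {a : ℕ → ℝ} (ha : ∀ i, 0 ≤ a i)
    (haA : ∀ i, a i ≤ A * q ^ i) (haM : ∀ i, a i ≤ M) (n : ℕ) :
    ∑ i ∈ Finset.range n, a i / 2 ^ i ≤
      ((q / 2) / (q / 2 - 1) + 2) * (A ^ θ * M ^ (1 - θ)) := by
  have hq0 : 0 < q := one_pos.trans hq
  have hb : 1 < q / 2 := by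
    rw [lt_div_iff₀ two_pos, one_mul, ← hqθ]
    calc q ^ θ < q ^ (1 : ℝ) := Real.rpow_lt_rpow_of_exponent_lt hq hθ1
      _ = q := Real.rpow_one q
  have hbθ : q / 2 = q ^ (1 - θ) := by rw [Real.rpow_sub hq0, Real.rpow_one, hqθ]
  set D := A ^ θ * M ^ (1 - θ) with hD
  have hD0 : 0 < D := by positivity
  obtain ⟨n0, hn0⟩ := pow_unbounded_of_one_lt (M / A) hq
  -- Let `k` be the first index at which `A q^k` reaches `M`. Before it the terms are at most `A
  -- (q/2)^i`, a growing geometric sequence dominated by its last member; from it on they are at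
  -- most `M / 2^i`. Both pieces are controlled by the crossover value, which `q^θ = 2` identifies
  -- as `A^θ M^{1-θ}`.
  have hex : ∃ k : ℕ, M ≤ A * q ^ k := ⟨n0, by
    rw [div_lt_iff₀ hA] at hn0
    linarith⟩
  classical
  set k := Nat.find hex with hk
  have hk1 : M ≤ A * q ^ k := Nat.find_spec hex
  have hfirst : ∑ i ∈ Finset.range k, a i / 2 ^ i ≤ (q / 2) / (q / 2 - 1) * D := by
    rcases Nat.eq_zero_or_pos k with h0 | hpos
    · rw [h0]
      simp only [Finset.range_zero, Finset.sum_empty]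
      have : 0 < q / 2 - 1 := by linarith
      positivity
    · obtain ⟨j, hj⟩ := Nat.exists_eq_succ_of_ne_zero hpos.ne'
      have hj1 : A * q ^ j < M := not_le.1 (Nat.find_min hex (by omega))
      have hj2 : A * (q / 2) ^ j ≤ D := by
        calc A * (q / 2) ^ j = A ^ θ * (A * q ^ j) ^ (1 - θ) := by
              rw [Real.mul_rpow hA.le (by positivity), ← mul_assoc, ← Real.rpow_add hA,
                add_sub_cancel, Real.rpow_one, hbθ, ← Real.rpow_natCast, ← Real.rpow_natCast,
                ← Real.rpow_mul hq0.le, ← Real.rpow_mul hq0.le, mul_comm (1 - θ)]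
          _ ≤ D := by
              rw [hD]
              gcongr
      calc ∑ i ∈ Finset.range k, a i / 2 ^ i ≤ ∑ i ∈ Finset.range k, A * (q / 2) ^ i := by
            refine Finset.sum_le_sum fun i _ => ?_
            rw [div_pow, ← mul_div_assoc]
            gcongr
            exact haA i
        _ = A * (((q / 2) ^ k - 1) / (q / 2 - 1)) := by
            rw [← Finset.mul_sum, geom_sum_eq hb.ne']
        _ ≤ A * ((q / 2) ^ k / (q / 2 - 1)) := by
            have : 0 < q / 2 - 1 := by linarith
            gcongr
            linarith
        _ = (q / 2) / (q / 2 - 1) * (A * (q / 2) ^ j) := by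
            rw [hj, pow_succ]
            ring
        _ ≤ _ := by
            have : 0 < q / 2 - 1 := by linarith
            gcongr
  have hsecond : ∑ i ∈ Finset.range n, a (k + i) / 2 ^ (k + i) ≤ 2 * D := by
    have h1 : M / 2 ^ k ≤ D := by
      have h2 : M / 2 ^ k = M * (q ^ k) ^ (-θ) := by
        rw [Real.rpow_neg (by positivity), ← Real.rpow_natCast q, ← Real.rpow_mul hq0.le,
          mul_comm (k : ℝ), Real.rpow_mul hq0.le, hqθ, Real.rpow_natCast]
        rfl
      have h3 : D = M * (M / A) ^ (-θ) := by
        rw [hD, Real.div_rpow hM.le hA.le, Real.rpow_sub hM, Real.rpow_neg hM.le,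
          Real.rpow_neg hA.le, Real.rpow_one]
        field_simp
      rw [h2, h3]
      have hθ : 0 < θ := by
        by_contra hcon
        have := Real.rpow_le_one_of_one_le_of_nonpos hq.le (not_lt.1 hcon)
        linarith
      gcongr M * ?_
      refine Real.rpow_le_rpow_of_nonpos (by positivity) ?_ (by linarith)
      rw [div_le_iff₀ hA]
      linarith
    calc ∑ i ∈ Finset.range n, a (k + i) / 2 ^ (k + i)
        ≤ ∑ i ∈ Finset.range n, M / 2 ^ k * (1 / 2) ^ i := by
          refine Finset.sum_le_sum fun i _ => ?_
          rw [one_div, inv_pow, ← div_eq_mul_inv, div_div, ← pow_add]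
          gcongr
          exact haM _
      _ = M / 2 ^ k * ∑ i ∈ Finset.range n, (1 / 2) ^ i := by rw [Finset.mul_sum]
      _ ≤ D * 2 := by
          gcongr
          exact sum_geometric_two_le n
      _ = 2 * D := mul_comm _ _
  calc ∑ i ∈ Finset.range n, a i / 2 ^ i ≤ ∑ i ∈ Finset.range (k + n), a i / 2 ^ i :=
        Finset.sum_le_sum_of_subset_of_nonneg (Finset.range_subset_range.2 (by omega))
          fun i _ _ => by have := ha i; positivity
    _ = ∑ i ∈ Finset.range k, a i / 2 ^ i + ∑ i ∈ Finset.range n, a (k + i) / 2 ^ (k + i) :=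
        Finset.sum_range_add _ _ _
    _ ≤ _ := by
        rw [add_mul]
        exact add_le_add hfirst hsecond

theorem sum_half_pow_mul_le_of_nonneg {q θ A M : ℝ} (hq : 1 < q) (hθ0 : 0 < θ) (hθ1 : θ < 1)
    (hqθ : q ^ θ = 2) (hA : 0 ≤ A) (hM : 0 ≤ M) {a : ℕ → ℝ} (ha : ∀ i, 0 ≤ a i)
    (haA : ∀ i, a i ≤ A * q ^ i) (haM : ∀ i, a i ≤ M) (n : ℕ) :
    ∑ i ∈ Finset.range n, a i / 2 ^ i ≤
      ((q / 2) / (q / 2 - 1) + 2) * (A ^ θ * M ^ (1 - θ)) := by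
  rcases hA.eq_or_lt with rfl | hA'
  · have h0 : ∀ i, a i = 0 := fun i => le_antisymm (by simpa using haA i) (ha i)
    simp [h0, Real.zero_rpow hθ0.ne']
  rcases hM.eq_or_lt with rfl | hM'
  · have h0 : ∀ i, a i = 0 := fun i => le_antisymm (haM i) (ha i)
    have h1 : 1 - θ ≠ 0 := by linarith
    simp [h0, Real.zero_rpow h1]
  · exact sum_half_pow_mul_le hq hθ1 hqθ hA' hM' ha haA haM n

theorem setAverage_le_mul_setAverage {α : Type*} [MeasurableSpace α] {μ : Measure α} {A B : Set α}
    {h : α → ℝ} {K : ℝ} (hAB : A ⊆ B) (hA : 0 < μ.real A)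
    (hK : μ.real B ≤ K * μ.real A) (hh : IntegrableOn h B μ) (h0 : ∀ x, 0 ≤ h x) (hB : 0 < μ.real B) :
    ⨍ x in A, h x ∂μ ≤ K * ⨍ x in B, h x ∂μ := by
  rw [setAverage_eq, setAverage_eq, smul_eq_mul, smul_eq_mul]
  have h1 : ∫ x in A, h x ∂μ ≤ ∫ x in B, h x ∂μ :=
    setIntegral_mono_set hh (Eventually.of_forall h0) hAB.eventuallyLE
  have h2 : 0 ≤ ∫ x in B, h x ∂μ := setIntegral_nonneg_of_ae (Eventually.of_forall h0)
  calc (μ.real A)⁻¹ * ∫ x in A, h x ∂μ ≤ (μ.real A)⁻¹ * ∫ x in B, h x ∂μ := by gcongr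
    _ ≤ (K * (μ.real B)⁻¹) * ∫ x in B, h x ∂μ := by
        gcongr
        rw [inv_le_iff_one_le_mul₀ hA]
        calc 1 = μ.real B * (μ.real B)⁻¹ := (mul_inv_cancel₀ hB.ne').symm
          _ ≤ K * μ.real A * (μ.real B)⁻¹ := by gcongr
          _ = K * (μ.real B)⁻¹ * μ.real A := by ring
    _ = K * ((μ.real B)⁻¹ * ∫ x in B, h x ∂μ) := by ring

theorem abs_setAverage_sub_le {α : Type*} [MeasurableSpace α] {μ : Measure α} {A : Set α}
    {h : α → ℝ} (hA : μ.real A ≠ 0) (hh : IntegrableOn h A μ) (c : ℝ) :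
    |⨍ x in A, h x ∂μ - c| ≤ ⨍ x in A, |h x - c| ∂μ := by
  have hfin : μ A ≠ ⊤ := fun h => hA (by simp [measureReal_def, h])
  have h1 : ⨍ x in A, h x ∂μ - c = ⨍ x in A, (h x - c) ∂μ := by
    rw [setAverage_eq, setAverage_eq, integral_sub hh (integrableOn_const hfin)]
    simp only [smul_eq_mul, setIntegral_const]
    field_simp
  rw [h1, setAverage_eq, setAverage_eq, smul_eq_mul, smul_eq_mul, abs_mul,
    abs_of_nonneg (inv_nonneg.2 measureReal_nonneg)]
  gcongr
  exact abs_integral_le_integral_abs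

variable {X : Fin m → E N → E N} {U : Set (E N)} {Q : ℝ}

theorem volume_real_ccBall_pos (hX : ∀ j, LocallyLipschitz (X j)) (hadm : IsAdmissible X U Q)
    {x : E N} (hx : x ∈ U) {r : ℝ} (hr : 0 < r) : 0 < volume.real (ccBall X U x r) :=
  ENNReal.toReal_pos (hadm.ball_pos x hx r hr).ne' (measure_ccBall_lt_top hX hadm hx r).ne

theorem volume_real_ccBall_two_pow_le (hX : ∀ j, LocallyLipschitz (X j))
    (hadm : IsAdmissible X U Q) {x : E N} (hx : x ∈ U) {r : ℝ} (hr : 0 < r) (k : ℕ) :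
    volume.real (ccBall X U x (2 ^ k * r)) ≤
      ((2 : ℝ) ^ Q) ^ k * volume.real (ccBall X U x r) := by
  have h1 := ENNReal.toReal_mono (ENNReal.mul_lt_top (ENNReal.pow_lt_top ENNReal.ofReal_lt_top)
    (measure_ccBall_lt_top hX hadm hx r)).ne (measure_ccBall_two_pow_le hadm hx hr k)
  rwa [ENNReal.toReal_mul, ENNReal.toReal_pow, ENNReal.toReal_ofReal (by positivity)] at h1

theorem integrableOn_ccBall (hX : ∀ j, LocallyLipschitz (X j)) (hadm : IsAdmissible X U Q)
    {x : E N} (hx : x ∈ U) (r : ℝ) {h : E N → ℝ} (hc : Continuous h) {C : ℝ} (hC : ∀ y, |h y| ≤ C) :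
    IntegrableOn h (ccBall X U x r) :=
  Measure.integrableOn_of_bounded (M := C) (measure_ccBall_lt_top hX hadm hx r).ne
    hc.aestronglyMeasurable (Eventually.of_forall hC)

theorem continuous_xGrad (hX : ∀ j, LocallyLipschitz (X j)) {φ : E N → ℝ} (hφ : ContDiff ℝ 1 φ) :
    Continuous (xGrad X φ) := by
  refine (PiLp.continuous_toLp 2 _).comp (continuous_pi fun j => ?_)
  exact (hφ.continuous_fderiv one_ne_zero).clm_apply (hX j).continuous

theorem xGrad_eq_zero_of_notMem_tsupport {φ : E N → ℝ} {x : E N} (hx : x ∉ tsupport φ) :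
    xGrad X φ x = 0 := by
  have h1 : fderiv ℝ φ x = 0 := by
    by_contra h
    exact hx (tsupport_fderiv_subset ℝ (subset_tsupport _ h))
  ext j
  simp [xGrad, h1]

theorem hasCompactSupport_xGrad {φ : E N → ℝ} (hφ : HasCompactSupport φ) :
    HasCompactSupport (xGrad X φ) :=
  HasCompactSupport.intro hφ fun _ hx => xGrad_eq_zero_of_notMem_tsupport hx

/-- Control balls shrink in the Euclidean sense, so ordinary continuity suffices and no
differentiation theorem is needed. -/
theorem tendsto_setAverage_ccBall (hX : ∀ j, LocallyLipschitz (X j)) 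
    (hU : IsOpen U) (hadm : IsAdmissible X U Q) {x : E N} (hx : x ∈ U) {R : ℝ} (hR : 0 < R) {φ : E N → ℝ}
    (hφ : Continuous φ) {C : ℝ} (hC : ∀ y, |φ y| ≤ C) :
    Tendsto (fun i : ℕ => ⨍ y in ccBall X U x (R / 2 ^ i), φ y) atTop (𝓝 (φ x)) := by
  rw [Metric.tendsto_atTop]
  intro ε hε
  obtain ⟨δ, hδ, hδε⟩ := Metric.continuousAt_iff.1 hφ.continuousAt (ε / 2) (by positivity)
  obtain ⟨r, hr, hrδ⟩ := exists_norm_sub_lt_of_ccDist_lt hX x hδ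
  obtain ⟨n, hn⟩ := pow_unbounded_of_one_lt (R / r) one_lt_two
  refine ⟨n, fun i hi => ?_⟩
  have hir : R / 2 ^ i ≤ r := by
    rw [div_le_iff₀ (by positivity)]
    rw [div_lt_iff₀ hr] at hn
    have : (2 : ℝ) ^ n ≤ 2 ^ i := pow_le_pow_right₀ one_le_two hi
    nlinarith
  have hpos := volume_real_ccBall_pos hX hadm hx (r := R / 2 ^ i) (by positivity)
  have hint := integrableOn_ccBall hX hadm hx (R / 2 ^ i) hφ hC
  rw [Real.dist_eq]
  refine (abs_setAverage_sub_le hpos.ne' hint (φ x)).trans_lt (lt_of_le_of_lt ?_ (half_lt_self hε))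
  rw [setAverage_eq, smul_eq_mul, inv_mul_le_iff₀ hpos]
  have h1 : ∫ y in ccBall X U x (R / 2 ^ i), |φ y - φ x| ≤
      ∫ y in ccBall X U x (R / 2 ^ i), ε / 2 := by
    refine setIntegral_mono_on (hint.sub (integrableOn_const
      (measure_ccBall_lt_top hX hadm hx _).ne)).abs (integrableOn_const
      (measure_ccBall_lt_top hX hadm hx _).ne) (isOpen_ccBall hX hU hadm _ _).measurableSet
      fun y hy => ?_
    have h2 : dist y x < δ := by
      rw [dist_eq_norm]
      exact hrδ y (ccBall_mono x hir hy).2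
    exact (hδε h2).le
  simpa using h1

end Telescoping

/-! ### Pointwise bound by the maximal function of the gradient. -/

section BallSobolev

variable {X : Fin m → E N → E N} {U : Set (E N)} {Q : ℝ}

/-- Jensen's inequality, obtained by expanding the nonnegative integral of `(g - c)²` with `c` the
average of `g`. -/
theorem sq_setAverage_mul_le {α : Type*} [MeasurableSpace α] {μ : Measure α} {B : Set α}
    {g : α → ℝ} (hB : 0 < μ.real B) (hg : IntegrableOn g B μ)
    (hg2 : IntegrableOn (fun y => g y ^ 2) B μ) :
    (⨍ y in B, g y ∂μ) ^ 2 * μ.real B ≤ ∫ y in B, g y ^ 2 ∂μ := by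
  have hfin : μ B ≠ ⊤ := fun h => hB.ne' (by simp [measureReal_def, h])
  set c := ⨍ y in B, g y ∂μ with hc
  have h1 : ∫ y in B, g y ∂μ = c * μ.real B := by
    rw [hc, setAverage_eq, smul_eq_mul]
    field_simp
  have h2 : 0 ≤ ∫ y in B, (g y - c) ^ 2 ∂μ := integral_nonneg fun y => sq_nonneg _
  have h3 : ∫ y in B, (g y - c) ^ 2 ∂μ =
      ∫ y in B, g y ^ 2 ∂μ - 2 * c * ∫ y in B, g y ∂μ + c ^ 2 * μ.real B := by
    have : ∀ y, (g y - c) ^ 2 = g y ^ 2 - 2 * c * g y + c ^ 2 := fun y => by ring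
    simp_rw [this]
    have i1 : Integrable (fun y => g y ^ 2 - 2 * c * g y) (μ.restrict B) :=
      hg2.sub (hg.const_mul (2 * c))
    have i2 : Integrable (fun _ => c ^ 2) (μ.restrict B) := integrableOn_const hfin
    rw [integral_add i1 i2, integral_sub hg2 (hg.const_mul (2 * c)), integral_const_mul]
    simp [mul_comm]
  rw [h3, h1] at h2
  linarith

theorem setAverage_le_maxFn (hX : ∀ j, LocallyLipschitz (X j)) (hadm : IsAdmissible X U Q) {R : ℝ}
    (hR : 0 < R) {x : E N} (hx : x ∈ U) {g : E N → ℝ} (hg : Continuous g) (hg0 : ∀ y, 0 ≤ g y)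
    {c : ℝ} (hgc : ∀ y, g y ≤ c) (i : ℕ) :
    ⨍ y in ccBall X U x (R / 2 ^ i), g y ≤
      (maxFn X U R (fun y => ENNReal.ofReal (g y)) x).toReal := by
  have hfin := ne_top_of_le_ne_top ENNReal.ofReal_ne_top
    (maxFn_le hX hadm hR hx fun y => ENNReal.ofReal_le_ofReal (hgc y))
  refine le_trans (le_of_eq ?_) (ENNReal.toReal_mono hfin (le_iSup (fun i : ℕ =>
    (∫⁻ y in ccBall X U x (R / 2 ^ i), ENNReal.ofReal (g y)) /
      volume (ccBall X U x (R / 2 ^ i))) i))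
  rw [setAverage_eq, smul_eq_mul, ENNReal.toReal_div, integral_eq_lintegral_of_nonneg_ae
    (Eventually.of_forall hg0) hg.aestronglyMeasurable, measureReal_def, inv_mul_eq_div]

/-- Consecutive averages differ by at most the oscillation controlled by Poincaré's inequality. -/
theorem abs_setAverage_half_sub_le (hX : ∀ j, LocallyLipschitz (X j)) (hadm : IsAdmissible X U Q)
    {CP ν : ℝ} (hP : ∀ x ∈ U, ∀ r : ℝ, 0 < r →
      ∀ u : E N → ℝ, ContDiff ℝ 1 u → HasCompactSupport u →
        ⨍ y in ccBall X U x r, |u y - ⨍ z in ccBall X U x r, u z| ≤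
          CP * r * ⨍ y in ccBall X U x (ν * r), ‖xGrad X u y‖)
    {x : E N} (hx : x ∈ U) {r : ℝ} (hr : 0 < r) {φ : E N → ℝ} (hφ : ContDiff ℝ 1 φ)
    (hφs : HasCompactSupport φ) :
    |(⨍ y in ccBall X U x (r / 2), φ y) - ⨍ y in ccBall X U x r, φ y| ≤
      2 ^ Q * (CP * r * ⨍ y in ccBall X U x (ν * r), ‖xGrad X φ y‖) := by
  obtain ⟨C, hC⟩ := hφs.exists_bound_of_continuous hφ.continuous
  have h1 := volume_real_ccBall_pos hX hadm hx hr
  have h2 := volume_real_ccBall_pos hX hadm hx (half_pos hr)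
  have h3 := integrableOn_ccBall hX hadm hx r hφ.continuous hC
  have hsub : ccBall X U x (r / 2) ⊆ ccBall X U x r := ccBall_mono x (by linarith)
  have hd := volume_real_ccBall_two_pow_le hX hadm hx (half_pos hr) 1
  rw [pow_one, pow_one, mul_div_cancel₀ _ (two_ne_zero)] at hd
  refine (abs_setAverage_sub_le h2.ne' (h3.mono_set hsub) _).trans ?_
  refine (setAverage_le_mul_setAverage (K := 2 ^ Q) hsub h2 hd (h3.sub (integrableOn_const
    (measure_ccBall_lt_top hX hadm hx _).ne)).abs (fun y => abs_nonneg _) h1).trans ?_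
  gcongr
  exact hP x hx r hr φ hφ hφs

variable {Ω : Set (E N)}

/-- Pointwise estimate of a function minus a constant by the maximal function of its gradient. -/
theorem exists_abs_sub_le_maxFn (hX : ∀ j, LocallyLipschitz (X j)) (hU : IsOpen U) (hQ : 2 < Q)
    (hadm : IsAdmissible X U Q) (hΩ : IsOpen Ω) (hΩb : Bornology.IsBounded Ω) (hΩU : Ω ⊆ U)
    {x₀ : E N} (hx₀ : x₀ ∈ Ω) {R : ℝ} (hR : 0 < R)
    (hRΩ : ∀ x ∈ Ω, ∀ y ∈ Ω, ccDist X x y < ENNReal.ofReal R) :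
    ∃ R' D₁ D₂ : ℝ, 0 < R' ∧ 0 ≤ D₁ ∧ 0 ≤ D₂ ∧ ∀ φ : E N → ℝ, ContDiff ℝ 1 φ → HasCompactSupport φ →
      ∃ a : ℝ, ∀ x ∈ Ω, |φ x - a| ≤
        D₁ * (∫ y, ‖xGrad X φ y‖ ^ 2) ^ (1 / Q) *
          (maxFn X U R' (fun y => ENNReal.ofReal ‖xGrad X φ y‖) x).toReal ^ (1 - 2 / Q) +
        D₂ * (∫ y, ‖xGrad X φ y‖ ^ 2) ^ (1 / 2 : ℝ) := by
  obtain ⟨CP, hCP, ν, hν, hP⟩ := hadm.poincare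
  have hQ0 : 0 < Q := by linarith
  set K : ℝ := 2 ^ Q with hK
  have hK0 : 0 < K := by positivity
  -- `q² = 2^Q`: each halving of the radius costs at most a factor `q` in the `L²` bound for the
  -- average of `|Xφ|`. Then `θ = 2/Q` solves `q^θ = 2`, and `Q > 2` gives `θ < 1`.
  set q : ℝ := 2 ^ (Q / 2) with hq
  have hq1 : 1 < q := Real.one_lt_rpow one_lt_two (by positivity)
  have hqK : q ^ 2 = K := by
    rw [hq, hK, ← Real.rpow_natCast, ← Real.rpow_mul two_pos.le]
    congr 1
    push_cast
    ring
  have hqθ : q ^ (2 / Q) = 2 := by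
    rw [hq, ← Real.rpow_mul two_pos.le]
    have : Q / 2 * (2 / Q) = 1 := by field_simp
    rw [this, Real.rpow_one]
  have hθ0 : 0 < 2 / Q := by positivity
  have hθ1 : 2 / Q < 1 := by rwa [div_lt_one hQ0]
  have hΩv : 0 < volume.real Ω :=
    ENNReal.toReal_pos (hΩ.measure_pos volume ⟨x₀, hx₀⟩).ne' hΩb.measure_lt_top.ne
  -- `k` doublings of the radius `ν R` bring it above `R`, so that the enlarged ball about any point
  -- of `Ω` contains `Ω`.
  obtain ⟨k, hk⟩ := pow_unbounded_of_one_lt (1 / ν) one_lt_two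
  rw [div_lt_iff₀ hν] at hk
  have hb1 : 0 < q / 2 - 1 := by
    have : q ^ (2 / Q) < q ^ (1 : ℝ) := Real.rpow_lt_rpow_of_exponent_lt hq1 hθ1
    rw [hqθ, Real.rpow_one] at this
    linarith
  set c := (q / 2) / (q / 2 - 1) + 2 with hc
  have hc0 : 0 < c := by positivity
  set b := K ^ k / volume.real Ω with hb
  have hb0 : 0 < b := by positivity
  set B := ccBall X U x₀ (2 * R) with hBdef
  have hBpos : 0 < volume.real B := volume_real_ccBall_pos hX hadm (hΩU hx₀) (by positivity)
  set B' := ccBall X U x₀ (ν * (2 * R)) with hB'def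
  have hB'pos : 0 < volume.real B' :=
    volume_real_ccBall_pos hX hadm (hΩU hx₀) (by positivity)
  refine ⟨ν * R, K * CP * R * c * b ^ (1 / Q),
    volume.real B / volume.real Ω * (CP * (2 * R)) * (1 / volume.real B') ^ (1 / 2 : ℝ),
    by positivity, by positivity, by positivity, fun φ hφ hφs => ?_⟩
  set g : E N → ℝ := fun y => ‖xGrad X φ y‖ with hg
  have hgc : Continuous g := (continuous_xGrad hX hφ).norm
  have hgs : HasCompactSupport g := (hasCompactSupport_xGrad hφs).norm
  have hg0 : ∀ y, 0 ≤ g y := fun y => norm_nonneg _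
  obtain ⟨Cg, hCg⟩ := hgs.exists_bound_of_continuous hgc
  have hgCg : ∀ y, g y ≤ Cg := fun y => (le_abs_self _).trans (hCg y)
  have hg2c : Continuous fun y => g y ^ 2 := hgc.pow 2
  have hg2s : HasCompactSupport fun y => g y ^ 2 := by
    refine HasCompactSupport.intro hgs fun y hy => ?_
    rw [image_eq_zero_of_notMem_tsupport hy]
    simp
  have hg2i : Integrable fun y => g y ^ 2 := hg2c.integrable_of_hasCompactSupport hg2s
  have hgi : Integrable g := hgc.integrable_of_hasCompactSupport hgs
  set G := ∫ y, g y ^ 2 with hG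
  have hG0 : 0 ≤ G := integral_nonneg fun y => sq_nonneg _
  have havg : ∀ x ∈ U, ∀ r : ℝ, 0 < r →
      (⨍ y in ccBall X U x r, g y) ^ 2 * volume.real (ccBall X U x r) ≤ G := fun x hx r hr =>
    (sq_setAverage_mul_le (volume_real_ccBall_pos hX hadm hx hr) hgi.integrableOn
      hg2i.integrableOn).trans (setIntegral_le_integral hg2i (Eventually.of_forall fun y => sq_nonneg _))
  obtain ⟨Cφ, hCφ⟩ := hφs.exists_bound_of_continuous hφ.continuous
  have hΩB : ∀ x ∈ Ω, Ω ⊆ ccBall X U x R := fun x hx y hy => ⟨hΩU hy, hRΩ x hx y hy⟩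
  have hΩBv : ∀ x ∈ Ω, volume.real Ω ≤ volume.real (ccBall X U x R) := fun x hx =>
    ENNReal.toReal_mono (measure_ccBall_lt_top hX hadm (hΩU hx) R).ne (measure_mono (hΩB x hx))
  refine ⟨⨍ y in B, φ y, fun x hx => ?_⟩
  have hxU := hΩU hx
  set M := (maxFn X U (ν * R) (fun y => ENNReal.ofReal (g y)) x).toReal with hM
  have hM0 : 0 ≤ M := ENNReal.toReal_nonneg
  set s : ℕ → ℝ := fun i => ⨍ y in ccBall X U x (ν * (R / 2 ^ i)), g y with hs
  have hs0 : ∀ i, 0 ≤ s i := fun i => by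
    simp only [hs, setAverage_eq, smul_eq_mul]
    exact mul_nonneg (inv_nonneg.2 measureReal_nonneg) (integral_nonneg hg0)
  have hsM : ∀ i, s i ≤ M := fun i => by
    simp only [hs, ← mul_div_assoc]
    exact setAverage_le_maxFn hX hadm (by positivity) hxU hgc hg0 hgCg i
  -- Jensen gives `s_i² |B_i| ≤ G`, and `k + i` doublings of `B_i` cover `Ω`, so `|B_i| ≥ K^{-(k+i)}
  -- |Ω|`. This lower volume bound is where the dimension `Q` enters.
  have hsA : ∀ i, s i ≤ (G * b) ^ (1 / 2 : ℝ) * q ^ i := fun i => by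
    have hr : 0 < ν * (R / 2 ^ i) := by positivity
    have h1 := havg x hxU _ hr
    have h2 := volume_real_ccBall_two_pow_le hX hadm hxU hr (k + i)
    have h3 : volume.real Ω ≤ K ^ (k + i) * volume.real (ccBall X U x (ν * (R / 2 ^ i))) := by
      refine (hΩBv x hx).trans (le_trans ?_ h2)
      refine ENNReal.toReal_mono (measure_ccBall_lt_top hX hadm hxU _).ne
        (measure_mono (ccBall_mono x ?_))
      calc R ≤ 2 ^ k * ν * R := by nlinarith
        _ = 2 ^ (k + i) * (ν * (R / 2 ^ i)) := by
          rw [pow_add]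
          field_simp
    have h4 : s i ^ 2 ≤ ((G * b) ^ (1 / 2 : ℝ) * q ^ i) ^ 2 := by
      have h5 : ((G * b) ^ (1 / 2 : ℝ) * q ^ i) ^ 2 = G * (K ^ (k + i) / volume.real Ω) := by
        rw [mul_pow, ← Real.rpow_natCast, ← Real.rpow_mul (by positivity)]
        norm_num
        rw [← pow_mul, mul_comm i 2, pow_mul, hqK, hb, pow_add]
        ring
      rw [h5, ← mul_div_assoc, le_div_iff₀ hΩv]
      calc s i ^ 2 * volume.real Ω
          ≤ s i ^ 2 * (K ^ (k + i) * volume.real (ccBall X U x (ν * (R / 2 ^ i)))) := by gcongr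
        _ = (s i ^ 2 * volume.real (ccBall X U x (ν * (R / 2 ^ i)))) * K ^ (k + i) := by ring
        _ ≤ G * K ^ (k + i) := by gcongr
    exact (pow_le_pow_iff_left₀ (hs0 i) (by positivity) two_ne_zero).1 h4
  set f : ℕ → ℝ := fun i => ⨍ y in ccBall X U x (R / 2 ^ i), φ y with hf
  have hstep : ∀ i, |f (i + 1) - f i| ≤ K * CP * R * (s i / 2 ^ i) := fun i => by
    have h1 := abs_setAverage_half_sub_le hX hadm hP hxU (r := R / 2 ^ i) (by positivity) hφ hφs
    rw [div_div, ← pow_succ] at h1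
    refine h1.trans (le_of_eq ?_)
    simp only [hs, hK, hg]
    ring
  have htel : ∀ n, |f n - f 0| ≤ K * CP * R * (c * (((G * b) ^ (1 / 2 : ℝ)) ^ (2 / Q) *
      M ^ (1 - 2 / Q))) := fun n => by
    calc |f n - f 0| = |∑ i ∈ Finset.range n, (f (i + 1) - f i)| := by rw [Finset.sum_range_sub]
      _ ≤ ∑ i ∈ Finset.range n, |f (i + 1) - f i| := Finset.abs_sum_le_sum_abs _ _
      _ ≤ ∑ i ∈ Finset.range n, K * CP * R * (s i / 2 ^ i) := Finset.sum_le_sum fun i _ => hstep i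
      _ = K * CP * R * ∑ i ∈ Finset.range n, s i / 2 ^ i := by rw [Finset.mul_sum]
      _ ≤ _ := by
        gcongr
        exact sum_half_pow_mul_le_of_nonneg hq1 hθ0 hθ1 hqθ (by positivity) hM0 hs0 hsA hsM n
  have hlim := tendsto_setAverage_ccBall hX hU hadm hxU hR hφ.continuous hCφ
  have hfirst := le_of_tendsto ((hlim.sub_const (f 0)).abs) (Eventually.of_forall htel)
  -- The telescoping ends at an average over the ball of radius `R` about `x`, which still depends
  -- on `x`. All these balls lie in `B` and contain `Ω`, so one Poincaré inequality on `B` replaces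
  -- them by a single constant at the cost `|B| / |Ω|`.
  have hsecond : |f 0 - ⨍ y in B, φ y| ≤ volume.real B / volume.real Ω *
      (CP * (2 * R) * ⨍ y in B', g y) := by
    have hsub : ccBall X U x R ⊆ B := by
      refine (ccBall_subset_ccBall hX hR.le hR.le (hRΩ x₀ hx₀ x hx).le).trans (ccBall_mono x₀ ?_)
      linarith
    have h1 := volume_real_ccBall_pos hX hadm hxU hR
    have h3 := integrableOn_ccBall hX hadm (hΩU hx₀) (2 * R) hφ.continuous hCφ
    simp only [hf, pow_zero, div_one]
    refine (abs_setAverage_sub_le h1.ne' (h3.mono_set hsub) _).trans ?_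
    refine (setAverage_le_mul_setAverage (K := volume.real B / volume.real Ω) hsub h1 ?_
      (h3.sub (integrableOn_const (measure_ccBall_lt_top hX hadm (hΩU hx₀) _).ne)).abs
      (fun y => abs_nonneg _) hBpos).trans ?_
    · rw [div_mul_eq_mul_div, le_div_iff₀ hΩv]
      exact mul_le_mul_of_nonneg_left (hΩBv x hx) measureReal_nonneg
    · gcongr
      exact hP x₀ (hΩU hx₀) (2 * R) (by positivity) φ hφ hφs
  have hB'avg : ⨍ y in B', g y ≤ (1 / volume.real B') ^ (1 / 2 : ℝ) * G ^ (1 / 2 : ℝ) := by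
    have h1 := havg x₀ (hΩU hx₀) (ν * (2 * R)) (by positivity)
    rw [← Real.mul_rpow (by positivity) hG0, ← Real.sqrt_eq_rpow]
    refine Real.le_sqrt_of_sq_le ?_
    rw [one_div, inv_mul_eq_div, le_div_iff₀ hB'pos]
    exact h1
  calc |φ x - ⨍ y in B, φ y| ≤ |φ x - f 0| + |f 0 - ⨍ y in B, φ y| := abs_sub_le _ _ _
    _ ≤ K * CP * R * (c * (((G * b) ^ (1 / 2 : ℝ)) ^ (2 / Q) * M ^ (1 - 2 / Q))) +
        volume.real B / volume.real Ω * (CP * (2 * R) *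
          ((1 / volume.real B') ^ (1 / 2 : ℝ) * G ^ (1 / 2 : ℝ))) := by
        refine add_le_add hfirst (hsecond.trans ?_)
        gcongr
    _ = _ := by
        have h1 : ((G * b) ^ (1 / 2 : ℝ)) ^ (2 / Q) = G ^ (1 / Q) * b ^ (1 / Q) := by
          rw [← Real.rpow_mul (by positivity), ← Real.mul_rpow hG0 hb0.le]
          congr 1
          field_simp
        rw [h1]
        ring

end BallSobolev

/-! ### The Sobolev inequality up to an additive constant. -/

section BallSobolevNorm

variable {X : Fin m → E N → E N} {U Ω : Set (E N)} {Q : ℝ}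

theorem eLpNorm_two_xGrad (hX : ∀ j, LocallyLipschitz (X j)) {φ : E N → ℝ}
    (hφ : ContDiff ℝ 1 φ) (hφs : HasCompactSupport φ) (hφΩ : tsupport φ ⊆ Ω) :
    eLpNorm (xGrad X φ) 2 (volume.restrict Ω) =
      ENNReal.ofReal ((∫ y, ‖xGrad X φ y‖ ^ 2) ^ (1 / 2 : ℝ)) := by
  have hgc : Continuous fun y => ‖xGrad X φ y‖ ^ 2 := (continuous_xGrad hX hφ).norm.pow 2
  have hgs : HasCompactSupport fun y => ‖xGrad X φ y‖ ^ 2 :=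
    HasCompactSupport.intro hφs fun y hy => by simp [xGrad_eq_zero_of_notMem_tsupport hy]
  have hi := hgc.integrable_of_hasCompactSupport hgs (μ := volume)
  rw [eLpNorm_eq_lintegral_rpow_enorm_toReal two_ne_zero ENNReal.ofNat_ne_top,
    ← setIntegral_eq_integral_of_forall_compl_eq_zero (s := Ω)
      (f := fun y => ‖xGrad X φ y‖ ^ 2),
    ← ENNReal.ofReal_rpow_of_nonneg (integral_nonneg fun y => by positivity) (by norm_num),
    ofReal_integral_eq_lintegral_ofReal hi.integrableOn (Eventually.of_forall fun y => by positivity)]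
  · simp only [ENNReal.toReal_ofNat]
    congr 1
    refine lintegral_congr fun y => ?_
    rw [ENNReal.ofReal_pow (norm_nonneg _), ofReal_norm, ENNReal.rpow_ofNat]
  · intro y hy
    simp [xGrad_eq_zero_of_notMem_tsupport fun h => hy (hφΩ h)]

/-- Sobolev's inequality up to a constant. -/
theorem exists_eLpNorm_sub_const_le (hX : ∀ j, LocallyLipschitz (X j)) (hU : IsOpen U) (hQ : 2 < Q)
    (hadm : IsAdmissible X U Q) (hΩ : IsOpen Ω) (hΩb : Bornology.IsBounded Ω) (hΩU : Ω ⊆ U)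
    {x₀ : E N} (hx₀ : x₀ ∈ Ω) {R : ℝ} (hR : 0 < R)
    (hRΩ : ∀ x ∈ Ω, ∀ y ∈ Ω, ccDist X x y < ENNReal.ofReal R) :
    ∃ S : ℝ, 0 ≤ S ∧ ∀ φ : E N → ℝ, ContDiff ℝ 1 φ → HasCompactSupport φ → tsupport φ ⊆ Ω →
      ∃ a : ℝ, eLpNorm (fun x => φ x - a) (ENNReal.ofReal (2 * Q / (Q - 2))) (volume.restrict Ω) ≤
        ENNReal.ofReal S * eLpNorm (xGrad X φ) 2 (volume.restrict Ω) := by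
  obtain ⟨R', D₁, D₂, hR', hD₁, hD₂, H⟩ :=
    exists_abs_sub_le_maxFn hX hU hQ hadm hΩ hΩb hΩU hx₀ hR hRΩ
  have hQ0 : 0 < Q := by linarith
  have hQ2 : 0 < Q - 2 := by linarith
  set p := 2 * Q / (Q - 2) with hp
  have hp0 : 0 < p := by positivity
  have hp1 : 1 ≤ p := by
    rw [hp, le_div_iff₀ hQ2]
    linarith
  set K : ℝ := 8 * (2 ^ Q) ^ 3 with hK
  have hK0 : 0 < K := by positivity
  set V := volume.real Ω with hV
  refine ⟨D₁ * K ^ (1 / p) + D₂ * V ^ (1 / p), by positivity, fun φ hφ hφs hφΩ => ?_⟩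
  obtain ⟨a, ha⟩ := H φ hφ hφs
  refine ⟨a, ?_⟩
  rw [eLpNorm_two_xGrad hX hφ hφs hφΩ]
  set g : E N → ℝ := fun y => ‖xGrad X φ y‖ with hg
  have hgc : Continuous g := (continuous_xGrad hX hφ).norm
  have hgs : HasCompactSupport g := (hasCompactSupport_xGrad hφs).norm
  obtain ⟨Cg, hCg⟩ := hgs.exists_bound_of_continuous hgc
  set G := ∫ y, g y ^ 2 with hG
  have hG0 : 0 ≤ G := integral_nonneg fun y => sq_nonneg _
  have hGl : ∫⁻ y, ENNReal.ofReal (g y ^ 2) = ENNReal.ofReal G := by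
    rw [hG, ofReal_integral_eq_lintegral_ofReal _ (Eventually.of_forall fun y => sq_nonneg _)]
    refine (hgc.pow 2).integrable_of_hasCompactSupport ?_
    exact HasCompactSupport.intro hφs fun y hy => by simp [hg, xGrad_eq_zero_of_notMem_tsupport hy]
  set Mx := maxFn X U R' (fun y => ENNReal.ofReal (g y)) with hMx
  set M : E N → ℝ := fun x => (U.indicator Mx x).toReal with hM
  have hMm : Measurable M :=
    (measurable_indicator_maxFn hX hU hadm R' hgc.measurable.ennreal_ofReal).ennreal_toReal
  have hM0 : ∀ x, 0 ≤ M x := fun x => ENNReal.toReal_nonneg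
  have hfin : ∀ x ∈ U, Mx x ≠ ⊤ := fun x hx => ne_top_of_le_ne_top ENNReal.ofReal_ne_top
    (maxFn_le hX hadm hR' hx fun y => ENNReal.ofReal_le_ofReal ((le_abs_self _).trans (hCg y)))
  set F : E N → ℝ := fun x => D₁ * G ^ (1 / Q) * M x ^ (1 - 2 / Q) with hF
  have hF0 : ∀ x, 0 ≤ F x := fun x => by
    have := hM0 x
    positivity
  have hFm : Measurable F := (hMm.pow_const _).const_mul _
  -- The `p`-th power of `M^{1-2/Q}` is `M²`, so the `L²` bound of the maximal function yields
  -- exactly the exponent `2Q/(Q-2)`.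
  have hpexp : (1 - 2 / Q) * p = 2 := by
    rw [hp]
    field_simp
  have hFnorm : eLpNorm F (ENNReal.ofReal p) (volume.restrict Ω) ≤
      ENNReal.ofReal (D₁ * K ^ (1 / p) * G ^ (1 / 2 : ℝ)) := by
    have h1 : ∫⁻ x in Ω, ‖F x‖ₑ ^ p ≤ ENNReal.ofReal ((D₁ * G ^ (1 / Q)) ^ p * (K * G)) := by
      have h2 : ∀ x ∈ Ω, ‖F x‖ₑ ^ p = ENNReal.ofReal ((D₁ * G ^ (1 / Q)) ^ p) * Mx x ^ 2 :=
          fun x hx => by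
        have h3 : M x = (Mx x).toReal := by simp [hM, indicator_of_mem (hΩU hx)]
        rw [Real.enorm_of_nonneg (hF0 x), ENNReal.ofReal_rpow_of_nonneg (hF0 x) hp0.le]
        simp only [hF]
        have := hM0 x
        rw [Real.mul_rpow (by positivity) (by positivity), ← Real.rpow_mul (hM0 x), hpexp,
          ENNReal.ofReal_mul (by positivity), Real.rpow_two, ENNReal.ofReal_pow (hM0 x), h3,
          ENNReal.ofReal_toReal (hfin x (hΩU hx))]
      rw [setLIntegral_congr_fun hΩ.measurableSet h2, lintegral_const_mul' _ _ ENNReal.ofReal_ne_top,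
        ENNReal.ofReal_mul (by positivity)]
      gcongr
      calc ∫⁻ x in Ω, Mx x ^ 2 ≤ ∫⁻ x in U, Mx x ^ 2 := lintegral_mono_set hΩU
        _ ≤ 8 * ENNReal.ofReal ((2 : ℝ) ^ Q) ^ 3 * ∫⁻ y, ENNReal.ofReal (g y ^ 2) :=
          lintegral_maxFn_sq_le hX hU hadm hR' hgc.measurable (fun y => norm_nonneg _)
            (fun y => (le_abs_self _).trans (hCg y))
        _ = ENNReal.ofReal (K * G) := by
          rw [hGl, hK, ENNReal.ofReal_mul (by positivity), ENNReal.ofReal_mul (by positivity),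
            ENNReal.ofReal_pow (by positivity), ENNReal.ofReal_ofNat]
    rw [eLpNorm_eq_lintegral_rpow_enorm_toReal (by simpa using hp0) ENNReal.ofReal_ne_top,
      ENNReal.toReal_ofReal hp0.le]
    refine (ENNReal.rpow_le_rpow h1 (by positivity)).trans (le_of_eq ?_)
    rw [ENNReal.ofReal_rpow_of_nonneg (by positivity) (by positivity)]
    congr 1
    rw [Real.mul_rpow (by positivity) (by positivity), ← Real.rpow_mul (by positivity),
      mul_one_div_cancel hp0.ne', Real.rpow_one, Real.mul_rpow hK0.le hG0]
    have h4 : G ^ (1 / 2 : ℝ) = G ^ (1 / Q) * G ^ (1 / p) := by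
      rw [← Real.rpow_add_of_nonneg hG0 (by positivity) (by positivity)]
      congr 1
      rw [hp]
      field_simp
      ring
    rw [h4]
    ring
  have hCnorm : eLpNorm (fun _ : E N => D₂ * G ^ (1 / 2 : ℝ)) (ENNReal.ofReal p)
      (volume.restrict Ω) ≤ ENNReal.ofReal (D₂ * V ^ (1 / p) * G ^ (1 / 2 : ℝ)) := by
    have hVl : ENNReal.ofReal V = volume Ω := ENNReal.ofReal_toReal hΩb.measure_lt_top.ne
    rw [eLpNorm_const' _ (by simpa using hp0) ENNReal.ofReal_ne_top, ENNReal.toReal_ofReal hp0.le,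
      Real.enorm_of_nonneg (by positivity), Measure.restrict_apply_univ, mul_right_comm,
      ENNReal.ofReal_mul (p := D₂ * G ^ (1 / 2 : ℝ)) (by positivity),
      ← ENNReal.ofReal_rpow_of_nonneg measureReal_nonneg (by positivity), hVl]
  calc eLpNorm (fun x => φ x - a) (ENNReal.ofReal p) (volume.restrict Ω)
      ≤ eLpNorm (F + fun _ : E N => D₂ * G ^ (1 / 2 : ℝ)) (ENNReal.ofReal p)
          (volume.restrict Ω) := by
        refine eLpNorm_mono_ae ?_
        filter_upwards [ae_restrict_mem hΩ.measurableSet] with x hx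
        refine (ha x hx).trans (le_trans (le_of_eq ?_) (le_abs_self _))
        simp [hF, hM, indicator_of_mem (hΩU hx), hMx, hg, hG]
    _ ≤ _ := eLpNorm_add_le hFm.aestronglyMeasurable aestronglyMeasurable_const
        (by rwa [ENNReal.one_le_ofReal])
    _ ≤ ENNReal.ofReal (D₁ * K ^ (1 / p) * G ^ (1 / 2 : ℝ)) +
        ENNReal.ofReal (D₂ * V ^ (1 / p) * G ^ (1 / 2 : ℝ)) := add_le_add hFnorm hCnorm
    _ = _ := by
        rw [← ENNReal.ofReal_add (by positivity) (by positivity), ← ENNReal.ofReal_mul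
          (by positivity), add_mul]

end BallSobolevNorm

/-! ### A `C¹` bump profile and the divergence of Lipschitz fields. -/

section Transport

/-- The square of the positive part. -/
noncomputable def sqPos (s : ℝ) : ℝ := max s 0 ^ 2

theorem sqPos_nonneg (s : ℝ) : 0 ≤ sqPos s := sq_nonneg _

theorem sqPos_of_nonpos {s : ℝ} (hs : s ≤ 0) : sqPos s = 0 := by simp [sqPos, hs]

theorem sqPos_pos {s : ℝ} (hs : 0 < s) : 0 < sqPos s := by
  rw [sqPos, max_eq_left hs.le]
  positivity

theorem abs_sqPos_sub_le {s t c : ℝ} (hs : s ≤ c) (ht : t ≤ c) (hc : 0 ≤ c) :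
    |sqPos s - sqPos t| ≤ 2 * c * |s - t| := by
  have h1 : sqPos s - sqPos t = (max s 0 + max t 0) * (max s 0 - max t 0) := by
    simp only [sqPos]
    ring
  rw [h1, abs_mul]
  have h2 := abs_max_sub_max_le_abs s t 0
  have h3 : |max s 0 + max t 0| ≤ 2 * c := by
    rw [abs_of_nonneg (by positivity)]
    linarith [max_le hs hc, max_le ht hc]
  gcongr

theorem hasDerivAt_sqPos (s : ℝ) : HasDerivAt sqPos (2 * max s 0) s := by
  rcases lt_trichotomy s 0 with h | rfl | h
  · rw [max_eq_right h.le, mul_zero]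
    refine (hasDerivAt_const s (0 : ℝ)).congr_of_eventuallyEq ?_
    filter_upwards [gt_mem_nhds h] with t ht using sqPos_of_nonpos (le_of_lt ht)
  · rw [hasDerivAt_iff_isLittleO]
    simp only [sub_zero, max_self, mul_zero, smul_zero, sqPos_of_nonpos le_rfl]
    have h1 : (fun x : ℝ => sqPos x) =O[𝓝 0] fun x => x ^ 2 := by
      refine Asymptotics.IsBigO.of_bound 1 (Eventually.of_forall fun x => ?_)
      rw [one_mul, Real.norm_of_nonneg (sqPos_nonneg x), Real.norm_of_nonneg (sq_nonneg x), sqPos]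
      rcases le_total x 0 with hx | hx
      · simp [hx]
        positivity
      · simp [hx]
    exact h1.trans_isLittleO (Asymptotics.isLittleO_pow_id one_lt_two)
  · rw [max_eq_left h.le]
    have h1 := hasDerivAt_pow 2 s
    simp only [Nat.cast_ofNat, Nat.add_one_sub_one, pow_one] at h1
    refine h1.congr_of_eventuallyEq ?_
    filter_upwards [lt_mem_nhds h] with t ht
    simp [sqPos, (le_of_lt ht : 0 ≤ t)]

theorem contDiff_sqPos : ContDiff ℝ 1 sqPos := by
  rw [contDiff_one_iff_deriv]
  refine ⟨fun s => (hasDerivAt_sqPos s).differentiableAt, ?_⟩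
  have : deriv sqPos = fun s => 2 * max s 0 := funext fun s => (hasDerivAt_sqPos s).deriv
  rw [this]
  fun_prop

/-- A Lipschitz vector field has bounded divergence, in weak form. -/
theorem abs_integral_fderiv_apply_le {Y : E N → E N} {K : Set (E N)} {L : NNReal}
    (hY : LipschitzOnWith L Y K) {ψ : E N → ℝ} (hψ : ContDiff ℝ 1 ψ) (hψs : HasCompactSupport ψ)
    (hψK : tsupport ψ ⊆ K) (hψ0 : ∀ y, 0 ≤ ψ y) :
    |∫ y, fderiv ℝ ψ y (Y y)| ≤ N * L * ∫ y, ψ y := by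
  -- Integration by parts requires globally Lipschitz functions, while `Y` is Lipschitz only on `K`.
  -- The components are extended one by one; off `K` the function `ψ` vanishes, so nothing changes.
  have hext : ∀ i : Fin N, ∃ f : E N → ℝ, LipschitzWith L f ∧ EqOn (fun y => Y y i) f K := fun i => by
    refine LipschitzOnWith.extend_real (LipschitzOnWith.of_dist_le_mul fun x hx y hy => ?_)
    refine le_trans ?_ (hY.dist_le_mul x hx y hy)
    rw [dist_eq_norm, dist_eq_norm]
    exact PiLp.norm_apply_le (Y x - Y y) i
  choose f hf hfY using hext
  obtain ⟨D, hD⟩ := hψ.lipschitzWith_of_hasCompactSupport hψs one_ne_zero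
  set e : Fin N → E N := fun i => EuclideanSpace.single i 1 with he
  have hdecomp : ∀ y, fderiv ℝ ψ y (Y y) = ∑ i, fderiv ℝ ψ y (e i) * f i y := fun y => by
    by_cases hy : y ∈ tsupport ψ
    · have h1 : Y y = ∑ i, (Y y i) • e i := by
        have := (EuclideanSpace.basisFun (Fin N) ℝ).sum_repr (Y y)
        simpa [he] using this.symm
      conv_lhs => rw [h1]
      rw [map_sum]
      refine Finset.sum_congr rfl fun i _ => ?_
      rw [map_smul, smul_eq_mul, mul_comm, ← hfY i (hψK hy)]
    · have h1 : fderiv ℝ ψ y = 0 := by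
        by_contra h
        exact hy (tsupport_fderiv_subset ℝ (subset_tsupport _ h))
      simp [h1]
  have hcont : ∀ i, Continuous fun y => fderiv ℝ ψ y (e i) := fun i =>
    (hψ.continuous_fderiv one_ne_zero).clm_apply continuous_const
  have hint : ∀ i, Integrable fun y => fderiv ℝ ψ y (e i) * f i y := fun i => by
    refine ((hcont i).mul (hf i).continuous).integrable_of_hasCompactSupport ?_
    refine HasCompactSupport.intro hψs fun y hy => ?_
    have h1 : fderiv ℝ ψ y = 0 := by
      by_contra h
      exact hy (tsupport_fderiv_subset ℝ (subset_tsupport _ h))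
    simp [h1]
  -- The derivative moves to `f i`, whose directional derivatives are at most `L` in absolute value.
  have hparts : ∀ i, ∫ y, fderiv ℝ ψ y (e i) * f i y = -∫ y, lineDeriv ℝ (f i) y (e i) * ψ y :=
      fun i => by
    rw [(hf i).integral_lineDeriv_mul_eq hD hψs (e i), ← integral_neg]
    refine integral_congr_ae (Eventually.of_forall fun y => ?_)
    simp only
    rw [((hψ.differentiable one_ne_zero) y).lineDeriv_eq_fderiv, map_neg]
    ring
  have hψi : Integrable ψ := hψ.continuous.integrable_of_hasCompactSupport hψs
  have hterm : ∀ i, |∫ y, fderiv ℝ ψ y (e i) * f i y| ≤ L * ∫ y, ψ y := fun i => by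
    rw [hparts, abs_neg, ← integral_const_mul]
    refine (abs_integral_le_integral_abs).trans (integral_mono_of_nonneg
      (Eventually.of_forall fun y => abs_nonneg _) (hψi.const_mul _)
      (Eventually.of_forall fun y => ?_))
    simp only
    rw [abs_mul, abs_of_nonneg (hψ0 y)]
    refine mul_le_mul_of_nonneg_right ?_ (hψ0 y)
    have h2 := norm_lineDeriv_le_of_lipschitz ℝ (hf i) (x₀ := y) (v := e i)
    simpa [he] using h2
  simp_rw [hdecomp]
  rw [integral_finsetSum _ fun i _ => hint i]
  refine (Finset.abs_sum_le_sum_abs _ _).trans ((Finset.sum_le_sum fun i _ => hterm i).trans ?_)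
  simp [mul_assoc]

end Transport

/-! ### Transport of a nonnegative function along a subunit path. -/

section TransportEstimate

variable {X : Fin m → E N → E N}

/-- The derivative along `∑ θ_j X_j` is the inner product of `θ` with the `X`-gradient, so
Cauchy–Schwarz applies. Hence transport along subunit paths costs only the horizontal gradient. -/
theorem abs_fderiv_sum_smul_le {F : E N → ℝ} {y : E N} {θ : Fin m → ℝ} (hθ : ∑ j, θ j ^ 2 ≤ 1) :
    |fderiv ℝ F y (∑ j, θ j • X j y)| ≤ ‖xGrad X F y‖ := by
  have h1 : fderiv ℝ F y (∑ j, θ j • X j y) = inner ℝ (WithLp.toLp 2 θ : E m) (xGrad X F y) := by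
    simp [xGrad, PiLp.inner_apply, mul_comm]
  rw [h1]
  refine (abs_real_inner_le_norm _ _).trans (mul_le_of_le_one_left (norm_nonneg _) ?_)
  rw [EuclideanSpace.norm_eq, Real.sqrt_le_one]
  simpa using hθ

/-- A nonnegative function is transported along subunit paths up to an error controlled by its
horizontal gradient: a bump centred at the path and with shrinking radius compensates for the
distortion of the flow. -/
theorem integral_mul_sqPos_le (hX : ∀ j, LocallyLipschitz (X j)) {x₀ : E N} {ρ : ℝ}
    {L : NNReal} (hL : ∀ θ : Fin m → ℝ, ∑ j, θ j ^ 2 ≤ 1 →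
      LipschitzOnWith L (fun y => ∑ j, θ j • X j y) (Metric.closedBall x₀ (ρ + 1)))
    {T : ℝ} (hT : 0 ≤ T) {γ : ℝ → E N} (hγ : IsSubunit X (Metric.closedBall x₀ ρ) T γ)
    {e₀ : ℝ} (he₀ : 0 < e₀) (he₁ : e₀ ≤ 1) {F : E N → ℝ} (hF : ContDiff ℝ 1 F)
    (hF0 : ∀ y, 0 ≤ F y) :
    ∫ y, F y * sqPos (e₀ * Real.exp (-(2 * L) * T) - ‖y - γ T‖ ^ 2) ≤
      Real.exp (N * L * T) * ((∫ y, F y * sqPos (e₀ - ‖y - γ 0‖ ^ 2)) +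
        T * ∫ y in Metric.closedBall x₀ (ρ + 1), ‖xGrad X F y‖) := by
  set K := Metric.closedBall x₀ (ρ + 1) with hK
  have hKc : IsCompact K := isCompact_closedBall _ _
  -- The velocity fields are `L`-Lipschitz, so under their flow the squared distance to the path
  -- changes at relative rate at most `2L`. A squared radius decaying at this rate gives the error
  -- term in `hpt` a sign.
  set e : ℝ → ℝ := fun t => e₀ * Real.exp (-(2 * L) * t) with he
  have he_pos : ∀ t, 0 < e t := fun t => by positivity
  have he_le : ∀ t, 0 ≤ t → e t ≤ 1 := fun t ht => by
    refine mul_le_one₀ he₁ (Real.exp_pos _).le (Real.exp_le_one_iff.2 ?_)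
    have : 0 ≤ (L : ℝ) * t := mul_nonneg L.2 ht
    linarith
  have he_der : ∀ t, HasDerivAt e (-(2 * L) * e t) t := fun t => by
    have h1 := (((hasDerivAt_id t).const_mul (-(2 * L : ℝ))).exp).const_mul e₀
    refine HasDerivAt.congr_deriv (f := e) h1 ?_
    simp only [he, id]
    ring
  have he_cd : ContDiff ℝ 1 e := by fun_prop
  obtain ⟨Ke, hKe⟩ := (he_cd.contDiffOn (s := Icc 0 T)).exists_lipschitzOnWith one_ne_zero
    (convex_Icc _ _) isCompact_Icc
  set s : ℝ → E N → ℝ := fun t y => e t - ‖y - γ t‖ ^ 2 with hs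
  set k : ℝ → E N → ℝ := fun t y => F y * sqPos (s t y) with hk
  obtain ⟨M, hM, hMb⟩ := hγ.exists_norm_sub_le hX hT
  have hγK : ∀ t ∈ Icc 0 T, ‖γ t - x₀‖ ≤ ρ := fun t ht => mem_closedBall_iff_norm.1 (hγ.2.1 t ht)
  have hρ : 0 ≤ ρ := (norm_nonneg _).trans (hγK 0 ⟨le_rfl, hT⟩)
  have hsupp : ∀ t ∈ Icc 0 T, ∀ y, y ∉ K → s t y ≤ 0 := fun t ht y hy => by
    by_contra hcon
    have h1 : ‖y - γ t‖ ^ 2 < 1 := by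
      have := he_le t ht.1
      simp only [hs] at hcon
      linarith
    have h2 : ‖y - γ t‖ < 1 := by
      rwa [sq_lt_one_iff₀ (norm_nonneg _)] at h1
    refine hy (mem_closedBall_iff_norm.2 ?_)
    calc ‖y - x₀‖ ≤ ‖y - γ t‖ + ‖γ t - x₀‖ := norm_sub_le_norm_sub_add_norm_sub _ _ _
      _ ≤ ρ + 1 := by linarith [hγK t ht]
  have hk0 : ∀ t ∈ Icc 0 T, ∀ y, y ∉ K → k t y = 0 := fun t ht y hy => by
    simp [hk, sqPos_of_nonpos (hsupp t ht y hy)]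
  have hs_cd : ∀ t, ContDiff ℝ 1 (s t) := fun t =>
    contDiff_const.sub ((contDiff_id.sub contDiff_const).norm_sq ℝ)
  have hk_cd : ∀ t, ContDiff ℝ 1 (k t) := fun t => hF.mul (contDiff_sqPos.comp (hs_cd t))
  have hk_supp : ∀ t ∈ Icc 0 T, HasCompactSupport (k t) := fun t ht =>
    HasCompactSupport.intro hKc (hk0 t ht)
  have hk_tsupp : ∀ t ∈ Icc 0 T, tsupport (k t) ⊆ K := fun t ht =>
    closure_minimal (fun y hy => by
      by_contra h
      exact hy (hk0 t ht y h)) hKc.isClosed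
  have hk_int : ∀ t ∈ Icc 0 T, Integrable (k t) := fun t ht =>
    (hk_cd t).continuous.integrable_of_hasCompactSupport (hk_supp t ht)
  have hk_nn : ∀ t y, 0 ≤ k t y := fun t y => mul_nonneg (hF0 y) (sqPos_nonneg _)
  obtain ⟨CF, hCF⟩ := hKc.exists_bound_of_continuousOn hF.continuous.continuousOn
  set Ls : ℝ := Ke + 2 * (2 * ρ + 1) * M with hLs
  have hLs0 : 0 ≤ Ls := by positivity
  set bound : E N → ℝ := K.indicator fun _ => CF * (2 * 1 * Ls) with hbound
  have hs_lip : ∀ y ∈ K, ∀ t ∈ Icc 0 T, ∀ t' ∈ Icc 0 T, |s t y - s t' y| ≤ Ls * |t - t'| := by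
    intro y hy t ht t' ht'
    have h1 : |e t - e t'| ≤ Ke * |t - t'| := by
      simpa [Real.dist_eq] using hKe.dist_le_mul t ht t' ht'
    have h2 : ‖γ t' - γ t‖ ≤ M * |t - t'| := by
      rcases le_total t t' with h | h
      · rw [abs_sub_comm, abs_of_nonneg (by linarith)]
        exact hMb t t' ht.1 h ht'.2
      · rw [norm_sub_rev, abs_of_nonneg (by linarith)]
        exact hMb t' t ht'.1 h ht.2
    have h3 : ∀ r ∈ Icc 0 T, ‖y - γ r‖ ≤ 2 * ρ + 1 := fun r hr => by
      have h4 := mem_closedBall_iff_norm.1 hy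
      calc ‖y - γ r‖ ≤ ‖y - x₀‖ + ‖x₀ - γ r‖ := norm_sub_le_norm_sub_add_norm_sub _ _ _
        _ ≤ 2 * ρ + 1 := by
          rw [norm_sub_rev x₀]
          linarith [hγK r hr]
    have h5 : |‖y - γ t'‖ ^ 2 - ‖y - γ t‖ ^ 2| ≤ 2 * (2 * ρ + 1) * (M * |t - t'|) := by
      have h6 : ‖y - γ t'‖ ^ 2 - ‖y - γ t‖ ^ 2 =
        (‖y - γ t'‖ + ‖y - γ t‖) * (‖y - γ t'‖ - ‖y - γ t‖) := by ring
      have h7 : |‖y - γ t'‖ - ‖y - γ t‖| ≤ ‖γ t' - γ t‖ := by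
        refine (abs_norm_sub_norm_le _ _).trans (le_of_eq ?_)
        rw [sub_sub_sub_cancel_left, norm_sub_rev]
      rw [h6, abs_mul, abs_of_nonneg (by positivity)]
      refine mul_le_mul ?_ (h7.trans h2) (abs_nonneg _) (by positivity)
      linarith [h3 t ht, h3 t' ht']
    calc |s t y - s t' y| = |(e t - e t') + (‖y - γ t'‖ ^ 2 - ‖y - γ t‖ ^ 2)| := by
          simp only [hs]
          congr 1
          ring
      _ ≤ |e t - e t'| + |‖y - γ t'‖ ^ 2 - ‖y - γ t‖ ^ 2| := abs_add_le _ _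
      _ ≤ Ke * |t - t'| + 2 * (2 * ρ + 1) * (M * |t - t'|) := add_le_add h1 h5
      _ = Ls * |t - t'| := by
          rw [hLs]
          ring
  -- An integrable Lipschitz constant in time serves twice: for the absolute continuity of `v` and
  -- for differentiating under the integral.
  have hk_lip : ∀ y, ∀ t ∈ Icc 0 T, ∀ t' ∈ Icc 0 T, |k t y - k t' y| ≤ bound y * |t - t'| := by
    intro y t ht t' ht'
    by_cases hy : y ∈ K
    · simp only [hbound, indicator_of_mem hy]
      have h1 : ∀ r ∈ Icc 0 T, s r y ≤ 1 := fun r hr => by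
        have := he_le r hr.1
        have h2 : 0 ≤ ‖y - γ r‖ ^ 2 := by positivity
        simp only [hs]
        linarith
      have h2 : |F y| ≤ CF := hCF y hy
      have hCF0 : 0 ≤ CF := (abs_nonneg _).trans h2
      calc |k t y - k t' y| = |F y| * |sqPos (s t y) - sqPos (s t' y)| := by
            rw [← abs_mul]
            congr 1
            simp only [hk]
            ring
        _ ≤ CF * (2 * 1 * |s t y - s t' y|) := by
            gcongr
            exact abs_sqPos_sub_le (h1 t ht) (h1 t' ht') zero_le_one
        _ ≤ CF * (2 * 1 * (Ls * |t - t'|)) := by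
            gcongr
            exact hs_lip y hy t ht t' ht'
        _ = _ := by ring
    · simp [hk0 t ht y hy, hk0 t' ht' y hy, hbound, hy]
  have hbound_int : Integrable bound :=
    (integrable_indicator_iff hKc.measurableSet).2 (integrableOn_const hKc.measure_lt_top.ne)
  have hbound_nn : ∀ y, 0 ≤ bound y := fun y => by
    refine indicator_nonneg (fun z hz => ?_) y
    have : 0 ≤ CF := (norm_nonneg _).trans (hCF z hz)
    positivity
  set v : ℝ → ℝ := fun t => ∫ y, k t y with hv
  have hv_ac : AbsolutelyContinuousOnInterval v 0 T := by
    refine LipschitzOnWith.absolutelyContinuousOnInterval (K := (∫ y, bound y).toNNReal) ?_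
    rw [uIcc_of_le hT]
    refine LipschitzOnWith.of_dist_le_mul fun t ht t' ht' => ?_
    rw [Real.coe_toNNReal _ (integral_nonneg hbound_nn), Real.dist_eq, Real.dist_eq, hv,
      ← integral_sub (hk_int t ht) (hk_int t' ht'), ← integral_mul_const]
    exact abs_integral_le_integral_abs.trans (integral_mono_of_nonneg
      (Eventually.of_forall fun y => abs_nonneg _) (hbound_int.mul_const _)
      (Eventually.of_forall fun y => hk_lip y t ht t' ht'))
  set β := ∫ y in K, ‖xGrad X F y‖ with hβ
  have hXF : Continuous (xGrad X F) := continuous_xGrad hX hF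
  have hβ0 : 0 ≤ β := integral_nonneg fun y => norm_nonneg _
  have hder : ∀ t ∈ Ioo 0 T, ∀ θ : Fin m → ℝ, ∑ j, θ j ^ 2 ≤ 1 →
      HasDerivAt γ (∑ j, θ j • X j (γ t)) t → ∃ d ≤ N * L * v t + β, HasDerivAt v d t := by
    intro t ht θ hθ hγt
    have ht' : t ∈ Icc 0 T := ⟨ht.1.le, ht.2.le⟩
    -- The controls are frozen at time `t`: `Y` is a fixed Lipschitz field whose value at `γ t` is
    -- the velocity of the path.
    set Y : E N → E N := fun y => ∑ j, θ j • X j y with hY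
    have hYc : Continuous Y := continuous_finsetSum _ fun j _ => by
      have := (hX j).continuous
      fun_prop
    set w := Y (γ t) with hw
    set k' : E N → ℝ := fun y =>
      F y * (2 * max (s t y) 0 * (-(2 * L) * e t + 2 * inner ℝ (y - γ t) w)) with hk'
    have hk'_der : ∀ y, HasDerivAt (fun r => k r y) (k' y) t := fun y => by
      have h1 := ((hasDerivAt_const t y).sub hγt).norm_sq
      have h2 := (he_der t).sub h1
      have h3 := ((hasDerivAt_sqPos (s t y)).comp t h2).const_mul (F y)
      refine HasDerivAt.congr_deriv (f := fun r => k r y) h3 ?_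
      simp only [hk', zero_sub, inner_neg_right, Pi.sub_apply]
      ring
    have hk'_cont : Continuous k' := by
      have := (hs_cd t).continuous
      have := hF.continuous
      simp only [hk']
      fun_prop
    obtain ⟨hk'_int, hvd⟩ := hasDerivAt_integral_of_dominated_loc_of_lip (μ := volume)
      (F := k) (bound := bound) (Icc_mem_nhds ht.1 ht.2)
      (Eventually.of_forall fun r => (hk_cd r).continuous.aestronglyMeasurable) (hk_int t ht')
      hk'_cont.aestronglyMeasurable (Eventually.of_forall fun y =>
        LipschitzOnWith.of_dist_le_mul fun r hr r' hr' => by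
          rw [Real.coe_nnabs, abs_of_nonneg (hbound_nn y)]
          exact hk_lip y r hr r' hr') hbound_int (Eventually.of_forall hk'_der)
    refine ⟨_, ?_, hvd⟩
    set D : E N → ℝ := fun y => fderiv ℝ (k t) y (Y y) with hD
    have hD_cont : Continuous D := ((hk_cd t).continuous_fderiv one_ne_zero).clm_apply hYc
    have hD_eq : ∀ y, D y = sqPos (s t y) * fderiv ℝ F y (Y y) +
        F y * (2 * max (s t y) 0 * (-(2 * inner ℝ (y - γ t) (Y y)))) := fun y => by
      have h1 : HasFDerivAt F (fderiv ℝ F y) y := (hF.differentiable one_ne_zero y).hasFDerivAt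
      have h2 := (((hasFDerivAt_id y).sub_const (γ t)).norm_sq).const_sub (e t)
      have h3 := (hasDerivAt_sqPos (s t y)).comp_hasFDerivAt y h2
      have h4 := (h1.mul h3).fderiv
      have h5 : fderiv ℝ (k t) y = _ := h4
      simp only [hD, h5]
      simp [inner_sub_left]
      ring
    have hDint : Integrable D := by
      refine hD_cont.integrable_of_hasCompactSupport (HasCompactSupport.intro hKc fun y hy => ?_)
      rw [hD_eq, sqPos_of_nonpos (hsupp t ht' y hy), max_eq_right (hsupp t ht' y hy)]
      simp
    set b : E N → ℝ := K.indicator fun y => ‖xGrad X F y‖ with hb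
    have hb_int : Integrable b := (integrable_indicator_iff hKc.measurableSet).2
      (hXF.norm.continuousOn.integrableOn_compact hKc)
    -- Adding `D` to `k'` leaves `sqPos (s t y)` times the derivative of `F` along `Y`, which `b`
    -- dominates, and `F` times `2 max (s t y) 0` times `-2L e t + 2 ⟨y - γ t, Y(γ t) - Y y⟩`. On
    -- the bump `‖y - γ t‖² < e t`, so the last factor is nonpositive. The integral of `D` is then
    -- small by the divergence bound.
    have hpt : ∀ y, k' y ≤ -D y + b y := fun y => by
      by_cases hpos : 0 < s t y
      · have hyK : y ∈ K := by
          by_contra h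
          exact absurd (hsupp t ht' y h) (not_le.2 hpos)
        have hγtK : γ t ∈ K := Metric.closedBall_subset_closedBall (by linarith)
          (hγ.2.1 t ht')
        have h1 : ‖w - Y y‖ ≤ L * ‖y - γ t‖ := by
          have := (hL θ hθ).dist_le_mul (γ t) hγtK y hyK
          rwa [dist_eq_norm, dist_eq_norm, norm_sub_rev (γ t)] at this
        have h2 : inner ℝ (y - γ t) (w - Y y) ≤ L * e t := by
          calc inner ℝ (y - γ t) (w - Y y) ≤ ‖y - γ t‖ * ‖w - Y y‖ := real_inner_le_norm _ _
            _ ≤ ‖y - γ t‖ * (L * ‖y - γ t‖) := by gcongr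
            _ = L * ‖y - γ t‖ ^ 2 := by ring
            _ ≤ L * e t := by
              simp only [hs] at hpos
              gcongr
              linarith
        have h3 : |sqPos (s t y) * fderiv ℝ F y (Y y)| ≤ ‖xGrad X F y‖ := by
          rw [abs_mul, abs_of_nonneg (sqPos_nonneg _)]
          refine (mul_le_of_le_one_left (abs_nonneg _) ?_).trans (abs_fderiv_sum_smul_le hθ)
          have h4 : s t y ≤ 1 := by
            have h5 := he_le t ht'.1
            have h6 : 0 ≤ ‖y - γ t‖ ^ 2 := by positivity
            simp only [hs]
            linarith
          rw [sqPos, max_eq_left hpos.le]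
          exact pow_le_one₀ hpos.le h4
        rw [hD_eq]
        simp only [hb, indicator_of_mem hyK, hk']
        rw [inner_sub_right] at h2
        have h7 : F y * (2 * max (s t y) 0 *
            (-(2 * L) * e t + 2 * (inner ℝ (y - γ t) w - inner ℝ (y - γ t) (Y y)))) ≤ 0 := by
          refine mul_nonpos_of_nonneg_of_nonpos (hF0 y)
            (mul_nonpos_of_nonneg_of_nonpos (by positivity) ?_)
          linarith
        have h8 := neg_le_of_abs_le h3
        have h9 := le_of_abs_le h3
        nlinarith
      · have hnp := not_lt.1 hpos
        have h1 : 0 ≤ b y := indicator_nonneg (fun z _ => norm_nonneg _) y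
        rw [hD_eq]
        simpa [hk', sqPos_of_nonpos hnp, max_eq_right hnp] using h1
    have h1 : ∫ y, k' y ≤ -(∫ y, D y) + β := by
      have h2 : ∫ y, b y = β := integral_indicator hKc.measurableSet
      have h3 : Integrable fun y => -D y := hDint.neg
      rw [← h2, ← integral_neg, ← integral_add h3 hb_int]
      exact integral_mono hk'_int (h3.add hb_int) hpt
    have h3 := abs_integral_fderiv_apply_le (hL θ hθ) (hk_cd t) (hk_supp t ht') (hk_tsupp t ht')
      (hk_nn t)
    have h4 := neg_le_of_abs_le h3
    linarith
  set c : ℝ := N * L with hc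
  have hc0 : 0 ≤ c := by positivity
  -- Integrating factor for `v' ≤ c v + β`.
  set u : ℝ → ℝ := fun t => Real.exp (-c * t) * v t with hu
  have hu_ac : AbsolutelyContinuousOnInterval u 0 T := by
    refine AbsolutelyContinuousOnInterval.mul (ContDiffOn.absolutelyContinuousOnInterval ?_) hv_ac
    exact ContDiff.contDiffOn (by fun_prop)
  obtain ⟨-, -, θ, -, hθ⟩ := hγ
  have hmain := sub_le_of_ae_hasDerivAt_le (c := β) hT hu_ac (by
    have hne : ∀ᵐ t : ℝ, t ≠ 0 ∧ t ≠ T := by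
      refine Filter.Eventually.and ?_ ?_ <;> simp [ae_iff]
    filter_upwards [hθ, hne] with t ht htne htm
    have hto : t ∈ Ioo 0 T := ⟨lt_of_le_of_ne htm.1 htne.1.symm, lt_of_le_of_ne htm.2 htne.2⟩
    obtain ⟨d, hd, hvd⟩ := hder t hto (θ t) (ht htm).1 (ht htm).2
    refine ⟨_, ?_, ((((hasDerivAt_id t).const_mul (-c)).exp).mul hvd)⟩
    have h1 : Real.exp (-c * t) ≤ 1 := Real.exp_le_one_iff.2 (by nlinarith [htm.1])
    have h2 := Real.exp_pos (-c * t)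
    simp only [id, mul_one]
    calc Real.exp (-c * t) * -c * v t + Real.exp (-c * t) * d
        ≤ Real.exp (-c * t) * -c * v t + Real.exp (-c * t) * (c * v t + β) := by gcongr
      _ = Real.exp (-c * t) * β := by ring
      _ ≤ β := mul_le_of_le_one_left hβ0 h1)
  have hexp : Real.exp (c * T) * Real.exp (-c * T) = 1 := by
    rw [← Real.exp_add]
    simp
  have h0 : u 0 = ∫ y, F y * sqPos (e₀ - ‖y - γ 0‖ ^ 2) := by
    simp [hu, hv, hk, hs, he]
  calc ∫ y, F y * sqPos (e₀ * Real.exp (-(2 * L) * T) - ‖y - γ T‖ ^ 2) = v T := rfl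
    _ = Real.exp (c * T) * u T := by
      simp only [hu]
      rw [← mul_assoc, hexp, one_mul]
    _ ≤ Real.exp (c * T) * (u 0 + T * β) := by
      gcongr
      linarith
    _ = _ := by rw [h0]

end TransportEstimate

/-! ### Control of the additive constant by leaving `Ω`. -/

section MeanBound

variable {X : Fin m → E N → E N}

theorem exists_lipschitzOnWith_sum_smul (hX : ∀ j, LocallyLipschitz (X j)) {K : Set (E N)}
    (hK : IsCompact K) : ∃ L : NNReal, ∀ θ : Fin m → ℝ, ∑ j, θ j ^ 2 ≤ 1 →
      LipschitzOnWith L (fun y => ∑ j, θ j • X j y) K := by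
  have h1 : ∀ j, ∃ L : NNReal, LipschitzOnWith L (X j) K := fun j =>
    LocallyLipschitzOn.exists_lipschitzOnWith_of_compact hK (hX j).locallyLipschitzOn
  choose L hL using h1
  refine ⟨∑ j, L j, fun θ hθ => LipschitzOnWith.of_dist_le_mul fun x hx y hy => ?_⟩
  rw [dist_eq_norm, ← Finset.sum_sub_distrib]
  simp_rw [← smul_sub]
  refine (norm_sum_smul_le hθ _).trans ?_
  push_cast
  rw [Finset.sum_mul]
  refine Finset.sum_le_sum fun j _ => ?_
  rw [← dist_eq_norm]
  exact (hL j).dist_le_mul x hx y hy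

/-- Some subunit path starting at `x₀ ∈ Ω` reaches a neighbourhood of a point outside `Ω`, at a
scale that decays at a given exponential rate. -/
theorem exists_isSubunit_exit (hN : 0 < N) {Ω : Set (E N)}
    {x₀ : E N} (hx₀ : x₀ ∈ Ω) {R : ℝ} (hRΩ : ∀ y ∈ Ω, ccDist X x₀ y < ENNReal.ofReal R)
    {ρ : ℝ} (hρ0 : 1 ≤ ρ) (hρ : ∀ y ∈ Ω, ‖y - x₀‖ ≤ ρ - 1) {e₀ l : ℝ} (he₀ : 0 < e₀) (he₁ : e₀ ≤ 1)
    (hl : 0 ≤ l) :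
    ∃ T : ℝ, 0 ≤ T ∧ ∃ γ : ℝ → E N, IsSubunit X (Metric.closedBall x₀ ρ) T γ ∧ γ 0 = x₀ ∧
      ∃ O : Set (E N), IsOpen O ∧ O.Nonempty ∧ Disjoint O Ω ∧
        ∀ z ∈ O, ‖z - γ T‖ ^ 2 < e₀ * Real.exp (-l * T) := by
  set i₀ : Fin N := ⟨0, hN⟩
  -- Every path used lasts less than `R`, so `δ²` is a lower bound for the final squared radius and
  -- can be fixed before the path is chosen. A point of `Ω` whose coordinate is within `δ/2` of its
  -- supremum has points off `Ω` within distance `δ`.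
  set δ := Real.sqrt (e₀ * Real.exp (-l * R)) with hδ
  have hδ0 : 0 < δ := Real.sqrt_pos.2 (by positivity)
  have hcoord : ∀ y : E N, |y i₀| ≤ ‖y‖ := fun y => by
    simpa using PiLp.norm_apply_le y i₀
  set S : Set ℝ := (fun y : E N => y i₀) '' Ω with hS
  have hSb : BddAbove S := by
    refine ⟨‖x₀‖ + (ρ - 1), ?_⟩
    rintro _ ⟨y, hy, rfl⟩
    have h1 : ‖y‖ ≤ ‖y - x₀‖ + ‖x₀‖ := norm_le_norm_sub_add y x₀
    linarith [le_of_abs_le (hcoord y), hρ y hy]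
  have hSne : S.Nonempty := ⟨_, mem_image_of_mem _ hx₀⟩
  obtain ⟨_, ⟨y, hyΩ, rfl⟩, hy⟩ := exists_lt_of_lt_csSup hSne (sub_lt_self (sSup S) (half_pos hδ0))
  obtain ⟨T, hT, hTR, γ, hγ, h0, h1⟩ := ccDist_lt_iff.1 (hRΩ y hyΩ)
  have hTR' : T < R := by
    rw [ENNReal.ofReal_lt_ofReal_iff_of_nonneg hT.le] at hTR
    exact hTR
  -- If the path stays in the large ball, its endpoint is near the open half-space beyond the
  -- supremum. If it leaves, it is stopped on the sphere of radius `ρ`, where a unit neighbourhood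
  -- misses `Ω` because `Ω` lies within radius `ρ - 1`.
  by_cases hstay : ∀ t ∈ Icc 0 T, ‖γ t - x₀‖ ≤ ρ
  · refine ⟨T, hT.le, γ, hγ.mono hT.le le_rfl fun t ht => mem_closedBall_iff_norm.2 (hstay t ht), h0,
      {z | ‖z - γ T‖ ^ 2 < e₀ * Real.exp (-l * T)} ∩ {z | sSup S < z i₀}, ?_, ?_, ?_,
      fun z hz => hz.1⟩
    · refine IsOpen.inter (isOpen_lt (by fun_prop) continuous_const)
        (isOpen_lt continuous_const (by fun_prop))
    · refine ⟨y + EuclideanSpace.single i₀ (3 / 4 * δ), ?_, ?_⟩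
      · have h3 : δ ^ 2 = e₀ * Real.exp (-l * R) := Real.sq_sqrt (by positivity)
        have h4 : e₀ * Real.exp (-l * R) ≤ e₀ * Real.exp (-l * T) := by
          gcongr ?_ * Real.exp ?_
          nlinarith
        simp only [mem_ofPred_eq, h1, add_sub_cancel_left, PiLp.norm_single, Real.norm_eq_abs,
          sq_abs]
        nlinarith
      · simp only [mem_ofPred_eq, PiLp.add_apply, PiLp.single_apply, if_true]
        linarith
    · rw [Set.disjoint_left]
      rintro z ⟨-, hz⟩ hzΩ
      exact absurd (le_csSup hSb (mem_image_of_mem _ hzΩ)) (not_le.2 hz)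
  · push Not at hstay
    obtain ⟨t₁, ht₁, ht₁ρ⟩ := hstay
    obtain ⟨t, ht, htt, hte, htl⟩ := exists_first_hit (f := fun t => ‖γ t - x₀‖) (c := ρ) ht₁.1
      (((hγ.continuousOn hT.le).mono (Icc_subset_Icc_right ht₁.2)).sub continuousOn_const).norm
      (by simp [h0]; linarith) ht₁ρ.le
    refine ⟨t, ht.le, γ, hγ.mono ht.le (htt.trans ht₁.2) fun s hs =>
      mem_closedBall_iff_norm.2 (htl s hs), h0, {z | ‖z - γ t‖ ^ 2 < e₀ * Real.exp (-l * t)},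
      isOpen_lt (by fun_prop) continuous_const, ⟨γ t, ?_⟩, ?_, fun z hz => hz⟩
    · simp only [mem_ofPred_eq, sub_self, norm_zero, zero_pow two_ne_zero]
      positivity
    · rw [Set.disjoint_left]
      intro z hz hzΩ
      have h3 : ‖z - γ t‖ ^ 2 < 1 := by
        refine lt_of_lt_of_le hz (mul_le_one₀ he₁ (Real.exp_pos _).le (Real.exp_le_one_iff.2 ?_))
        nlinarith
      rw [sq_lt_one_iff₀ (norm_nonneg _)] at h3
      have h4 := hρ z hzΩ
      have h5 : ‖γ t - x₀‖ ≤ ‖γ t - z‖ + ‖z - x₀‖ := norm_sub_le_norm_sub_add_norm_sub _ _ _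
      rw [norm_sub_rev (γ t) z] at h5
      linarith

/-- A constant is controlled by its distance to functions vanishing near the boundary. -/
theorem exists_sq_le_mul_integral (hN : 0 < N) (hX : ∀ j, LocallyLipschitz (X j)) {Ω : Set (E N)}
    (hΩ : IsOpen Ω) (hΩb : Bornology.IsBounded Ω) {x₀ : E N} (hx₀ : x₀ ∈ Ω) {R : ℝ}
    (hRΩ : ∀ y ∈ Ω, ccDist X x₀ y < ENNReal.ofReal R) :
    ∃ C : ℝ, 0 < C ∧ ∀ φ : E N → ℝ, ContDiff ℝ 1 φ → HasCompactSupport φ → tsupport φ ⊆ Ω →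
      ∀ a : ℝ, a ^ 2 ≤ C * ((∫ y in Ω, (φ y - a) ^ 2) + ∫ y in Ω, |φ y - a| * ‖xGrad X φ y‖) := by
  obtain ⟨r, hr⟩ := hΩb.subset_closedBall x₀
  set ρ := max r 0 + 1 with hρ
  have hρ0 : 1 ≤ ρ := by
    have := le_max_right r 0
    linarith
  have hρΩ : ∀ y ∈ Ω, ‖y - x₀‖ ≤ ρ - 1 := fun y hy => by
    have := mem_closedBall_iff_norm.1 (hr hy)
    rw [hρ, add_sub_cancel_right]
    exact this.trans (le_max_left _ _)
  obtain ⟨ε, hε, hεΩ⟩ := Metric.isOpen_iff.1 hΩ x₀ hx₀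
  -- The initial bump, positive only at distance less than `√e₀` from `x₀`, must be supported in
  -- `Ω`.
  set e₀ := min ε 1 ^ 2 with he₀
  have hmin : 0 < min ε 1 := lt_min hε one_pos
  have he₀0 : 0 < e₀ := by positivity
  have he₀1 : e₀ ≤ 1 := pow_le_one₀ hmin.le (min_le_right _ _)
  set K := Metric.closedBall x₀ (ρ + 1) with hK
  obtain ⟨L, hL⟩ := exists_lipschitzOnWith_sum_smul hX (isCompact_closedBall x₀ (ρ + 1))
  obtain ⟨T, hT, γ, hγ, h0, O, hO, hOne, hOΩ, hOe⟩ := exists_isSubunit_exit hN hx₀ hRΩ hρ0 hρΩ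
    he₀0 he₀1 (l := 2 * L) (by positivity)
  set h : E N → ℝ := fun y => sqPos (e₀ * Real.exp (-(2 * L) * T) - ‖y - γ T‖ ^ 2) with hh
  have hhc : Continuous h := contDiff_sqPos.continuous.comp (by fun_prop)
  have heT : e₀ * Real.exp (-(2 * L) * T) ≤ 1 := by
    refine mul_le_one₀ he₀1 (Real.exp_pos _).le (Real.exp_le_one_iff.2 ?_)
    have : 0 ≤ (L : ℝ) * T := by positivity
    linarith
  have hhs : HasCompactSupport h := by
    refine HasCompactSupport.intro (isCompact_closedBall (γ T) 1) fun y hy => sqPos_of_nonpos ?_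
    rw [mem_closedBall_iff_norm, not_le] at hy
    nlinarith
  have hh0 : ∀ y, 0 ≤ h y := fun y => sqPos_nonneg _
  have hhi : Integrable h := hhc.integrable_of_hasCompactSupport hhs
  set κ := ∫ y in O, h y with hκ
  have hκ0 : 0 < κ := by
    rw [hκ, setIntegral_pos_iff_support_of_nonneg_ae (Eventually.of_forall hh0) hhi.integrableOn]
    refine (hO.measure_pos volume hOne).trans_le (measure_mono fun y hy => ⟨?_, hy⟩)
    exact (sqPos_pos (sub_pos.2 (hOe y hy))).ne'
  set c := Real.exp (N * L * T) with hc
  have hc0 : 0 < c := Real.exp_pos _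
  refine ⟨c * (1 + 2 * T) / κ, by positivity, fun φ hφ hφs hφΩ a => ?_⟩
  -- `F = a²` on `O`, where `φ` vanishes, and `|XF| = 2 |φ - a| |Xφ|` vanishes off `Ω`. Transporting
  -- `F` from `x₀` to `O` thus bounds `a²` by integrals over `Ω`.
  set F : E N → ℝ := fun y => (φ y - a) ^ 2 with hF
  have hFc : ContDiff ℝ 1 F := (hφ.sub contDiff_const).pow 2
  have hF0 : ∀ y, 0 ≤ F y := fun y => sq_nonneg _
  have hmain := integral_mul_sqPos_le hX hL hT hγ he₀0 he₀1 hFc hF0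
  have hgrad : ∀ y, ‖xGrad X F y‖ = 2 * (|φ y - a| * ‖xGrad X φ y‖) := fun y => by
    have h1 : xGrad X F y = (2 * (φ y - a)) • xGrad X φ y := by
      have h2 : HasFDerivAt (fun y => φ y - a) (fderiv ℝ φ y) y :=
        ((hφ.differentiable one_ne_zero y).hasFDerivAt).sub_const a
      have h3 : fderiv ℝ F y = _ := (h2.pow 2).fderiv
      ext j
      simp [xGrad, h3]
    rw [h1, norm_smul, Real.norm_eq_abs, abs_mul, abs_two]
    ring
  have hφint : ∫ y in K, ‖xGrad X F y‖ ≤ 2 * ∫ y in Ω, |φ y - a| * ‖xGrad X φ y‖ := by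
    have hi : Integrable fun y => 2 * (|φ y - a| * ‖xGrad X φ y‖) := by
      refine Continuous.integrable_of_hasCompactSupport ?_ ?_
      · exact continuous_const.mul ((hφ.continuous.sub continuous_const).abs.mul
          (continuous_xGrad hX hφ).norm)
      · exact HasCompactSupport.intro hφs fun y hy => by
          simp [xGrad_eq_zero_of_notMem_tsupport hy]
    rw [← integral_const_mul]
    simp_rw [hgrad]
    rw [setIntegral_eq_integral_of_forall_compl_eq_zero (s := Ω)]
    · exact setIntegral_le_integral hi (Eventually.of_forall fun y => by positivity)
    · intro y hy
      simp [xGrad_eq_zero_of_notMem_tsupport fun h => hy (hφΩ h)]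
  have hFb : IntegrableOn F Ω := by
    obtain ⟨C, hC⟩ := hφs.exists_bound_of_continuous hφ.continuous
    refine Measure.integrableOn_of_bounded (M := (C + |a|) ^ 2) hΩb.measure_lt_top.ne
      hFc.continuous.aestronglyMeasurable (Eventually.of_forall fun y => ?_)
    rw [Real.norm_of_nonneg (hF0 y), hF]
    simp only
    rw [← sq_abs (φ y - a)]
    have h1 : |φ y - a| ≤ |φ y| + |a| := norm_sub_le (φ y) a
    have h2 : |φ y| ≤ C := hC y
    exact pow_le_pow_left₀ (abs_nonneg _) (by linarith) 2
  have hstart : ∫ y, F y * sqPos (e₀ - ‖y - γ 0‖ ^ 2) ≤ ∫ y in Ω, F y := by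
    rw [h0, ← integral_indicator hΩ.measurableSet]
    refine integral_mono_of_nonneg (Eventually.of_forall fun y =>
      mul_nonneg (hF0 y) (sqPos_nonneg _)) ((integrable_indicator_iff hΩ.measurableSet).2 hFb)
      (Eventually.of_forall fun y => ?_)
    simp only
    by_cases hy : y ∈ Ω
    · rw [indicator_of_mem hy]
      refine mul_le_of_le_one_right (hF0 y) ?_
      rw [sqPos]
      refine pow_le_one₀ (le_max_right _ _) (max_le ?_ zero_le_one)
      have : 0 ≤ ‖y - x₀‖ ^ 2 := by positivity
      linarith
    · rw [indicator_of_notMem hy, sqPos_of_nonpos, mul_zero]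
      have h1 : ε ≤ ‖y - x₀‖ := by
        by_contra hcon
        exact hy (hεΩ (mem_ball_iff_norm.2 (not_le.1 hcon)))
      have h2 : min ε 1 ≤ ‖y - x₀‖ := (min_le_left _ _).trans h1
      rw [he₀, sub_nonpos]
      gcongr
  have hend : a ^ 2 * κ ≤ ∫ y, F y * h y := by
    have hFi : Integrable fun y => F y * h y :=
      (hFc.continuous.mul hhc).integrable_of_hasCompactSupport hhs.mul_left
    rw [hκ, ← integral_const_mul]
    refine le_trans (le_of_eq (setIntegral_congr_fun hO.measurableSet fun y hy => ?_))
      (setIntegral_le_integral hFi (Eventually.of_forall fun y => mul_nonneg (hF0 y) (hh0 y)))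
    have h1 : φ y = 0 := image_eq_zero_of_notMem_tsupport fun hyt =>
      Set.disjoint_left.1 hOΩ hy (hφΩ hyt)
    simp [hF, h1]
  have hP : 0 ≤ ∫ y in Ω, F y := integral_nonneg hF0
  have hP' : 0 ≤ ∫ y in Ω, |φ y - a| * ‖xGrad X φ y‖ := integral_nonneg fun y => by positivity
  rw [div_mul_eq_mul_div, le_div_iff₀ hκ0]
  calc a ^ 2 * κ ≤ c * ((∫ y in Ω, F y) + T * (2 * ∫ y in Ω, |φ y - a| * ‖xGrad X φ y‖)) := by
        refine hend.trans (hmain.trans ?_)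
        gcongr
    _ ≤ c * (1 + 2 * T) * ((∫ y in Ω, F y) + ∫ y in Ω, |φ y - a| * ‖xGrad X φ y‖) := by
        rw [mul_assoc]
        gcongr
        nlinarith

end MeanBound

/-! ### The Sobolev inequality on test functions. -/

section Sobolev

variable {X : Fin m → E N → E N} {U Ω : Set (E N)} {Q : ℝ}

theorem integral_sq_le_of_eLpNorm_two_le {α : Type*} [MeasurableSpace α] {μ : Measure α} {f : α → ℝ}
    (hf : AEStronglyMeasurable f μ) {c : ℝ} (hc : 0 ≤ c) (h : eLpNorm f 2 μ ≤ ENNReal.ofReal c) :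
    ∫ x, f x ^ 2 ∂μ ≤ c ^ 2 := by
  rw [integral_eq_lintegral_of_nonneg_ae (Eventually.of_forall fun x => sq_nonneg _) (hf.pow 2)]
  refine ENNReal.toReal_le_of_le_ofReal (by positivity) ?_
  have h1 := eLpNorm_nnreal_pow_eq_lintegral (μ := μ) (f := f) (p := 2) two_ne_zero
  have h2 : ∫⁻ x, ENNReal.ofReal (f x ^ 2) ∂μ = eLpNorm f 2 μ ^ 2 := by
    have h3 : (eLpNorm f ((2 : NNReal) : ℝ≥0∞) μ) ^ ((2 : NNReal) : ℝ) = eLpNorm f 2 μ ^ 2 := by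
      norm_num
    rw [← h3, h1]
    refine lintegral_congr fun x => ?_
    rw [← sq_abs, ENNReal.ofReal_pow (abs_nonneg _), ← Real.norm_eq_abs, ofReal_norm]
    norm_num
  rw [h2, ENNReal.ofReal_pow hc]
  gcongr

/-- The Sobolev inequality on compactly supported functions. -/
theorem exists_eLpNorm_le_mul_eLpNorm_xGrad (hN : 0 < N) (hX : ∀ j, LocallyLipschitz (X j))
    (hΩ : IsOpen Ω) (hΩb : Bornology.IsBounded Ω) (hU : IsOpen U)
    (hΩU : U = Ω ∨ closure Ω ⊆ U) (hQ : 2 < Q) (hadm : IsAdmissible X U Q) :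
    ∃ S : ℝ, 0 < S ∧ ∀ φ : E N → ℝ, ContDiff ℝ 1 φ → HasCompactSupport φ → tsupport φ ⊆ Ω →
      eLpNorm φ (ENNReal.ofReal (2 * Q / (Q - 2))) (volume.restrict Ω) ≤
        ENNReal.ofReal S * eLpNorm (xGrad X φ) 2 (volume.restrict Ω) := by
  rcases Ω.eq_empty_or_nonempty with rfl | ⟨x₀, hx₀⟩
  · exact ⟨1, one_pos, fun φ _ _ _ => by simp⟩
  obtain ⟨R, hR, hRΩ⟩ := exists_subset_ccBall hX hU hadm hΩb hΩU
  have hsub := subset_of_eq_or_closure_subset hΩU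
  obtain ⟨S, hS, HS⟩ := exists_eLpNorm_sub_const_le hX hU hQ hadm hΩ hΩb hsub hx₀ hR hRΩ
  obtain ⟨C, hC, HC⟩ := exists_sq_le_mul_integral hN hX hΩ hΩb hx₀ (hRΩ x₀ hx₀)
  have hQ2 : 0 < Q - 2 := by linarith
  set p := 2 * Q / (Q - 2) with hp
  have hp2 : 2 ≤ p := by
    rw [hp, le_div_iff₀ hQ2]
    linarith
  have hp0 : 0 < p := by linarith
  set V := volume.real Ω with hV
  have hV0 : 0 ≤ V := measureReal_nonneg
  have hVl : ENNReal.ofReal V = volume Ω := ENNReal.ofReal_toReal hΩb.measure_lt_top.ne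
  set w := V ^ (1 / 2 - 1 / p) with hw
  set B := C * (3 / 2 * (S * w) ^ 2 + 1 / 2) with hB
  have hB0 : 0 ≤ B := by positivity
  refine ⟨S + Real.sqrt B * V ^ (1 / p) + 1, by positivity, fun φ hφ hφs hφΩ => ?_⟩
  obtain ⟨a, ha⟩ := HS φ hφ hφs hφΩ
  have hgrad := eLpNorm_two_xGrad hX hφ hφs hφΩ
  set G := ∫ y, ‖xGrad X φ y‖ ^ 2 with hG
  have hG0 : 0 ≤ G := integral_nonneg fun y => by positivity
  rw [← Real.sqrt_eq_rpow] at hgrad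
  set n := Real.sqrt G with hn
  have hn0 : 0 ≤ n := Real.sqrt_nonneg _
  have hn2 : n ^ 2 = G := Real.sq_sqrt hG0
  rw [hgrad, ← ENNReal.ofReal_mul hS] at ha
  rw [hgrad]
  have hXφ := continuous_xGrad hX hφ
  have hm : AEStronglyMeasurable (fun x => φ x - a) (volume.restrict Ω) :=
    (hφ.continuous.sub continuous_const).aestronglyMeasurable
  have h2 : eLpNorm (fun x => φ x - a) 2 (volume.restrict Ω) ≤ ENNReal.ofReal (S * n * w) := by
    have h3 := eLpNorm_le_eLpNorm_mul_rpow_measure_univ (μ := volume.restrict Ω) (p := 2)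
      (q := ENNReal.ofReal p) (by
        rw [← ENNReal.ofReal_ofNat]
        exact ENNReal.ofReal_le_ofReal hp2) hm
    refine h3.trans ?_
    rw [ENNReal.ofReal_mul (by positivity), Measure.restrict_apply_univ, ENNReal.toReal_ofNat,
      ENNReal.toReal_ofReal hp0.le, ← hVl, ENNReal.ofReal_rpow_of_nonneg hV0]
    · gcongr
    · rw [sub_nonneg]
      gcongr
  have h4 := integral_sq_le_of_eLpNorm_two_le hm (by positivity) h2
  have hgi : Integrable fun y => ‖xGrad X φ y‖ ^ 2 :=
    (hXφ.norm.pow 2).integrable_of_hasCompactSupport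
      (HasCompactSupport.intro hφs fun y hy => by simp [xGrad_eq_zero_of_notMem_tsupport hy])
  have hfi : Integrable (fun y => (φ y - a) ^ 2) (volume.restrict Ω) := by
    obtain ⟨C', hC'⟩ := hφs.exists_bound_of_continuous hφ.continuous
    refine Measure.integrableOn_of_bounded (M := (C' + |a|) ^ 2) hΩb.measure_lt_top.ne
      ((hφ.continuous.sub continuous_const).pow 2).aestronglyMeasurable
      (Eventually.of_forall fun y => ?_)
    rw [Real.norm_of_nonneg (sq_nonneg _), ← sq_abs (φ y - a)]
    have h5 : |φ y - a| ≤ |φ y| + |a| := norm_sub_le (φ y) a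
    have h6 : |φ y| ≤ C' := hC' y
    exact pow_le_pow_left₀ (abs_nonneg _) (by linarith) 2
  have h7 : ∫ y in Ω, |φ y - a| * ‖xGrad X φ y‖ ≤
      1 / 2 * (∫ y in Ω, (φ y - a) ^ 2) + 1 / 2 * G := by
    have h8 : ∫ y in Ω, ‖xGrad X φ y‖ ^ 2 ≤ G :=
      setIntegral_le_integral hgi (Eventually.of_forall fun y => by positivity)
    calc ∫ y in Ω, |φ y - a| * ‖xGrad X φ y‖
        ≤ ∫ y in Ω, (1 / 2 * (φ y - a) ^ 2 + 1 / 2 * ‖xGrad X φ y‖ ^ 2) := by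
          refine integral_mono_of_nonneg (Eventually.of_forall fun y => by positivity)
            ((hfi.const_mul _).add (hgi.integrableOn.const_mul _)) (Eventually.of_forall fun y => ?_)
          simp only
          rw [← sq_abs (φ y - a)]
          nlinarith [sq_nonneg (|φ y - a| - ‖xGrad X φ y‖)]
      _ = 1 / 2 * (∫ y in Ω, (φ y - a) ^ 2) + 1 / 2 * ∫ y in Ω, ‖xGrad X φ y‖ ^ 2 := by
          rw [integral_add (hfi.const_mul _) (hgi.integrableOn.const_mul _), integral_const_mul,
            integral_const_mul]
      _ ≤ _ := by gcongr
  -- After Young's inequality for the mixed term, everything on the right is controlled by `‖φ -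
  -- a‖_2` and `‖Xφ‖_2`, and the first was already bounded by the second. So the gradient alone
  -- controls `a`.
  have h9 : a ^ 2 ≤ B * G := by
    calc a ^ 2 ≤ C * ((∫ y in Ω, (φ y - a) ^ 2) + ∫ y in Ω, |φ y - a| * ‖xGrad X φ y‖) :=
          HC φ hφ hφs hφΩ a
      _ ≤ C * ((S * n * w) ^ 2 + (1 / 2 * (S * n * w) ^ 2 + 1 / 2 * G)) := by
          gcongr
          exact h7.trans (by gcongr)
      _ = B * G := by
          rw [hB, ← hn2]
          ring
  have h10 : |a| ≤ Real.sqrt B * n := by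
    rw [hn, ← Real.sqrt_mul hB0]
    exact Real.abs_le_sqrt h9
  calc eLpNorm φ (ENNReal.ofReal p) (volume.restrict Ω)
      = eLpNorm ((fun x => φ x - a) + fun _ => a) (ENNReal.ofReal p) (volume.restrict Ω) := by
        congr 1
        ext x
        simp
    _ ≤ eLpNorm (fun x => φ x - a) (ENNReal.ofReal p) (volume.restrict Ω) +
        eLpNorm (fun _ : E N => a) (ENNReal.ofReal p) (volume.restrict Ω) :=
        eLpNorm_add_le hm aestronglyMeasurable_const (by
          rw [ENNReal.one_le_ofReal]
          linarith)
    _ ≤ ENNReal.ofReal (S * n) + ENNReal.ofReal (Real.sqrt B * n * V ^ (1 / p)) := by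
        refine add_le_add ha ?_
        rw [eLpNorm_const' _ (by simpa using hp0) ENNReal.ofReal_ne_top,
          ENNReal.toReal_ofReal hp0.le, Measure.restrict_apply_univ, ← hVl,
          ENNReal.ofReal_rpow_of_nonneg hV0 (by positivity),
          ENNReal.ofReal_mul (p := Real.sqrt B * n) (by positivity), ← ofReal_norm]
        gcongr
        exact h10
    _ = ENNReal.ofReal (S * n + Real.sqrt B * n * V ^ (1 / p)) :=
        (ENNReal.ofReal_add (by positivity) (by positivity)).symm
    _ ≤ ENNReal.ofReal ((S + Real.sqrt B * V ^ (1 / p) + 1) * n) := by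
        refine ENNReal.ofReal_le_ofReal ?_
        nlinarith
    _ = _ := ENNReal.ofReal_mul (by positivity)

end Sobolev

/-! ### Convergence in `L^q`. -/

section Convergence

variable {ι F : Type*} [MeasurableSpace ι] {μ : Measure ι} [NormedAddCommGroup F]

theorem tendsto_eLpNorm_zero_of_dominated {q : ℝ≥0∞} (hq0 : q ≠ 0) (hq : q ≠ ⊤) {f : ℕ → ι → F}
    (hf : ∀ k, AEStronglyMeasurable (f k) μ) {g : ι → ℝ} (hg : MemLp g q μ)
    (hfg : ∀ k, ∀ᵐ x ∂μ, ‖f k x‖ ≤ g x) (hlim : ∀ᵐ x ∂μ, Tendsto (fun k => f k x) atTop (𝓝 0)) :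
    Tendsto (fun k => eLpNorm (f k) q μ) atTop (𝓝 0) := by
  have hq' : 0 < q.toReal := ENNReal.toReal_pos hq0 hq
  have h1 : Tendsto (fun k => ∫⁻ x, ‖f k x‖ₑ ^ q.toReal ∂μ) atTop (𝓝 (∫⁻ _, 0 ∂μ)) := by
    refine tendsto_lintegral_of_dominated_convergence' (fun x => ‖g x‖ₑ ^ q.toReal)
      (fun k => (hf k).enorm.pow_const _) (fun k => ?_) ?_ ?_
    · filter_upwards [hfg k] with x hx
      gcongr
      rw [enorm_le_iff_norm_le]
      exact hx.trans (le_abs_self _)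
    · exact (lintegral_rpow_enorm_lt_top_of_eLpNorm_lt_top hq0 hq hg.2).ne
    · filter_upwards [hlim] with x hx
      have h2 := (hx.enorm).ennrpow_const q.toReal
      simpa [ENNReal.zero_rpow_of_pos hq'] using h2
  have h3 := h1.ennrpow_const (1 / q.toReal)
  simp only [lintegral_zero, ENNReal.zero_rpow_of_pos (one_div_pos.2 hq')] at h3
  exact h3.congr fun k => (eLpNorm_eq_lintegral_rpow_enorm_toReal hq0 hq).symm

theorem tendsto_eLpNorm_sub_trans {q : ℝ≥0∞} (hq : 1 ≤ q) {f g : ℕ → ι → F} {h : ι → F}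
    (hf : ∀ k, AEStronglyMeasurable (f k) μ) (hg : ∀ k, AEStronglyMeasurable (g k) μ)
    (hh : AEStronglyMeasurable h μ)
    (hfg : Tendsto (fun k => eLpNorm (fun x => f k x - g k x) q μ) atTop (𝓝 0))
    (hgh : Tendsto (fun k => eLpNorm (fun x => g k x - h x) q μ) atTop (𝓝 0)) :
    Tendsto (fun k => eLpNorm (fun x => f k x - h x) q μ) atTop (𝓝 0) := by
  have h1 := hfg.add hgh
  rw [add_zero] at h1
  refine tendsto_of_tendsto_of_tendsto_of_le_of_le tendsto_const_nhds h1 (fun _ => zero_le)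
    fun k => ?_
  have h2 := eLpNorm_add_le ((hf k).sub (hg k)) ((hg k).sub hh) hq
  refine le_of_eq_of_le ?_ h2
  congr 1
  ext x
  simp

theorem tendsto_eLpNorm_mono_exponent [IsFiniteMeasure μ] {r q : ℝ≥0∞} (hr : r ≠ 0) (hrq : r ≤ q)
    {f : ℕ → ι → F} (hf : ∀ k, AEStronglyMeasurable (f k) μ)
    (h : Tendsto (fun k => eLpNorm (f k) q μ) atTop (𝓝 0)) :
    Tendsto (fun k => eLpNorm (f k) r μ) atTop (𝓝 0) := by
  rcases eq_or_ne r ⊤ with rfl | hr'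
  · rwa [← top_le_iff.1 hrq]
  have he : 0 ≤ 1 / r.toReal - 1 / q.toReal := by
    rcases eq_or_ne q ∞ with rfl | hq'
    · simp
    · have := one_div_le_one_div_of_le (ENNReal.toReal_pos hr hr') (ENNReal.toReal_mono hq' hrq)
      linarith
  have h1 := ENNReal.Tendsto.mul_const (b := μ univ ^ (1 / r.toReal - 1 / q.toReal)) h
    (Or.inr (ENNReal.rpow_ne_top_of_nonneg he (measure_ne_top _ _)))
  rw [zero_mul] at h1
  exact tendsto_of_tendsto_of_tendsto_of_le_of_le tendsto_const_nhds h1 (fun _ => zero_le)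
    fun k => eLpNorm_le_eLpNorm_mul_rpow_measure_univ hrq (hf k)

theorem exists_seq_tendsto_ae_of_tendsto_eLpNorm {q : ℝ≥0∞} (hq0 : q ≠ 0) {f : ℕ → ι → F}
    {g : ι → F} (hf : ∀ k, AEStronglyMeasurable (f k) μ) (hg : AEStronglyMeasurable g μ)
    (h : Tendsto (fun k => eLpNorm (fun x => f k x - g x) q μ) atTop (𝓝 0)) :
    ∃ κ : ℕ → ℕ, StrictMono κ ∧ ∀ᵐ x ∂μ, Tendsto (fun k => f (κ k) x) atTop (𝓝 (g x)) :=
  (tendstoInMeasure_of_tendsto_eLpNorm hq0 hf hg h).exists_seq_tendsto_ae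

end Convergence

/-! ### Calculus of the `X`-gradient and of `W₀^{1,q}(Ω,X)`. -/

section Gradient

variable {X : Fin m → E N → E N} {φ ψ : E N → ℝ} {x : E N}

theorem xGrad_add (hφ : DifferentiableAt ℝ φ x) (hψ : DifferentiableAt ℝ ψ x) :
    xGrad X (fun y => φ y + ψ y) x = xGrad X φ x + xGrad X ψ x := by
  ext j
  have : fderiv ℝ (fun y => φ y + ψ y) x = fderiv ℝ φ x + fderiv ℝ ψ x := fderiv_add hφ hψ
  simp [xGrad, this]

theorem xGrad_const_mul (c : ℝ) (hφ : DifferentiableAt ℝ φ x) :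
    xGrad X (fun y => c * φ y) x = c • xGrad X φ x := by
  ext j
  simp [xGrad, fderiv_const_mul hφ c]

theorem xGrad_comp {Φ : ℝ → ℝ} (hΦ : DifferentiableAt ℝ Φ (φ x)) (hφ : DifferentiableAt ℝ φ x) :
    xGrad X (fun y => Φ (φ y)) x = deriv Φ (φ x) • xGrad X φ x := by
  ext j
  have h : fderiv ℝ (fun y => Φ (φ y)) x = deriv Φ (φ x) • fderiv ℝ φ x :=
    (hΦ.hasDerivAt.comp_hasFDerivAt x hφ.hasFDerivAt).fderiv
  simp [xGrad, h]

end Gradient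

section Sobolev

variable {X : Fin m → E N → E N} {Ω : Set (E N)} {q : ℝ≥0∞} {u v : E N → ℝ} {G H : E N → E m}

/-- Test functions belong to `W₀^{1,q}(Ω,X)`, with their classical gradient. -/
theorem isW0_of_contDiff (hX : ∀ j, LocallyLipschitz (X j)) {φ : E N → ℝ} (hφ : ContDiff ℝ ∞ φ)
    (hφs : HasCompactSupport φ) (hφΩ : tsupport φ ⊆ Ω) : IsW0 X Ω q φ (xGrad X φ) := by
  refine ⟨?_, ?_, fun _ => φ, fun _ => ⟨hφ, hφs, hφΩ⟩, by simp, by simp⟩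
  · exact hφ.continuous.memLp_of_hasCompactSupport hφs
  · exact (continuous_xGrad hX (hφ.of_le (by norm_cast))).memLp_of_hasCompactSupport
      (hasCompactSupport_xGrad hφs)

theorem IsW0.congr (h : IsW0 X Ω q u G) (hu : u =ᵐ[volume.restrict Ω] v)
    (hG : G =ᵐ[volume.restrict Ω] H) : IsW0 X Ω q v H := by
  obtain ⟨h1, h2, φ, hφ, h3, h4⟩ := h
  refine ⟨h1.ae_eq hu, h2.ae_eq hG, φ, hφ, h3.congr fun k => eLpNorm_congr_ae ?_,
    h4.congr fun k => eLpNorm_congr_ae ?_⟩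
  · filter_upwards [hu] with x hx
    rw [hx]
  · filter_upwards [hG] with x hx
    rw [hx]

theorem aestronglyMeasurable_xGrad (hX : ∀ j, LocallyLipschitz (X j)) {φ : E N → ℝ}
    (hφ : ContDiff ℝ ∞ φ) (μ : Measure (E N)) : AEStronglyMeasurable (xGrad X φ) μ :=
  (continuous_xGrad hX (hφ.of_le (by norm_cast))).aestronglyMeasurable

theorem IsW0.mono_exponent (hX : ∀ j, LocallyLipschitz (X j)) (hΩ : volume Ω ≠ ⊤) {r : ℝ≥0∞}
    (hr : r ≠ 0) (hrq : r ≤ q) (h : IsW0 X Ω q u G) : IsW0 X Ω r u G := by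
  have : IsFiniteMeasure (volume.restrict Ω) := isFiniteMeasure_restrict.2 hΩ
  obtain ⟨h1, h2, φ, hφ, h3, h4⟩ := h
  refine ⟨h1.mono_exponent hrq, h2.mono_exponent hrq, φ, hφ,
    tendsto_eLpNorm_mono_exponent hr hrq (fun k => ?_) h3,
    tendsto_eLpNorm_mono_exponent hr hrq (fun k => ?_) h4⟩
  · exact (hφ k).1.continuous.aestronglyMeasurable.sub h1.1
  · exact (aestronglyMeasurable_xGrad hX (hφ k).1 _).sub h2.1

/-- Diagonal argument: each `un n` is replaced by a test function within `1/(n+1)` of it, gradient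
included. This closedness serves both Lax–Milgram and the final limit. -/
theorem IsW0.of_tendsto (hX : ∀ j, LocallyLipschitz (X j)) (hq : 1 ≤ q) {un : ℕ → E N → ℝ}
    {Gn : ℕ → E N → E m} (h : ∀ n, IsW0 X Ω q (un n) (Gn n)) (hu : MemLp u q (volume.restrict Ω))
    (hG : MemLp G q (volume.restrict Ω))
    (hun : Tendsto (fun n => eLpNorm (fun x => un n x - u x) q (volume.restrict Ω)) atTop (𝓝 0))
    (hGn : Tendsto (fun n => eLpNorm (fun x => Gn n x - G x) q (volume.restrict Ω)) atTop (𝓝 0)) :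
    IsW0 X Ω q u G := by
  have key : ∀ n : ℕ, ∃ φ : E N → ℝ,
      (ContDiff ℝ ∞ φ ∧ HasCompactSupport φ ∧ tsupport φ ⊆ Ω) ∧
      eLpNorm (fun x => φ x - un n x) q (volume.restrict Ω) ≤ ((n : ℝ≥0∞) + 1)⁻¹ ∧
      eLpNorm (fun x => xGrad X φ x - Gn n x) q (volume.restrict Ω) ≤ ((n : ℝ≥0∞) + 1)⁻¹ := by
    intro n
    obtain ⟨-, -, φ, hφ, h3, h4⟩ := h n
    have hpos : (0 : ℝ≥0∞) < ((n : ℝ≥0∞) + 1)⁻¹ :=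
      ENNReal.inv_pos.2 (ENNReal.add_ne_top.2 ⟨ENNReal.natCast_ne_top n, ENNReal.one_ne_top⟩)
    obtain ⟨k, hk3, hk4⟩ :=
      ((h3.eventually_le_const hpos).and (h4.eventually_le_const hpos)).exists
    exact ⟨φ k, hφ k, hk3, hk4⟩
  choose φ hφ h3 h4 using key
  have hlim : Tendsto (fun n : ℕ => ((n : ℝ≥0∞) + 1)⁻¹) atTop (𝓝 0) := by
    have := (tendsto_add_atTop_iff_nat 1).2 ENNReal.tendsto_inv_nat_nhds_zero
    simpa using this
  refine ⟨hu, hG, φ, hφ, ?_, ?_⟩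
  · exact tendsto_eLpNorm_sub_trans hq (fun n => (hφ n).1.continuous.aestronglyMeasurable)
      (fun n => (h n).1.1) hu.1
      (tendsto_of_tendsto_of_tendsto_of_le_of_le tendsto_const_nhds hlim (fun _ => zero_le) h3) hun
  · exact tendsto_eLpNorm_sub_trans hq (fun n => aestronglyMeasurable_xGrad hX (hφ n).1 _)
      (fun n => (h n).2.1.1) hG.1
      (tendsto_of_tendsto_of_tendsto_of_le_of_le tendsto_const_nhds hlim (fun _ => zero_le) h4) hGn

theorem IsW0.const_mul (c : ℝ) (h : IsW0 X Ω q u G) :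
    IsW0 X Ω q (fun x => c * u x) (fun x => c • G x) := by
  obtain ⟨h1, h2, φ, hφ, h3, h4⟩ := h
  refine ⟨h1.const_mul c, h2.const_smul c, fun k x => c * φ k x, fun k =>
    ⟨contDiff_const.mul (hφ k).1, (hφ k).2.1.mul_left,
      (tsupport_mul_subset_right (f := fun _ => c)).trans (hφ k).2.2⟩, ?_, ?_⟩
  · have h5 := ENNReal.Tendsto.const_mul (a := ‖c‖ₑ) h3 (Or.inr enorm_ne_top)
    rw [mul_zero] at h5
    refine h5.congr fun k => ?_
    rw [← eLpNorm_const_smul]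
    congr 1
    ext x
    simp [mul_sub]
  · have h5 := ENNReal.Tendsto.const_mul (a := ‖c‖ₑ) h4 (Or.inr enorm_ne_top)
    rw [mul_zero] at h5
    refine h5.congr fun k => ?_
    rw [← eLpNorm_const_smul]
    congr 1
    ext x : 1
    rw [xGrad_const_mul c ((hφ k).1.differentiable (by simp) x)]
    simp [smul_sub]

theorem IsW0.add (hX : ∀ j, LocallyLipschitz (X j)) (hq : 1 ≤ q) (h : IsW0 X Ω q u G)
    (h' : IsW0 X Ω q v H) : IsW0 X Ω q (fun x => u x + v x) (fun x => G x + H x) := by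
  obtain ⟨h1, h2, φ, hφ, h3, h4⟩ := h
  obtain ⟨h1', h2', ψ, hψ, h3', h4'⟩ := h'
  refine ⟨h1.add h1', h2.add h2', fun k x => φ k x + ψ k x, fun k =>
    ⟨(hφ k).1.add (hψ k).1, (hφ k).2.1.add (hψ k).2.1,
      (tsupport_add (φ k) (ψ k)).trans (union_subset (hφ k).2.2 (hψ k).2.2)⟩, ?_, ?_⟩
  · have h5 := h3.add h3'
    rw [add_zero] at h5
    refine tendsto_of_tendsto_of_tendsto_of_le_of_le tendsto_const_nhds h5 (fun _ => zero_le)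
      fun k => ?_
    refine le_of_eq_of_le ?_ (eLpNorm_add_le
      ((hφ k).1.continuous.aestronglyMeasurable.sub h1.1)
      ((hψ k).1.continuous.aestronglyMeasurable.sub h1'.1) hq)
    congr 1
    ext x
    simp
    ring
  · have h5 := h4.add h4'
    rw [add_zero] at h5
    refine tendsto_of_tendsto_of_tendsto_of_le_of_le tendsto_const_nhds h5 (fun _ => zero_le)
      fun k => ?_
    refine le_of_eq_of_le ?_ (eLpNorm_add_le
      ((aestronglyMeasurable_xGrad hX (hφ k).1 _).sub h2.1)
      ((aestronglyMeasurable_xGrad hX (hψ k).1 _).sub h2'.1) hq)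
    congr 1
    ext x : 1
    rw [xGrad_add ((hφ k).1.differentiable (by simp) x) ((hψ k).1.differentiable (by simp) x)]
    simp only [Pi.add_apply]
    abel

theorem IsW0.sub (hX : ∀ j, LocallyLipschitz (X j)) (hq : 1 ≤ q) (h : IsW0 X Ω q u G)
    (h' : IsW0 X Ω q v H) : IsW0 X Ω q (fun x => u x - v x) (fun x => G x - H x) := by
  simpa [sub_eq_add_neg] using h.add hX hq (h'.const_mul (-1))

/-- The chain rule in `W₀^{1,q}(Ω,X)`. -/
theorem IsW0.comp (hX : ∀ j, LocallyLipschitz (X j)) (hq : 1 ≤ q) (hq' : q ≠ ⊤) {Φ : ℝ → ℝ}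
    (hΦ : ContDiff ℝ ∞ Φ) (h0 : Φ 0 = 0) {K : ℝ} (hK : ∀ t, |deriv Φ t| ≤ K)
    (h : IsW0 X Ω q u G) :
    IsW0 X Ω q (fun x => Φ (u x)) (fun x => deriv Φ (u x) • G x) := by
  obtain ⟨h1, h2, φ, hφ, h3, h4⟩ := h
  have hq0 : q ≠ 0 := (zero_lt_one.trans_le hq).ne'
  have hΦd : Differentiable ℝ Φ := hΦ.differentiable (by simp)
  have hΦ' : Continuous (deriv Φ) := hΦ.continuous_deriv (by simp)
  have hK0 : 0 ≤ K := (abs_nonneg _).trans (hK 0)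
  have hlip : ∀ s t, |Φ s - Φ t| ≤ K * |s - t| := fun s t => by
    have := Convex.norm_image_sub_le_of_norm_deriv_le (f := Φ) (C := K) (s := univ)
      (fun x _ => hΦd x) (fun x _ => hK x) convex_univ (mem_univ t) (mem_univ s)
    simpa using this
  have hφm : ∀ k, AEStronglyMeasurable (φ k) (volume.restrict Ω) := fun k =>
    (hφ k).1.continuous.aestronglyMeasurable
  have hgm : ∀ k, AEStronglyMeasurable (xGrad X (φ k)) (volume.restrict Ω) := fun k =>
    aestronglyMeasurable_xGrad hX (hφ k).1 _
  -- The coefficient `Φ'(φ_k)` is merely bounded and continuous in `φ_k`, so `Φ'(φ_k) G → Φ'(u) G`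
  -- needs almost everywhere convergence and domination.
  obtain ⟨κ, hκ, hae⟩ := exists_seq_tendsto_ae_of_tendsto_eLpNorm hq0 hφm h1.1 h3
  have hGm : AEStronglyMeasurable (fun x => deriv Φ (u x) • G x) (volume.restrict Ω) :=
    (hΦ'.comp_aestronglyMeasurable h1.1).smul h2.1
  refine ⟨?_, ?_, fun k x => Φ (φ (κ k) x), fun k => ⟨hΦ.comp (hφ _).1, ?_, ?_⟩, ?_, ?_⟩
  · refine (h1.norm.const_mul K).mono' (hΦ.continuous.comp_aestronglyMeasurable h1.1)
      (Eventually.of_forall fun x => ?_)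
    have := hlip (u x) 0
    simpa [h0] using this
  · refine (h2.norm.const_mul K).mono' hGm (Eventually.of_forall fun x => ?_)
    rw [norm_smul]
    gcongr
    exact hK _
  · exact (hφ (κ k)).2.1.comp_left h0
  · exact (closure_mono (Function.support_comp_subset h0 _)).trans (hφ (κ k)).2.2
  · have h5 := ENNReal.Tendsto.const_mul (a := ENNReal.ofReal K) (h3.comp hκ.tendsto_atTop)
      (Or.inr ENNReal.ofReal_ne_top)
    rw [mul_zero] at h5
    refine tendsto_of_tendsto_of_tendsto_of_le_of_le tendsto_const_nhds h5 (fun _ => zero_le)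
      fun k => eLpNorm_le_mul_eLpNorm_of_ae_le_mul (Eventually.of_forall fun x => hlip _ _) q
  · have h5 := ENNReal.Tendsto.const_mul (a := ENNReal.ofReal K) (h4.comp hκ.tendsto_atTop)
      (Or.inr ENNReal.ofReal_ne_top)
    rw [mul_zero] at h5
    -- Splitting through `Φ'(φ_k) G` separates the convergence of the gradients, where `|Φ'| ≤ K`
    -- suffices, from that of the coefficients.
    refine tendsto_eLpNorm_sub_trans hq (g := fun k x => deriv Φ (φ (κ k) x) • G x)
      (fun k => aestronglyMeasurable_xGrad hX (hΦ.comp (hφ _).1) _)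
      (fun k => (hΦ'.comp_aestronglyMeasurable (hφm _)).smul h2.1) hGm ?_ ?_
    · refine tendsto_of_tendsto_of_tendsto_of_le_of_le tendsto_const_nhds h5 (fun _ => zero_le)
        fun k => eLpNorm_le_mul_eLpNorm_of_ae_le_mul (Eventually.of_forall fun x => ?_) q
      rw [xGrad_comp (hΦd _) ((hφ (κ k)).1.differentiable (by simp) x), ← smul_sub, norm_smul]
      exact mul_le_mul_of_nonneg_right (hK _) (norm_nonneg _)
    · refine tendsto_eLpNorm_zero_of_dominated hq0 hq'
        (fun k => ((hΦ'.comp_aestronglyMeasurable (hφm _)).smul h2.1).sub hGm)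
        (h2.norm.const_mul (2 * K)) (fun k => Eventually.of_forall fun x => ?_) ?_
      · rw [← sub_smul, norm_smul]
        gcongr
        refine (norm_sub_le _ _).trans ?_
        have := hK (φ (κ k) x)
        have := hK (u x)
        simp only [Real.norm_eq_abs]
        linarith
      · filter_upwards [hae] with x hx
        have := (((hΦ'.tendsto _).comp hx).smul_const (G x)).sub_const (deriv Φ (u x) • G x)
        simpa using this

/-- Fatou's lemma along an almost everywhere convergent subsequence; `u ∈ L^r` is a consequence when
the right side is finite, not an assumption. -/
theorem IsW0.eLpNorm_le {r : ℝ≥0∞} (hX : ∀ j, LocallyLipschitz (X j)) (hq : 1 ≤ q) {S : ℝ≥0∞}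
    (hS : S ≠ ⊤)
    (hSob : ∀ φ : E N → ℝ, ContDiff ℝ 1 φ → HasCompactSupport φ → tsupport φ ⊆ Ω →
      eLpNorm φ r (volume.restrict Ω) ≤ S * eLpNorm (xGrad X φ) q (volume.restrict Ω))
    (h : IsW0 X Ω q u G) :
    eLpNorm u r (volume.restrict Ω) ≤ S * eLpNorm G q (volume.restrict Ω) := by
  obtain ⟨h1, h2, φ, hφ, h3, h4⟩ := h
  have hq0 : q ≠ 0 := (zero_lt_one.trans_le hq).ne'
  have hφm : ∀ k, AEStronglyMeasurable (φ k) (volume.restrict Ω) := fun k =>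
    (hφ k).1.continuous.aestronglyMeasurable
  obtain ⟨κ, hκ, hae⟩ := exists_seq_tendsto_ae_of_tendsto_eLpNorm hq0 hφm h1.1 h3
  refine (Lp.eLpNorm_lim_le_liminf_eLpNorm (fun k => hφm (κ k)) u hae).trans ?_
  have h5 : Tendsto (fun k => S * (eLpNorm (fun x => xGrad X (φ (κ k)) x - G x) q
      (volume.restrict Ω) + eLpNorm G q (volume.restrict Ω))) atTop
      (𝓝 (S * (0 + eLpNorm G q (volume.restrict Ω)))) :=
    ENNReal.Tendsto.const_mul ((h4.comp hκ.tendsto_atTop).add_const _) (Or.inr hS)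
  rw [zero_add] at h5
  rw [← h5.liminf_eq]
  refine liminf_le_liminf (Eventually.of_forall fun k => ?_)
  refine (hSob _ ((hφ (κ k)).1.of_le (by norm_cast)) (hφ _).2.1 (hφ _).2.2).trans ?_
  gcongr
  refine le_of_eq_of_le ?_ (eLpNorm_add_le
    ((aestronglyMeasurable_xGrad hX (hφ (κ k)).1 _).sub h2.1) h2.1 hq)
  congr 1
  ext x : 1
  simp

end Sobolev

/-! ### The coefficient matrix. -/

section Coefficients

variable {Ω : Set (E N)} {α β : ℝ} {A : E N → Matrix (Fin m) (Fin m) ℝ} {G H : E N → E m}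

/-- A crude bound, used for integrability and continuity only; it never reaches the constant of the
final estimate. -/
theorem norm_toLp_mulVec_le {B : Matrix (Fin m) (Fin m) ℝ} {M : ℝ} (hB : ∀ i j, |B i j| ≤ M)
    (η : E m) : ‖(WithLp.toLp 2 (B *ᵥ η.ofLp) : E m)‖ ≤ m * (m * (M * ‖η‖)) := by
  rcases m.eq_zero_or_pos with rfl | hm
  · simp [EuclideanSpace.norm_eq]
  have hM : 0 ≤ M := (abs_nonneg _).trans (hB ⟨0, hm⟩ ⟨0, hm⟩)
  have hm1 : (1 : ℝ) ≤ m := by exact_mod_cast hm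
  have h1 : ∀ i, |(B *ᵥ η.ofLp) i| ≤ m * (M * ‖η‖) := fun i => by
    calc |(B *ᵥ η.ofLp) i| = |∑ j, B i j * η j| := rfl
      _ ≤ ∑ j, |B i j * η j| := Finset.abs_sum_le_sum_abs _ _
      _ ≤ ∑ _j : Fin m, M * ‖η‖ := by
          refine Finset.sum_le_sum fun j _ => ?_
          rw [abs_mul]
          exact mul_le_mul (hB i j) (PiLp.norm_apply_le η j) (abs_nonneg _) hM
      _ = m * (M * ‖η‖) := by simp
  have h2 : 0 ≤ M * ‖η‖ := by positivity
  refine abs_le_of_sq_le_sq' ?_ (by positivity) |>.2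
  rw [EuclideanSpace.norm_sq_eq]
  calc ∑ i, ‖(WithLp.toLp 2 (B *ᵥ η.ofLp) : E m) i‖ ^ 2
      ≤ ∑ _i : Fin m, (m * (M * ‖η‖)) ^ 2 :=
        Finset.sum_le_sum fun i _ => pow_le_pow_left₀ (norm_nonneg _) (h1 i) 2
    _ = m * (m * (M * ‖η‖)) ^ 2 := by simp
    _ ≤ (m : ℝ) ^ 2 * (m * (M * ‖η‖)) ^ 2 := by
        gcongr
        nlinarith
    _ = _ := by ring

theorem IsElliptic.aestronglyMeasurable_mulVec (hA : IsElliptic Ω α β A)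
    (hG : AEStronglyMeasurable G (volume.restrict Ω)) :
    AEStronglyMeasurable (fun x => (WithLp.toLp 2 (A x *ᵥ (G x).ofLp) : E m))
      (volume.restrict Ω) := by
  have h1 : AEMeasurable (fun x => A x *ᵥ (G x).ofLp) (volume.restrict Ω) := by
    refine aemeasurable_pi_lambda _ fun i => ?_
    have h2 : ∀ j, AEMeasurable (fun x => G x j) (volume.restrict Ω) := fun j =>
      ((EuclideanSpace.proj (𝕜 := ℝ) j).continuous.comp_aestronglyMeasurable hG).aemeasurable
    exact Finset.aemeasurable_fun_sum Finset.univ fun j _ => (hA.measurable i j).mul (h2 j)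
  exact (PiLp.continuous_toLp 2 _).comp_aestronglyMeasurable h1.aestronglyMeasurable

theorem IsElliptic.memLp_mulVec (hA : IsElliptic Ω α β A) {q : ℝ≥0∞}
    (hG : MemLp G q (volume.restrict Ω)) :
    MemLp (fun x => (WithLp.toLp 2 (A x *ᵥ (G x).ofLp) : E m)) q (volume.restrict Ω) := by
  obtain ⟨M, hM⟩ := hA.bounded
  refine (hG.norm.const_mul (m * (m * M))).mono' (hA.aestronglyMeasurable_mulVec hG.1) ?_
  filter_upwards [hM] with x hx
  refine (norm_toLp_mulVec_le hx (G x)).trans_eq ?_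
  ring

theorem inner_toLp_mulVec (B : Matrix (Fin m) (Fin m) ℝ) (η ξ : E m) :
    inner ℝ (WithLp.toLp 2 (B *ᵥ η.ofLp) : E m) ξ = (B *ᵥ η.ofLp) ⬝ᵥ ξ.ofLp := by
  simp [PiLp.inner_apply, dotProduct, mul_comm]

theorem IsElliptic.integrable_mulVec_dotProduct (hA : IsElliptic Ω α β A)
    (hG : MemLp G 2 (volume.restrict Ω)) (hH : MemLp H 2 (volume.restrict Ω)) :
    IntegrableOn (fun x => (A x *ᵥ (G x).ofLp) ⬝ᵥ (H x).ofLp) Ω := by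
  have h1 := hA.memLp_mulVec hG
  refine Integrable.congr (Integrable.mono' (h1.norm.integrable_mul hH.norm) (h1.1.inner hH.1)
    (Eventually.of_forall fun x => norm_inner_le_norm (𝕜 := ℝ) _ _))
    (Eventually.of_forall fun x => inner_toLp_mulVec _ _ _)

theorem IsElliptic.mul_integral_le (hA : IsElliptic Ω α β A)
    (hG : MemLp G 2 (volume.restrict Ω)) :
    α * ∫ x in Ω, ‖G x‖ ^ 2 ≤ ∫ x in Ω, (A x *ᵥ (G x).ofLp) ⬝ᵥ (G x).ofLp := by
  rw [← integral_const_mul]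
  refine integral_mono_ae (hG.integrable_norm_pow (by simp) |>.const_mul α)
    (hA.integrable_mulVec_dotProduct hG hG) ?_
  filter_upwards [hA.elliptic] with x hx
  refine le_of_eq_of_le ?_ (hx (G x).ofLp).1
  rw [EuclideanSpace.norm_sq_eq]
  simp [dotProduct, sq]

end Coefficients

/-! ### Existence of weak solutions. -/

section LaxMilgram

variable {X : Fin m → E N → E N} {Ω : Set (E N)}

/-- The graph of `u ↦ Xu` on `W₀^{1,2}(Ω,X)`, as a subspace of `L²(Ω) × L²(Ω)^m`. -/
def w0Graph (hX : ∀ j, LocallyLipschitz (X j)) (Ω : Set (E N)) :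
    Submodule ℝ (WithLp 2 (Lp ℝ 2 (volume.restrict Ω) × Lp (E m) 2 (volume.restrict Ω))) where
  carrier := {z | IsW0 X Ω 2 z.fst z.snd}
  add_mem' {z w} hz hw :=
    (IsW0.add hX (by norm_num) hz hw).congr (Lp.coeFn_add z.fst w.fst).symm
      (Lp.coeFn_add z.snd w.snd).symm
  zero_mem' := by
    refine IsW0.congr (isW0_of_contDiff hX (φ := fun _ => 0) contDiff_const
      HasCompactSupport.zero (by simp [tsupport])) (Lp.coeFn_zero _ _ _).symm ?_
    filter_upwards [Lp.coeFn_zero (E m) 2 (volume.restrict Ω)] with x hx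
    refine Eq.trans ?_ hx.symm
    ext j
    simp [xGrad]
  smul_mem' c z hz :=
    (IsW0.const_mul c hz).congr (Lp.coeFn_smul c z.fst).symm (Lp.coeFn_smul c z.snd).symm

theorem isClosed_w0Graph (hX : ∀ j, LocallyLipschitz (X j)) (Ω : Set (E N)) :
    IsClosed (w0Graph hX Ω :
    Set (WithLp 2 (Lp ℝ 2 (volume.restrict Ω) × Lp (E m) 2 (volume.restrict Ω)))) := by
  refine IsSeqClosed.isClosed fun z w hz hzw => ?_
  have h1 : Tendsto (fun n => (z n).fst) atTop (𝓝 w.fst) :=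
    ((WithLp.prod_continuous_ofLp 2 _ _).fst.tendsto w).comp hzw
  have h2 : Tendsto (fun n => (z n).snd) atTop (𝓝 w.snd) :=
    ((WithLp.prod_continuous_ofLp 2 _ _).snd.tendsto w).comp hzw
  exact IsW0.of_tendsto hX (by norm_num) hz (Lp.memLp _) (Lp.memLp _)
    ((Lp.tendsto_Lp_iff_tendsto_eLpNorm' _ _).1 h1) ((Lp.tendsto_Lp_iff_tendsto_eLpNorm' _ _).1 h2)

/-- Lax–Milgram on a complete space of pairs. The form sees only the second component, and the bound
of the first by the second makes it coercive for the full norm, with constant `α / (C² + 1)`. -/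
theorem exists_mem_forall_inner_eq {F₁ F₂ : Type*} [NormedAddCommGroup F₁] [InnerProductSpace ℝ F₁]
    [NormedAddCommGroup F₂] [InnerProductSpace ℝ F₂] (V : Submodule ℝ (WithLp 2 (F₁ × F₂)))
    [CompleteSpace V] (T : F₂ →L[ℝ] F₂) {α C : ℝ} (hα : 0 < α)
    (hT : ∀ z ∈ V, α * ‖z.snd‖ ^ 2 ≤ inner ℝ (T z.snd) z.snd)
    (hC : ∀ z ∈ V, ‖z.fst‖ ≤ C * ‖z.snd‖) (g : F₁) :
    ∃ z ∈ V, ∀ w ∈ V, inner ℝ (T z.snd) w.snd = inner ℝ g w.fst := by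
  let P₁ : V →L[ℝ] F₁ := (WithLp.fstL 2 ℝ F₁ F₂).comp V.subtypeL
  let P₂ : V →L[ℝ] F₂ := (WithLp.sndL 2 ℝ F₁ F₂).comp V.subtypeL
  let I : F₂ →L[ℝ] F₂ →L[ℝ] ℝ := innerSL ℝ
  let B : V →L[ℝ] V →L[ℝ] ℝ := I.bilinearComp (T.comp P₂) P₂
  have hcoer : IsCoercive B := by
    refine ⟨α / (C ^ 2 + 1), by positivity, fun z => ?_⟩
    refine le_trans ?_ (hT z.1 z.2)
    have h6 := WithLp.prod_norm_sq_eq_of_L2 z.1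
    have h7 := pow_le_pow_left₀ (norm_nonneg _) (hC z.1 z.2) 2
    rw [mul_assoc, div_mul_eq_mul_div, div_le_iff₀ (by positivity), mul_assoc]
    refine mul_le_mul_of_nonneg_left ?_ hα.le
    rw [← sq, Submodule.coe_norm]
    linarith
  let ℓ : V →L[ℝ] ℝ := (innerSL ℝ g).comp P₁
  let z := hcoer.continuousLinearEquivOfBilin.symm ((InnerProductSpace.toDual ℝ V).symm ℓ)
  refine ⟨z.1, z.2, fun w hw => ?_⟩
  have h1 : B z ⟨w, hw⟩ = ℓ ⟨w, hw⟩ := by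
    rw [← hcoer.continuousLinearEquivOfBilin_apply, ContinuousLinearEquiv.apply_symm_apply,
      InnerProductSpace.toDual_symm_apply]
  exact h1

/-- The Lax-Milgram theorem in `W₀^{1,2}(Ω,X)`. -/
theorem exists_isWeakSol (hX : ∀ j, LocallyLipschitz (X j)) {C : ℝ}
    (hC : ∀ (u : E N → ℝ) (G : E N → E m), IsW0 X Ω 2 u G →
      eLpNorm u 2 (volume.restrict Ω) ≤ ENNReal.ofReal C * eLpNorm G 2 (volume.restrict Ω))
    {α β : ℝ} (hα : 0 < α) {A : E N → Matrix (Fin m) (Fin m) ℝ} (hA : IsElliptic Ω α β A)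
    {g : E N → ℝ} (hg : MemLp g 2 (volume.restrict Ω)) : ∃ u, IsWeakSol X Ω A g u := by
  set μ := volume.restrict Ω with hμ
  have : CompleteSpace (w0Graph hX Ω) := (isClosed_w0Graph hX Ω).completeSpace_coe
  let T₀ : Lp (E m) 2 μ →ₗ[ℝ] Lp (E m) 2 μ :=
    { toFun := fun G => (hA.memLp_mulVec (Lp.memLp G)).toLp _
      map_add' := fun G H => by
        rw [← MemLp.toLp_add]
        refine MemLp.toLp_congr _ _ ?_
        filter_upwards [Lp.coeFn_add G H] with x hx
        rw [hx]
        simp [Matrix.mulVec_add]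
      map_smul' := fun c G => by
        rw [RingHom.id_apply, ← MemLp.toLp_const_smul]
        refine MemLp.toLp_congr _ _ ?_
        filter_upwards [Lp.coeFn_smul c G] with x hx
        rw [hx]
        simp [Matrix.mulVec_smul] }
  obtain ⟨M, hM⟩ := hA.bounded
  let T : Lp (E m) 2 μ →L[ℝ] Lp (E m) 2 μ := T₀.mkContinuous (m * (m * M)) fun G => by
    refine Lp.norm_le_mul_norm_of_ae_le_mul ?_
    filter_upwards [hM, (hA.memLp_mulVec (Lp.memLp G)).coeFn_toLp] with x hx hx'
    rw [show T₀ G = (hA.memLp_mulVec (Lp.memLp G)).toLp _ from rfl, hx']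
    refine (norm_toLp_mulVec_le hx (G x)).trans_eq ?_
    ring
  have hT : ∀ G H : Lp (E m) 2 μ,
      inner ℝ (T G) H = ∫ x in Ω, (A x *ᵥ (G x).ofLp) ⬝ᵥ (H x).ofLp := fun G H => by
    rw [L2.inner_def]
    refine integral_congr_ae ?_
    filter_upwards [(hA.memLp_mulVec (Lp.memLp G)).coeFn_toLp] with x hx
    rw [show T G = (hA.memLp_mulVec (Lp.memLp G)).toLp _ from rfl, hx, inner_toLp_mulVec]
  have hco : ∀ z ∈ w0Graph hX Ω, α * ‖z.snd‖ ^ 2 ≤ inner ℝ (T z.snd) z.snd := fun z _ => by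
    rw [hT]
    refine le_of_eq_of_le ?_ (hA.mul_integral_le (Lp.memLp _))
    rw [← real_inner_self_eq_norm_sq, L2.inner_def]
    simp only [real_inner_self_eq_norm_sq]
  have hle : ∀ z ∈ w0Graph hX Ω, ‖z.fst‖ ≤ |C| * ‖z.snd‖ := fun z hz => by
    have h3 := ENNReal.toReal_mono
      (ENNReal.mul_ne_top ENNReal.ofReal_ne_top (Lp.eLpNorm_ne_top _)) (hC _ _ hz)
    rw [ENNReal.toReal_mul, ← Lp.norm_def, ← Lp.norm_def] at h3
    refine h3.trans (mul_le_mul_of_nonneg_right ?_ (norm_nonneg _))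
    rw [ENNReal.toReal_ofReal']
    exact max_le (le_abs_self C) (abs_nonneg C)
  obtain ⟨z, hz, h⟩ := exists_mem_forall_inner_eq (w0Graph hX Ω) T hα hco hle (hg.toLp g)
  refine ⟨z.fst, z.snd, hz, fun v H hv => ?_⟩
  have h1 := h (WithLp.toLp 2 (hv.1.toLp v, hv.2.1.toLp H))
    (hv.congr hv.1.coeFn_toLp.symm hv.2.1.coeFn_toLp.symm)
  rw [hT] at h1
  refine Eq.trans ?_ (h1.trans ?_)
  · refine integral_congr_ae ?_
    filter_upwards [hv.2.1.coeFn_toLp] with x hx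
    exact congrArg (fun η : E m => (A x *ᵥ (z.snd x).ofLp) ⬝ᵥ η.ofLp) hx.symm
  · rw [L2.inner_def]
    refine integral_congr_ae ?_
    filter_upwards [hv.1.coeFn_toLp, hg.coeFn_toLp] with x hx hx'
    simp [hx, hx', mul_comm]

end LaxMilgram

/-! ### Smooth test nonlinearities and the absorption step. -/

section Nonlinearities

variable {γ : ℝ}

theorem contDiff_one_add_sq_rpow (r : ℝ) : ContDiff ℝ ∞ fun t : ℝ => (1 + t ^ 2) ^ r :=
  (contDiff_const.add (contDiff_id.pow 2)).rpow_const_of_ne fun t => by positivity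

theorem hasDerivAt_one_add_sq_rpow (r t : ℝ) :
    HasDerivAt (fun t : ℝ => (1 + t ^ 2) ^ r) (2 * r * t * (1 + t ^ 2) ^ (r - 1)) t := by
  have h := ((hasDerivAt_pow 2 t).const_add 1).rpow_const (p := r)
    (Or.inl (by positivity))
  refine h.congr_deriv ?_
  push_cast
  ring

/-- In this form the last factor visibly lies between `2γ - 1` and `1` for `γ ≤ 1`, since `t²/(1+t²)
∈ [0,1]`. Both derivative bounds below are read off from it. -/
theorem deriv_mul_one_add_sq_rpow (γ t : ℝ) :
    deriv (fun t : ℝ => t * (1 + t ^ 2) ^ (γ - 1)) t =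
      (1 + t ^ 2) ^ (γ - 1) * (1 - 2 * (1 - γ) * (t ^ 2 / (1 + t ^ 2))) := by
  have h := ((hasDerivAt_id t).mul (hasDerivAt_one_add_sq_rpow (γ - 1) t)).deriv
  refine h.trans ?_
  have h0 : (1 + t ^ 2 : ℝ) ≠ 0 := by positivity
  rw [Real.rpow_sub_one h0 (γ - 1)]
  simp only [id]
  field_simp
  ring

theorem sq_div_one_add_sq_mem (t : ℝ) : 0 ≤ t ^ 2 / (1 + t ^ 2) ∧ t ^ 2 / (1 + t ^ 2) ≤ 1 :=
  ⟨by positivity, div_le_one_of_le₀ (by linarith) (by positivity)⟩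

theorem one_add_sq_rpow_le_one {r : ℝ} (hr : r ≤ 0) (t : ℝ) : (1 + t ^ 2) ^ r ≤ 1 :=
  Real.rpow_le_one_of_one_le_of_nonpos (by nlinarith [sq_nonneg t]) hr

theorem le_deriv_mul_one_add_sq_rpow (hγ : γ ≤ 1) (t : ℝ) :
    (2 * γ - 1) * (1 + t ^ 2) ^ (γ - 1) ≤ deriv (fun t : ℝ => t * (1 + t ^ 2) ^ (γ - 1)) t := by
  rw [deriv_mul_one_add_sq_rpow, mul_comm]
  refine mul_le_mul_of_nonneg_left ?_ (by positivity)
  nlinarith [(sq_div_one_add_sq_mem t).2]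

theorem abs_deriv_mul_one_add_sq_rpow_le (hγ' : 1 / 2 ≤ γ) (hγ : γ ≤ 1) (t : ℝ) :
    |deriv (fun t : ℝ => t * (1 + t ^ 2) ^ (γ - 1)) t| ≤ 1 := by
  have h1 := le_deriv_mul_one_add_sq_rpow hγ t
  have h2 : 0 ≤ (2 * γ - 1) * (1 + t ^ 2) ^ (γ - 1) :=
    mul_nonneg (by linarith) (by positivity)
  rw [abs_of_nonneg (h2.trans h1), deriv_mul_one_add_sq_rpow]
  refine mul_le_one₀ (one_add_sq_rpow_le_one (by linarith) t) ?_ ?_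
  · nlinarith [(sq_div_one_add_sq_mem t).2]
  · nlinarith [(sq_div_one_add_sq_mem t).1]

theorem abs_le_one_add_sq_rpow_half (t : ℝ) : |t| ≤ (1 + t ^ 2) ^ (1 / 2 : ℝ) := by
  rw [← Real.sqrt_eq_rpow]
  exact Real.abs_le_sqrt (by linarith)

theorem abs_mul_one_add_sq_rpow_le (γ t : ℝ) :
    |t * (1 + t ^ 2) ^ (γ - 1)| ≤ (1 + t ^ 2) ^ (γ - 1 / 2) := by
  have h0 : (0 : ℝ) < 1 + t ^ 2 := by positivity
  rw [abs_mul, abs_of_pos (Real.rpow_pos_of_pos h0 _)]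
  calc |t| * (1 + t ^ 2) ^ (γ - 1) ≤ (1 + t ^ 2) ^ (1 / 2 : ℝ) * (1 + t ^ 2) ^ (γ - 1) := by
        gcongr
        exact abs_le_one_add_sq_rpow_half t
    _ = _ := by
        rw [← Real.rpow_add h0]
        congr 1
        ring

theorem abs_deriv_one_add_sq_rpow_sub_one_le (hγ0 : 0 ≤ γ) (hγ : γ ≤ 1) (t : ℝ) :
    |deriv (fun t : ℝ => (1 + t ^ 2) ^ (γ / 2) - 1) t| ≤ (1 + t ^ 2) ^ ((γ - 1) / 2) := by
  have h0 : (0 : ℝ) < 1 + t ^ 2 := by positivity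
  rw [((hasDerivAt_one_add_sq_rpow (γ / 2) t).sub_const 1).deriv, abs_mul,
    abs_of_pos (Real.rpow_pos_of_pos h0 _), mul_div_cancel₀ γ two_ne_zero, abs_mul,
    abs_of_nonneg hγ0]
  calc γ * |t| * (1 + t ^ 2) ^ (γ / 2 - 1)
      ≤ 1 * (1 + t ^ 2) ^ (1 / 2 : ℝ) * (1 + t ^ 2) ^ (γ / 2 - 1) := by
        gcongr
        exact abs_le_one_add_sq_rpow_half t
    _ = _ := by
        rw [one_mul, ← Real.rpow_add h0]
        congr 1
        ring

/-- For `x ≥ 1` the constant is absorbed into `x^θ`, so `x^{1-θ}` is bounded. This closes the loop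
between the two energy inequalities. -/
theorem exists_le_of_le_add_mul_rpow (c c' : ℝ) {θ : ℝ} (hc : 0 ≤ c) (hc' : 0 ≤ c') (hθ0 : 0 ≤ θ)
    (hθ : θ < 1) : ∃ K : ℝ, 0 < K ∧ ∀ x : ℝ, x ≤ c + c' * x ^ θ → x ≤ K := by
  refine ⟨(c + c' + 1) ^ (1 / (1 - θ)), by positivity, fun x hx => ?_⟩
  have h1θ : 0 < 1 - θ := by linarith
  rcases le_total x 1 with h | h
  · exact h.trans (Real.one_le_rpow (by linarith) (by positivity))
  have h0 : 0 < x := by linarith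
  have h1 : 1 ≤ x ^ θ := Real.one_le_rpow h hθ0
  have h2 : x ^ (1 - θ) ≤ c + c' + 1 := by
    rw [Real.rpow_sub h0, Real.rpow_one, div_le_iff₀ (by positivity)]
    nlinarith
  calc x = (x ^ (1 - θ)) ^ (1 / (1 - θ)) := by
        rw [← Real.rpow_mul h0.le, mul_one_div_cancel h1θ.ne', Real.rpow_one]
    _ ≤ _ := by gcongr

end Nonlinearities

/-! ### The three inequalities behind the a priori estimate. -/

section Estimate

variable {X : Fin m → E N → E N} {Ω : Set (E N)} {α β γ a s p p' q : ℝ}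
  {A : E N → Matrix (Fin m) (Fin m) ℝ} {g u : E N → ℝ} {G : E N → E m}

theorem integrable_norm_sq_mul_rpow (hγ : γ ≤ 1) {μ : Measure (E N)}
    (hu : AEStronglyMeasurable u μ) (hG : MemLp G 2 μ) :
    Integrable (fun x => ‖G x‖ ^ 2 * (1 + u x ^ 2) ^ (γ - 1)) μ := by
  refine (hG.integrable_norm_pow (by simp)).mono'
    ((hG.1.norm.pow 2).mul ((contDiff_one_add_sq_rpow (γ - 1)).continuous.comp_aestronglyMeasurable
      hu)) (Eventually.of_forall fun x => ?_)
  rw [Real.norm_of_nonneg (by positivity)]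
  exact mul_le_of_le_one_right (by positivity) (one_add_sq_rpow_le_one (by linarith) _)

/-- Sobolev's inequality for `Ψ(u) = (1+u²)^{γ/2} - 1`, where the `-1` ensures `Ψ 0 = 0`. Since
`|Ψ'|² ≤ (1+t²)^{γ-1}`, the gradient side is the weighted energy, and `γ a = s` turns `(1 + Ψ(u))^a`
into `(1+u²)^{s/2}`. -/
theorem integrable_rpow_of_sobolev (hX : ∀ j, LocallyLipschitz (X j)) (hΩ : volume Ω ≠ ⊤)
    (hγ0 : 0 ≤ γ) (hγ : γ ≤ 1) (ha : 0 < a) (hs : γ * a = s) {S : ℝ}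
    (hS : ∀ (u : E N → ℝ) (G : E N → E m), IsW0 X Ω 2 u G →
      eLpNorm u (ENNReal.ofReal a) (volume.restrict Ω) ≤
        ENNReal.ofReal S * eLpNorm G 2 (volume.restrict Ω)) (h : IsW0 X Ω 2 u G) :
    IntegrableOn (fun x => (1 + u x ^ 2) ^ (s / 2)) Ω ∧
      ∫ x in Ω, (1 + u x ^ 2) ^ (s / 2) ≤ 2 ^ a * ((volume Ω).toReal +
        |S| ^ a * (∫ x in Ω, ‖G x‖ ^ 2 * (1 + u x ^ 2) ^ (γ - 1)) ^ (a / 2)) := by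
  have : IsFiniteMeasure (volume.restrict Ω) := isFiniteMeasure_restrict.2 hΩ
  set Ψ : ℝ → ℝ := fun t => (1 + t ^ 2) ^ (γ / 2) - 1 with hΨ
  have hΨs : ContDiff ℝ ∞ Ψ := (contDiff_one_add_sq_rpow (γ / 2)).sub contDiff_const
  have hd := abs_deriv_one_add_sq_rpow_sub_one_le hγ0 hγ
  have hw := h.comp hX (by norm_num) (by simp) hΨs (by simp [hΨ]) (K := 1) fun t =>
    (hd t).trans (one_add_sq_rpow_le_one (by linarith) t)
  have h1 := hS _ _ hw
  have ha0 : ENNReal.ofReal a ≠ 0 := by simpa using ha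
  have hmem : MemLp (fun x => Ψ (u x)) (ENNReal.ofReal a) (volume.restrict Ω) :=
    ⟨hw.1.1, h1.trans_lt (ENNReal.mul_lt_top ENNReal.ofReal_lt_top hw.2.1.2)⟩
  have hJi := integrable_norm_sq_mul_rpow hγ h.1.1 h.2.1
  set J := ∫ x in Ω, ‖G x‖ ^ 2 * (1 + u x ^ 2) ^ (γ - 1) with hJ
  have hJ0 : 0 ≤ J := integral_nonneg fun x => by positivity
  have hI : Integrable (fun x => |Ψ (u x)| ^ a) (volume.restrict Ω) := by
    have := hmem.integrable_norm_rpow ha0 ENNReal.ofReal_ne_top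
    simpa [ENNReal.toReal_ofReal ha.le] using this
  have hI0 : 0 ≤ ∫ x in Ω, |Ψ (u x)| ^ a := integral_nonneg fun x => by positivity
  have h2 : ∫ x in Ω, |Ψ (u x)| ^ a ≤ |S| ^ a * J ^ (a / 2) := by
    rw [hmem.eLpNorm_eq_integral_rpow_norm ha0 ENNReal.ofReal_ne_top,
      hw.2.1.eLpNorm_eq_integral_rpow_norm (by simp) (by simp), ENNReal.toReal_ofReal ha.le] at h1
    have h3 : (∫ x in Ω, |Ψ (u x)| ^ a) ^ a⁻¹ ≤ |S| * J ^ (1 / 2 : ℝ) := by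
      rw [← ENNReal.ofReal_le_ofReal_iff (by positivity), ENNReal.ofReal_mul (abs_nonneg S)]
      refine h1.trans (mul_le_mul' (ENNReal.ofReal_le_ofReal (le_abs_self S))
        (ENNReal.ofReal_le_ofReal ?_))
      simp only [ENNReal.toReal_ofNat, one_div]
      refine Real.rpow_le_rpow (integral_nonneg fun x => by positivity) ?_ (by norm_num)
      refine integral_mono_of_nonneg (Eventually.of_forall fun x => by positivity) hJi
        (Eventually.of_forall fun x => ?_)
      simp only
      rw [Real.rpow_two, norm_smul, mul_pow, mul_comm]
      gcongr
      calc ‖deriv Ψ (u x)‖ ^ 2 ≤ ((1 + u x ^ 2) ^ ((γ - 1) / 2)) ^ 2 :=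
            pow_le_pow_left₀ (norm_nonneg _) (hd (u x)) 2
        _ = _ := by
            rw [← Real.rpow_mul_natCast (by positivity)]
            congr 1
            push_cast
            ring
    calc ∫ x in Ω, |Ψ (u x)| ^ a = ((∫ x in Ω, |Ψ (u x)| ^ a) ^ a⁻¹) ^ a :=
          (Real.rpow_inv_rpow hI0 ha.ne').symm
      _ ≤ (|S| * J ^ (1 / 2 : ℝ)) ^ a := by gcongr
      _ = _ := by
          rw [Real.mul_rpow (abs_nonneg S) (by positivity), ← Real.rpow_mul hJ0]
          congr 2
          ring
  have h4 : ∀ x, (1 + u x ^ 2) ^ (s / 2) ≤ 2 ^ a * (1 + |Ψ (u x)| ^ a) := fun x => by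
    have h5 : (1 + u x ^ 2) ^ (γ / 2) ≤ 2 * max 1 |Ψ (u x)| := by
      have h6 : (1 + u x ^ 2) ^ (γ / 2) = 1 + Ψ (u x) := by simp [hΨ]
      have := le_max_left 1 |Ψ (u x)|
      have := le_max_right 1 |Ψ (u x)|
      have := le_abs_self (Ψ (u x))
      linarith
    calc (1 + u x ^ 2) ^ (s / 2) = ((1 + u x ^ 2) ^ (γ / 2)) ^ a := by
          rw [← Real.rpow_mul (by positivity), ← hs]
          congr 1
          ring
      _ ≤ (2 * max 1 |Ψ (u x)|) ^ a := by gcongr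
      _ = 2 ^ a * max 1 |Ψ (u x)| ^ a := Real.mul_rpow (by norm_num) (by positivity)
      _ ≤ _ := by
          gcongr
          rcases max_cases 1 |Ψ (u x)| with ⟨h7, -⟩ | ⟨h7, -⟩ <;> rw [h7]
          · rw [Real.one_rpow]
            have : 0 ≤ |Ψ (u x)| ^ a := by positivity
            linarith
          · linarith
  have h8 : Integrable (fun x => 2 ^ a * (1 + |Ψ (u x)| ^ a)) (volume.restrict Ω) :=
    ((integrable_const 1).add hI).const_mul _
  have h9 : IntegrableOn (fun x => (1 + u x ^ 2) ^ (s / 2)) Ω := by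
    refine h8.mono' ((contDiff_one_add_sq_rpow _).continuous.comp_aestronglyMeasurable h.1.1)
      (Eventually.of_forall fun x => ?_)
    rw [Real.norm_of_nonneg (by positivity)]
    exact h4 x
  refine ⟨h9, (integral_mono h9 h8 h4).trans ?_⟩
  rw [integral_const_mul, integral_add (integrable_const 1) hI]
  gcongr
  simp [Measure.real]

/-- The test function is `Φ(u) = u (1+u²)^{γ-1}`. Ellipticity from below and `Φ' ≥
(2γ-1)(1+t²)^{γ-1}` produce the weighted energy. On the right `|Φ(u)| ≤ (1+u²)^{γ-1/2}`, whose
`p'`-th power is `(1+u²)^{s/2}` by the choice of `s`. -/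
theorem integral_norm_sq_mul_rpow_le (hX : ∀ j, LocallyLipschitz (X j)) (hα : 0 < α)
    (hA : IsElliptic Ω α β A) (hγ' : 1 / 2 < γ) (hγ : γ ≤ 1) (hp : p.HolderConjugate p')
    (hs : (2 * γ - 1) * p' = s) (h : IsW0 X Ω 2 u G)
    (hu : IntegrableOn (fun x => (1 + u x ^ 2) ^ (s / 2)) Ω)
    (hg : MemLp g (ENNReal.ofReal p) (volume.restrict Ω)) (hg1 : ∫ x in Ω, |g x| ^ p ≤ 1)
    (hsol : ∀ (v : E N → ℝ) (H : E N → E m), IsW0 X Ω 2 v H →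
      ∫ x in Ω, (A x *ᵥ (G x).ofLp) ⬝ᵥ (H x).ofLp = ∫ x in Ω, g x * v x) :
    ∫ x in Ω, ‖G x‖ ^ 2 * (1 + u x ^ 2) ^ (γ - 1) ≤
      (α * (2 * γ - 1))⁻¹ * (∫ x in Ω, (1 + u x ^ 2) ^ (s / 2)) ^ (1 / p') := by
  have hJi := integrable_norm_sq_mul_rpow hγ h.1.1 h.2.1
  set Φ : ℝ → ℝ := fun t => t * (1 + t ^ 2) ^ (γ - 1) with hΦ
  have hv := h.comp hX (by norm_num) (by simp)
    (contDiff_id.mul (contDiff_one_add_sq_rpow (γ - 1)) : ContDiff ℝ ∞ Φ) (by simp) (K := 1)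
    (abs_deriv_mul_one_add_sq_rpow_le hγ'.le hγ)
  have h1 : α * (2 * γ - 1) * (∫ x in Ω, ‖G x‖ ^ 2 * (1 + u x ^ 2) ^ (γ - 1)) ≤
      ∫ x in Ω, (A x *ᵥ (G x).ofLp) ⬝ᵥ (deriv Φ (u x) • G x).ofLp := by
    rw [← integral_const_mul]
    refine integral_mono_ae (hJi.const_mul _) (hA.integrable_mulVec_dotProduct h.2.1 hv.2.1) ?_
    filter_upwards [hA.elliptic] with x hx
    have h2 := le_deriv_mul_one_add_sq_rpow hγ (u x)
    have h3 : 0 ≤ (2 * γ - 1) * (1 + u x ^ 2) ^ (γ - 1) :=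
      mul_nonneg (by linarith) (by positivity)
    have h4 : (G x).ofLp ⬝ᵥ (G x).ofLp = ‖G x‖ ^ 2 := by
      rw [EuclideanSpace.norm_sq_eq]
      simp [dotProduct, sq]
    have h5 := (hx (G x).ofLp).1
    rw [h4] at h5
    rw [WithLp.ofLp_smul, dotProduct_smul, smul_eq_mul]
    calc α * (2 * γ - 1) * (‖G x‖ ^ 2 * (1 + u x ^ 2) ^ (γ - 1))
        = (2 * γ - 1) * (1 + u x ^ 2) ^ (γ - 1) * (α * ‖G x‖ ^ 2) := by ring
      _ ≤ _ := mul_le_mul h2 h5 (by positivity) (h3.trans h2)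
  set W : E N → ℝ := fun x => (1 + u x ^ 2) ^ (γ - 1 / 2) with hW
  have hWm : AEStronglyMeasurable W (volume.restrict Ω) :=
    (contDiff_one_add_sq_rpow _).continuous.comp_aestronglyMeasurable h.1.1
  have hWp : ∀ x, W x ^ p' = (1 + u x ^ 2) ^ (s / 2) := fun x => by
    rw [hW, ← Real.rpow_mul (by positivity), ← hs]
    congr 1
    ring
  have hp'0 : 0 < p' := hp.symm.pos
  have hWmem : MemLp W (ENNReal.ofReal p') (volume.restrict Ω) := by
    rw [← integrable_norm_rpow_iff hWm (by simpa using hp'0) ENNReal.ofReal_ne_top,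
      ENNReal.toReal_ofReal hp'0.le]
    refine hu.congr (Eventually.of_forall fun x => ?_)
    simp only
    rw [Real.norm_of_nonneg (by positivity), hWp]
  have h6 : ∫ x in Ω, g x * Φ (u x) ≤ (∫ x in Ω, (1 + u x ^ 2) ^ (s / 2)) ^ (1 / p') := by
    have h7 := integral_mul_le_Lp_mul_Lq_of_nonneg hp
      (Eventually.of_forall fun x => abs_nonneg (g x))
      (Eventually.of_forall fun x => by positivity) hg.abs hWmem
    simp only [hWp] at h7
    have h8 : Integrable (fun x => |g x| * W x) (volume.restrict Ω) := by
      have : (ENNReal.ofReal p).HolderConjugate (ENNReal.ofReal p') := hp.ennrealOfReal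
      exact hg.abs.integrable_mul hWmem
    calc ∫ x in Ω, g x * Φ (u x) ≤ ∫ x in Ω, |g x| * W x := by
          refine (le_abs_self _).trans ((abs_integral_le_integral_abs).trans
            (integral_mono_of_nonneg (Eventually.of_forall fun x => abs_nonneg _) h8
              (Eventually.of_forall fun x => ?_)))
          simp only
          rw [abs_mul]
          gcongr
          exact abs_mul_one_add_sq_rpow_le γ (u x)
      _ ≤ _ := h7
      _ ≤ 1 * (∫ x in Ω, (1 + u x ^ 2) ^ (s / 2)) ^ (1 / p') := by
          gcongr
          exact Real.rpow_le_one (integral_nonneg fun x => by positivity) hg1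
              (one_div_nonneg.2 hp.pos.le)
      _ = _ := one_mul _
  rw [inv_mul_eq_div, le_div_iff₀' (mul_pos hα (by linarith))]
  exact h1.trans ((hsol _ _ hv).le.trans h6)

/-- Hölder's inequality with exponents `2/q` and `2/(2-q)`, after multiplying and dividing by the
weight `(1+u²)^{(γ-1)q/2}`. -/
theorem integral_norm_rpow_le (hγ : γ ≤ 1) (hq0 : 0 < q) (hq : q < 2)
    (hs : (1 - γ) * (2 * q / (2 - q)) = s) {μ : Measure (E N)} (hum : AEStronglyMeasurable u μ)
    (hG : MemLp G 2 μ) (hu : Integrable (fun x => (1 + u x ^ 2) ^ (s / 2)) μ) :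
    ∫ x, ‖G x‖ ^ q ∂μ ≤ (∫ x, ‖G x‖ ^ 2 * (1 + u x ^ 2) ^ (γ - 1) ∂μ) ^ (q / 2) *
      (∫ x, (1 + u x ^ 2) ^ (s / 2) ∂μ) ^ ((2 - q) / 2) := by
  have hJi := integrable_norm_sq_mul_rpow hγ hum hG
  have h2q : 0 < 2 - q := by linarith
  have hpq : (2 / q).HolderConjugate (2 / (2 - q)) := by
    rw [Real.holderConjugate_iff]
    refine ⟨by rw [lt_div_iff₀ hq0]; linarith, ?_⟩
    field_simp
    ring
  set F : E N → ℝ := fun x => (‖G x‖ ^ 2 * (1 + u x ^ 2) ^ (γ - 1)) ^ (q / 2) with hF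
  set W : E N → ℝ := fun x => (1 + u x ^ 2) ^ ((1 - γ) * (q / 2)) with hW
  have hFp : ∀ x, F x ^ (2 / q) = ‖G x‖ ^ 2 * (1 + u x ^ 2) ^ (γ - 1) := fun x => by
    rw [hF, ← Real.rpow_mul (by positivity), div_mul_div_cancel₀ two_ne_zero, div_self hq0.ne',
      Real.rpow_one]
  have hWp : ∀ x, W x ^ (2 / (2 - q)) = (1 + u x ^ 2) ^ (s / 2) := fun x => by
    rw [hW, ← Real.rpow_mul (by positivity), ← hs]
    congr 1
    field_simp
  have hFW : ∀ x, F x * W x = ‖G x‖ ^ q := fun x => by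
    have h0 : (0 : ℝ) < 1 + u x ^ 2 := by positivity
    simp only [hF, hW]
    rw [Real.mul_rpow (by positivity) (by positivity), ← Real.rpow_mul h0.le, mul_assoc,
      ← Real.rpow_add h0, ← Real.rpow_natCast, ← Real.rpow_mul (norm_nonneg _)]
    rw [show (γ - 1) * (q / 2) + (1 - γ) * (q / 2) = 0 by ring, Real.rpow_zero, mul_one]
    congr 1
    push_cast
    ring
  have hFm : AEStronglyMeasurable F μ :=
    (Real.continuous_rpow_const (by positivity)).comp_aestronglyMeasurable hJi.1
  have hWm : AEStronglyMeasurable W μ :=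
    (contDiff_one_add_sq_rpow _).continuous.comp_aestronglyMeasurable hum
  have hFmem : MemLp F (ENNReal.ofReal (2 / q)) μ := by
    rw [← integrable_norm_rpow_iff hFm (ENNReal.ofReal_pos.2 (by positivity)).ne' ENNReal.ofReal_ne_top,
      ENNReal.toReal_ofReal (by positivity)]
    refine hJi.congr (Eventually.of_forall fun x => ?_)
    simp only
    rw [Real.norm_of_nonneg (by positivity), hFp]
  have hWmem : MemLp W (ENNReal.ofReal (2 / (2 - q))) μ := by
    rw [← integrable_norm_rpow_iff hWm (ENNReal.ofReal_pos.2 (by positivity)).ne' ENNReal.ofReal_ne_top,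
      ENNReal.toReal_ofReal (by positivity)]
    refine hu.congr (Eventually.of_forall fun x => ?_)
    simp only
    rw [Real.norm_of_nonneg (by positivity), hWp]
  have h7 := integral_mul_le_Lp_mul_Lq_of_nonneg hpq
    (Eventually.of_forall fun x => (by positivity : 0 ≤ F x))
    (Eventually.of_forall fun x => (by positivity : 0 ≤ W x)) hFmem hWmem
  simpa only [hWp, hFp, hFW, one_div_div] using h7

end Estimate

/-! ### The a priori estimate for weak solutions. -/

/-- `u ∈ W₀^{1,2}(Ω,X)`, with gradient `G`, solves `X^*(A Xu) = g` weakly. -/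
def IsWeakPair (X : Fin m → E N → E N) (Ω : Set (E N)) (A : E N → Matrix (Fin m) (Fin m) ℝ)
    (g u : E N → ℝ) (G : E N → E m) : Prop :=
  IsW0 X Ω 2 u G ∧ ∀ (v : E N → ℝ) (H : E N → E m), IsW0 X Ω 2 v H →
    ∫ x in Ω, (A x *ᵥ (G x).ofLp) ⬝ᵥ (H x).ofLp = ∫ x in Ω, g x * v x

section WeakPair

variable {X : Fin m → E N → E N} {Ω : Set (E N)} {α β : ℝ}
  {A : E N → Matrix (Fin m) (Fin m) ℝ} {g g' u u' : E N → ℝ} {G G' : E N → E m}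

theorem IsWeakPair.const_mul (h : IsWeakPair X Ω A g u G) (c : ℝ) :
    IsWeakPair X Ω A (fun x => c * g x) (fun x => c * u x) (fun x => c • G x) := by
  refine ⟨h.1.const_mul c, fun v H hv => ?_⟩
  have h1 := congrArg (c * ·) (h.2 v H hv)
  simp only [← integral_const_mul] at h1
  simpa [Matrix.mulVec_smul, mul_assoc] using h1

theorem IsWeakPair.sub (hX : ∀ j, LocallyLipschitz (X j)) (hA : IsElliptic Ω α β A)
    (h : IsWeakPair X Ω A g u G) (h' : IsWeakPair X Ω A g' u' G')
    (hg : MemLp g 2 (volume.restrict Ω)) (hg' : MemLp g' 2 (volume.restrict Ω)) :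
    IsWeakPair X Ω A (fun x => g x - g' x) (fun x => u x - u' x) (fun x => G x - G' x) := by
  refine ⟨h.1.sub hX (by norm_num) h'.1, fun v H hv => ?_⟩
  have h1 : Integrable (fun x => g x * v x) (volume.restrict Ω) := hg.integrable_mul hv.1
  have h2 : Integrable (fun x => g' x * v x) (volume.restrict Ω) := hg'.integrable_mul hv.1
  simp only [WithLp.ofLp_sub, Matrix.mulVec_sub, sub_dotProduct, sub_mul]
  rw [integral_sub (hA.integrable_mulVec_dotProduct h.1.2.1 hv.2.1)
    (hA.integrable_mulVec_dotProduct h'.1.2.1 hv.2.1), integral_sub h1 h2, h.2 v H hv,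
    h'.2 v H hv]

variable {γ a s p p' q : ℝ}

/-- Inserting the energy bound into the Sobolev bound gives `I ≤ c + c' I^{a/(2p')}`, a sublinear
inequality for the finite number `I = ∫ (1+u²)^{s/2}`. The data are normalized because the weights
`1 + u²` are not homogeneous in `u`. Both `c` and `c'` are fixed before `β` and `A`. -/
theorem exists_eLpNorm_le_of_integral_rpow_le_one (hX : ∀ j, LocallyLipschitz (X j))
    (hΩ : volume Ω ≠ ⊤) {S : ℝ} (hS : ∀ (u : E N → ℝ) (G : E N → E m), IsW0 X Ω 2 u G →
      eLpNorm u (ENNReal.ofReal a) (volume.restrict Ω) ≤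
        ENNReal.ofReal S * eLpNorm G 2 (volume.restrict Ω)) (hα : 0 < α) (ha : 0 < a)
    (hγ' : 1 / 2 < γ) (hγ : γ ≤ 1) (hp : p.HolderConjugate p') (hap : a / (2 * p') < 1)
    (hsa : γ * a = s) (hsp : (2 * γ - 1) * p' = s) (hq0 : 0 < q) (hq : q < 2)
    (hsq : (1 - γ) * (2 * q / (2 - q)) = s) :
    ∃ K : ℝ, 0 < K ∧ ∀ (β : ℝ) (A : E N → Matrix (Fin m) (Fin m) ℝ), IsElliptic Ω α β A →
      ∀ (g u : E N → ℝ) (G : E N → E m), MemLp g (ENNReal.ofReal p) (volume.restrict Ω) →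
      IsWeakPair X Ω A g u G → ∫ x in Ω, |g x| ^ p ≤ 1 →
      eLpNorm u (ENNReal.ofReal s) (volume.restrict Ω) ≤ ENNReal.ofReal K ∧
      eLpNorm G (ENNReal.ofReal q) (volume.restrict Ω) ≤ ENNReal.ofReal K := by
  have : IsFiniteMeasure (volume.restrict Ω) := isFiniteMeasure_restrict.2 hΩ
  have hp'0 : 0 < p' := hp.symm.pos
  have hs0 : 0 < s := hsa ▸ mul_pos (by linarith) ha
  set D := (α * (2 * γ - 1))⁻¹ with hD
  have hD0 : 0 < D := inv_pos.2 (mul_pos hα (by linarith))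
  obtain ⟨K₀, hK₀, hK⟩ := exists_le_of_le_add_mul_rpow (2 ^ a * (volume Ω).toReal)
    (2 ^ a * (|S| ^ a * D ^ (a / 2))) (θ := a / (2 * p')) (by positivity) (by positivity)
    (by positivity) hap
  set K₁ := (D * K₀ ^ (1 / p')) ^ (q / 2) * K₀ ^ ((2 - q) / 2) with hK₁
  refine ⟨max (K₀ ^ s⁻¹) (K₁ ^ q⁻¹), by positivity, fun β A hA g u G hg hw hg1 => ?_⟩
  obtain ⟨h, hsol⟩ := hw
  obtain ⟨hu, hI⟩ := integrable_rpow_of_sobolev hX hΩ (by linarith) hγ ha hsa hS h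
  have hJ := integral_norm_sq_mul_rpow_le hX hα hA hγ' hγ hp hsp h hu hg hg1 hsol
  have hGq := integral_norm_rpow_le hγ hq0 hq hsq h.1.1 h.2.1 hu
  set I := ∫ x in Ω, (1 + u x ^ 2) ^ (s / 2) with hI'
  set J := ∫ x in Ω, ‖G x‖ ^ 2 * (1 + u x ^ 2) ^ (γ - 1) with hJ'
  have hI0 : 0 ≤ I := integral_nonneg fun x => by positivity
  have hJ0 : 0 ≤ J := integral_nonneg fun x => by positivity
  have hIK : I ≤ K₀ := by
    refine hK I (hI.trans ?_)
    have h1 : J ^ (a / 2) ≤ D ^ (a / 2) * I ^ (a / (2 * p')) := by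
      calc J ^ (a / 2) ≤ (D * I ^ (1 / p')) ^ (a / 2) := by gcongr
        _ = _ := by
          rw [Real.mul_rpow hD0.le (by positivity), ← Real.rpow_mul hI0]
          congr 2
          field_simp
    calc 2 ^ a * ((volume Ω).toReal + |S| ^ a * J ^ (a / 2))
        ≤ 2 ^ a * ((volume Ω).toReal + |S| ^ a * (D ^ (a / 2) * I ^ (a / (2 * p')))) := by gcongr
      _ = _ := by ring
  have hGK : ∫ x in Ω, ‖G x‖ ^ q ≤ K₁ := by
    refine hGq.trans ?_
    have : 0 ≤ (2 - q) / 2 := by linarith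
    have : J ≤ D * K₀ ^ (1 / p') := hJ.trans (by gcongr)
    rw [hK₁]
    gcongr
  constructor
  · have h1 : ∀ x, |u x| ^ s ≤ (1 + u x ^ 2) ^ (s / 2) := fun x => by
      calc |u x| ^ s ≤ ((1 + u x ^ 2) ^ (1 / 2 : ℝ)) ^ s := by
            gcongr
            exact abs_le_one_add_sq_rpow_half _
        _ = _ := by
            rw [← Real.rpow_mul (by positivity)]
            congr 1
            ring
    have h0 : ENNReal.ofReal s ≠ 0 := by simpa using hs0
    have h2 : MemLp u (ENNReal.ofReal s) (volume.restrict Ω) := by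
      rw [← integrable_norm_rpow_iff h.1.1 h0 ENNReal.ofReal_ne_top, ENNReal.toReal_ofReal hs0.le]
      refine hu.mono' ((Real.continuous_rpow_const hs0.le).comp_aestronglyMeasurable h.1.1.norm)
        (Eventually.of_forall fun x => ?_)
      rw [Real.norm_of_nonneg (by positivity)]
      exact h1 x
    rw [h2.eLpNorm_eq_integral_rpow_norm h0 ENNReal.ofReal_ne_top, ENNReal.toReal_ofReal hs0.le]
    refine ENNReal.ofReal_le_ofReal (le_max_of_le_left ?_)
    refine Real.rpow_le_rpow (integral_nonneg fun x => by positivity) ?_ (by positivity)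
    exact (integral_mono_of_nonneg (Eventually.of_forall fun x => by positivity) hu
      (Eventually.of_forall h1)).trans hIK
  · have h0 : ENNReal.ofReal q ≠ 0 := by simpa using hq0
    have h2 : MemLp G (ENNReal.ofReal q) (volume.restrict Ω) := by
      refine h.2.1.mono_exponent ?_
      rw [← ENNReal.ofReal_ofNat]
      exact ENNReal.ofReal_le_ofReal hq.le
    rw [h2.eLpNorm_eq_integral_rpow_norm h0 ENNReal.ofReal_ne_top, ENNReal.toReal_ofReal hq0.le]
    refine ENNReal.ofReal_le_ofReal (le_max_of_le_right ?_)
    exact Real.rpow_le_rpow (integral_nonneg fun x => by positivity) hGK (by positivity)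

/-- The a priori estimate for weak solutions: an `L^p` datum controls `u` in `L^{p**}` and `Xu` in
`L^{p*}`. -/
theorem exists_eLpNorm_le_mul_of_isWeakPair (hX : ∀ j, LocallyLipschitz (X j))
    (hΩ : volume Ω ≠ ⊤) {S : ℝ} (hS : ∀ (u : E N → ℝ) (G : E N → E m), IsW0 X Ω 2 u G →
      eLpNorm u (ENNReal.ofReal a) (volume.restrict Ω) ≤
        ENNReal.ofReal S * eLpNorm G 2 (volume.restrict Ω)) (hα : 0 < α) (ha : 0 < a)
    (hγ' : 1 / 2 < γ) (hγ : γ ≤ 1) (hp : p.HolderConjugate p') (hap : a / (2 * p') < 1)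
    (hsa : γ * a = s) (hsp : (2 * γ - 1) * p' = s) (hq0 : 0 < q) (hq : q < 2)
    (hsq : (1 - γ) * (2 * q / (2 - q)) = s) :
    ∃ K : ℝ, 0 < K ∧ ∀ (β : ℝ) (A : E N → Matrix (Fin m) (Fin m) ℝ), IsElliptic Ω α β A →
      ∀ (g u : E N → ℝ) (G : E N → E m), MemLp g (ENNReal.ofReal p) (volume.restrict Ω) →
      IsWeakPair X Ω A g u G →
      eLpNorm u (ENNReal.ofReal s) (volume.restrict Ω) ≤
        ENNReal.ofReal K * eLpNorm g (ENNReal.ofReal p) (volume.restrict Ω) ∧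
      eLpNorm G (ENNReal.ofReal q) (volume.restrict Ω) ≤
        ENNReal.ofReal K * eLpNorm g (ENNReal.ofReal p) (volume.restrict Ω) := by
  obtain ⟨K, hK0, hK⟩ :=
    exists_eLpNorm_le_of_integral_rpow_le_one hX hΩ hS hα ha hγ' hγ hp hap hsa hsp hq0 hq hsq
  refine ⟨K, hK0, fun β A hA g u G hg hw => ?_⟩
  have hp0 : 0 < p := hp.pos
  have hpe : ENNReal.ofReal p ≠ 0 := by simpa using hp0
  -- The equation is linear, so `u / t` solves it with datum `g / t` of norm at most one. A free `t`
  -- above the norm, instead of the norm itself, allows `g = 0`.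
  have key : ∀ t : ℝ, 0 < t → eLpNorm g (ENNReal.ofReal p) (volume.restrict Ω) ≤ ENNReal.ofReal t →
      eLpNorm u (ENNReal.ofReal s) (volume.restrict Ω) ≤ ENNReal.ofReal K * ENNReal.ofReal t ∧
      eLpNorm G (ENNReal.ofReal q) (volume.restrict Ω) ≤ ENNReal.ofReal K * ENNReal.ofReal t := by
    intro t ht hgt
    have hte : ‖t⁻¹‖ₑ = (ENNReal.ofReal t)⁻¹ := by
      rw [← ofReal_norm, Real.norm_of_nonneg (by positivity), ENNReal.ofReal_inv_of_pos ht]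
    have ht0 : ENNReal.ofReal t ≠ 0 := by simpa using ht
    have hg' := hg.const_mul t⁻¹
    have h1 : ∫ x in Ω, |t⁻¹ * g x| ^ p ≤ 1 := by
      have h2 : eLpNorm (fun x => t⁻¹ * g x) (ENNReal.ofReal p) (volume.restrict Ω) ≤ 1 := by
        have h3 := eLpNorm_const_smul t⁻¹ g (ENNReal.ofReal p) (volume.restrict Ω)
        refine h3.le.trans ?_
        rw [hte]
        refine (mul_le_mul_right hgt _).trans ?_
        rw [ENNReal.inv_mul_cancel ht0 ENNReal.ofReal_ne_top]
      rw [hg'.eLpNorm_eq_integral_rpow_norm hpe ENNReal.ofReal_ne_top,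
        ENNReal.toReal_ofReal hp0.le, ENNReal.ofReal_le_one] at h2
      have h4 : 0 ≤ ∫ x in Ω, |t⁻¹ * g x| ^ p := integral_nonneg fun x => by positivity
      calc ∫ x in Ω, |t⁻¹ * g x| ^ p = ((∫ x in Ω, |t⁻¹ * g x| ^ p) ^ p⁻¹) ^ p :=
            (Real.rpow_inv_rpow h4 hp0.ne').symm
        _ ≤ 1 := Real.rpow_le_one (by positivity) h2 hp0.le
    obtain ⟨h5, h6⟩ := hK β A hA _ _ _ hg' (hw.const_mul t⁻¹) h1
    have h7 := eLpNorm_const_smul t⁻¹ u (ENNReal.ofReal s) (volume.restrict Ω)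
    have h8 := eLpNorm_const_smul t⁻¹ G (ENNReal.ofReal q) (volume.restrict Ω)
    have h9 := h7.symm.trans_le h5
    have h10 := h8.symm.trans_le h6
    rw [hte, ← ENNReal.div_eq_inv_mul, ENNReal.div_le_iff ht0 ENNReal.ofReal_ne_top] at h9 h10
    exact ⟨h9, h10⟩
  -- Letting `t` decrease to the norm of `g`.
  have hinf : ∀ y : ℝ≥0∞, (∀ t : ℝ, 0 < t →
      eLpNorm g (ENNReal.ofReal p) (volume.restrict Ω) ≤ ENNReal.ofReal t →
      y ≤ ENNReal.ofReal K * ENNReal.ofReal t) →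
      y ≤ ENNReal.ofReal K * eLpNorm g (ENNReal.ofReal p) (volume.restrict Ω) := by
    intro y hy
    have hKe : ENNReal.ofReal K ≠ 0 := by simpa using hK0
    rw [← ENNReal.div_le_iff' hKe ENNReal.ofReal_ne_top]
    refine le_of_forall_gt_imp_ge_of_dense fun b hb => ?_
    rcases eq_or_ne b ⊤ with rfl | hb'
    · exact le_top
    have hb0 : 0 < b.toReal := ENNReal.toReal_pos hb.ne_bot hb'
    have h1 := hy b.toReal hb0
    rw [ENNReal.ofReal_toReal hb'] at h1
    rw [ENNReal.div_le_iff' hKe ENNReal.ofReal_ne_top]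
    exact h1 hb.le
  exact ⟨hinf _ fun t ht hgt => (key t ht hgt).1, hinf _ fun t ht hgt => (key t ht hgt).2⟩

end WeakPair

/-! ### Truncated data and completeness of `L^p`. -/

section Truncation

theorem abs_trunc_le {k : ℝ} (hk : 0 ≤ k) (t : ℝ) : |trunc k t| ≤ k :=
  abs_le.2 ⟨le_max_left _ _, max_le (by linarith) (min_le_left _ _)⟩

theorem abs_trunc_le_abs {k : ℝ} (hk : 0 ≤ k) (t : ℝ) : |trunc k t| ≤ |t| := by
  rw [abs_le, trunc]
  refine ⟨le_max_of_le_right (le_min ?_ (neg_abs_le t)), max_le ?_ ?_⟩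
  · exact (neg_nonpos.2 (abs_nonneg t)).trans hk
  · exact (neg_nonpos.2 hk).trans (abs_nonneg t)
  · exact (min_le_right _ _).trans (le_abs_self t)

theorem trunc_eq_self {k t : ℝ} (h : |t| ≤ k) : trunc k t = t := by
  rw [trunc, min_eq_right (abs_le.1 h).2, max_eq_right (abs_le.1 h).1]

theorem continuous_trunc (k : ℝ) : Continuous (trunc k) := by
  unfold trunc
  fun_prop

variable {ι : Type*} [MeasurableSpace ι] {μ : Measure ι} {f : ι → ℝ} {p : ℝ≥0∞}

theorem memLp_trunc [IsFiniteMeasure μ] (hf : AEStronglyMeasurable f μ) (n : ℕ) (p : ℝ≥0∞) :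
    MemLp (fun x => trunc n (f x)) p μ :=
  .of_bound ((continuous_trunc n).comp_aestronglyMeasurable hf) n
    (Eventually.of_forall fun _ => abs_trunc_le n.cast_nonneg _)

theorem tendsto_eLpNorm_trunc_sub (hp0 : p ≠ 0) (hp : p ≠ ⊤) (hf : MemLp f p μ) :
    Tendsto (fun n : ℕ => eLpNorm (fun x => trunc n (f x) - f x) p μ) atTop (𝓝 0) := by
  refine tendsto_eLpNorm_zero_of_dominated hp0 hp
    (fun n => ((continuous_trunc n).comp_aestronglyMeasurable hf.1).sub hf.1)
    (hf.norm.const_mul 2) (fun n => Eventually.of_forall fun x => ?_)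
    (Eventually.of_forall fun x => ?_)
  · refine (norm_sub_le _ _).trans ?_
    have : ‖trunc n (f x)‖ ≤ ‖f x‖ := abs_trunc_le_abs n.cast_nonneg _
    linarith
  · obtain ⟨k, hk⟩ := exists_nat_ge |f x|
    refine tendsto_const_nhds.congr' ?_
    filter_upwards [eventually_ge_atTop k] with n hn
    rw [trunc_eq_self (hk.trans (by exact_mod_cast hn)), sub_self]

/-- Completeness, with the Cauchy condition in the form available for truncations: `b n` will be a
multiple of the distance from the `n`-th truncation to the datum. -/
theorem exists_tendsto_eLpNorm_sub {F : Type*} [NormedAddCommGroup F] [CompleteSpace F]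
    (hp : 1 ≤ p) {f : ℕ → ι → F} (hf : ∀ n, MemLp (f n) p μ) {b : ℕ → ℝ≥0∞}
    (hb : Tendsto b atTop (𝓝 0))
    (hfb : ∀ n k, eLpNorm (fun x => f n x - f k x) p μ ≤ b n + b k) :
    ∃ g, MemLp g p μ ∧ Tendsto (fun n => eLpNorm (fun x => f n x - g x) p μ) atTop (𝓝 0) := by
  have : Fact (1 ≤ p) := ⟨hp⟩
  have h1 : CauchySeq fun n => (hf n).toLp (f n) := by
    refine EMetric.cauchySeq_iff.2 fun ε hε => ?_
    obtain ⟨n₀, hn₀⟩ := eventually_atTop.1 (hb.eventually_lt_const (ENNReal.half_pos hε.ne'))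
    refine ⟨n₀, fun k hk n hn => ?_⟩
    rw [Lp.edist_toLp_toLp]
    refine (hfb k n).trans_lt ?_
    rw [← ENNReal.add_halves ε]
    exact ENNReal.add_lt_add (hn₀ k hk) (hn₀ n hn)
  obtain ⟨g, hg⟩ := cauchySeq_tendsto_of_complete h1
  refine ⟨g, Lp.memLp g, ?_⟩
  rw [← Lp.toLp_coeFn g (Lp.memLp g)] at hg
  exact (Lp.tendsto_Lp_iff_tendsto_eLpNorm'' f hf g (Lp.memLp g)).1 hg

end Truncation

/-! ### Convergence of the approximate solutions. -/

section Approximation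

variable {X : Fin m → E N → E N} {Ω : Set (E N)} {α β : ℝ}
  {A : E N → Matrix (Fin m) (Fin m) ℝ} {f : E N → ℝ} {p q s K : ℝ≥0∞}

/-- The weak solutions with truncated data converge in `W₀^{1,q}(Ω,X)`. -/
theorem exists_isW0_tendsto_of_isWeakPair_trunc (hX : ∀ j, LocallyLipschitz (X j))
    (hΩ : volume Ω ≠ ⊤) (hA : IsElliptic Ω α β A) (hp1 : 1 ≤ p) (hp : p ≠ ⊤) (hq : 1 ≤ q)
    (hq2 : q ≤ 2) (hqs : q ≤ s) (hK0 : K ≠ ⊤)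
    (hK : ∀ (g u : E N → ℝ) (G : E N → E m), MemLp g p (volume.restrict Ω) →
      IsWeakPair X Ω A g u G →
      eLpNorm u s (volume.restrict Ω) ≤ K * eLpNorm g p (volume.restrict Ω) ∧
      eLpNorm G q (volume.restrict Ω) ≤ K * eLpNorm g p (volume.restrict Ω))
    (hf : MemLp f p (volume.restrict Ω)) {un : ℕ → E N → ℝ} {Gn : ℕ → E N → E m}
    (h : ∀ n : ℕ, IsWeakPair X Ω A (fun x => trunc n (f x)) (un n) (Gn n)) :
    ∃ u G, IsW0 X Ω q u G ∧
      Tendsto (fun n => eLpNorm (fun x => un n x - u x) q (volume.restrict Ω)) atTop (𝓝 0) ∧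
      eLpNorm G q (volume.restrict Ω) ≤ K * eLpNorm f p (volume.restrict Ω) := by
  have : IsFiniteMeasure (volume.restrict Ω) := isFiniteMeasure_restrict.2 hΩ
  have hq0 : q ≠ 0 := (zero_lt_one.trans_le hq).ne'
  set b : ℕ → ℝ≥0∞ := fun n =>
    K * eLpNorm (fun x => trunc n (f x) - f x) p (volume.restrict Ω) with hb
  have hfm : ∀ n : ℕ, MemLp (fun x => trunc n (f x)) p (volume.restrict Ω) := fun n =>
    memLp_trunc hf.1 n p
  have hb0 : Tendsto b atTop (𝓝 0) := by
    have h1 := ENNReal.Tendsto.const_mul (a := K)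
      (tendsto_eLpNorm_trunc_sub (zero_lt_one.trans_le hp1).ne' hp hf) (Or.inr hK0)
    rwa [mul_zero] at h1
  have hd : ∀ n k : ℕ, K * eLpNorm (fun x => trunc n (f x) - trunc k (f x)) p
      (volume.restrict Ω) ≤ b n + b k := fun n k => by
    rw [hb, ← mul_add]
    gcongr
    refine le_of_eq_of_le ?_ (eLpNorm_sub_le ((hfm n).sub hf).1 ((hfm k).sub hf).1 hp1)
    congr 1
    ext x
    simp
  -- By linearity the difference of two approximate solutions solves the equation with the
  -- difference of the data, so the a priori estimate is a Cauchy estimate for functions and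
  -- gradients alike.
  have hpair : ∀ n k : ℕ, IsWeakPair X Ω A (fun x => trunc n (f x) - trunc k (f x))
      (fun x => un n x - un k x) (fun x => Gn n x - Gn k x) := fun n k =>
    (h n).sub hX hA (h k) (memLp_trunc hf.1 n 2) (memLp_trunc hf.1 k 2)
  have hest := fun n k : ℕ => hK _ _ _ ((hfm n).sub (hfm k)) (hpair n k)
  have hum : ∀ n, MemLp (un n) s (volume.restrict Ω) := fun n =>
    ⟨(h n).1.1.1, (hK _ _ _ (hfm n) (h n)).1.trans_lt (ENNReal.mul_lt_top hK0.lt_top (hfm n).2)⟩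
  have hw : ∀ n, IsW0 X Ω q (un n) (Gn n) := fun n => (h n).1.mono_exponent hX hΩ hq0 hq2
  obtain ⟨u, hu, hun⟩ := exists_tendsto_eLpNorm_sub (hq.trans hqs) hum hb0
    fun n k => (hest n k).1.trans (hd n k)
  obtain ⟨G, hG, hGn⟩ := exists_tendsto_eLpNorm_sub hq (fun n => (hw n).2.1) hb0
    fun n k => (hest n k).2.trans (hd n k)
  have hunq := tendsto_eLpNorm_mono_exponent hq0 hqs (fun n => ((hum n).sub hu).1) hun
  refine ⟨u, G, .of_tendsto hX hq hw (hu.mono_exponent hqs) hG hunq hGn, hunq, ?_⟩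
  have h1 := hGn.add_const (K * eLpNorm f p (volume.restrict Ω))
  rw [zero_add] at h1
  refine ge_of_tendsto' h1 fun n => ?_
  calc eLpNorm G q (volume.restrict Ω)
      ≤ eLpNorm (fun x => Gn n x - G x) q (volume.restrict Ω) +
        eLpNorm (Gn n) q (volume.restrict Ω) := by
        rw [add_comm]
        refine le_of_eq_of_le ?_ (eLpNorm_sub_le (hw n).2.1.1 ((hw n).2.1.sub hG).1 hq)
        congr 1
        ext x : 1
        simp
    _ ≤ _ := by
        gcongr
        refine (hK _ _ _ (hfm n) (h n)).2.trans ?_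
        gcongr
        exact eLpNorm_mono fun x => abs_trunc_le_abs n.cast_nonneg _

/-- Existence and regularity of solutions found by approximation, from an a priori estimate for
weak solutions. -/
theorem exists_isApproxSol_and_forall_isW0 (hX : ∀ j, LocallyLipschitz (X j))
    (hΩ : volume Ω ≠ ⊤) (hα : 0 < α) (hA : IsElliptic Ω α β A) (hp1 : 1 ≤ p) (hp : p ≠ ⊤)
    (hq : 1 ≤ q) (hq2 : q ≤ 2) (hqs : q ≤ s) (hK0 : K ≠ ⊤) {C : ℝ}
    (hC : ∀ (u : E N → ℝ) (G : E N → E m), IsW0 X Ω 2 u G →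
      eLpNorm u 2 (volume.restrict Ω) ≤ ENNReal.ofReal C * eLpNorm G 2 (volume.restrict Ω))
    (hK : ∀ (g u : E N → ℝ) (G : E N → E m), MemLp g p (volume.restrict Ω) →
      IsWeakPair X Ω A g u G →
      eLpNorm u s (volume.restrict Ω) ≤ K * eLpNorm g p (volume.restrict Ω) ∧
      eLpNorm G q (volume.restrict Ω) ≤ K * eLpNorm g p (volume.restrict Ω))
    (hf : MemLp f p (volume.restrict Ω)) :
    (∃ u, IsApproxSol X Ω A f u) ∧ ∀ u, IsApproxSol X Ω A f u →
      ∃ G, IsW0 X Ω q u G ∧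
        eLpNorm G q (volume.restrict Ω) ≤ K * eLpNorm f p (volume.restrict Ω) := by
  have : IsFiniteMeasure (volume.restrict Ω) := isFiniteMeasure_restrict.2 hΩ
  constructor
  · choose un Gn h using fun n : ℕ => exists_isWeakSol hX hC hα hA (memLp_trunc hf.1 n 2)
    obtain ⟨u, G, hu, hun, -⟩ :=
      exists_isW0_tendsto_of_isWeakPair_trunc hX hΩ hA hp1 hp hq hq2 hqs hK0 hK hf h
    exact ⟨u, hu.1.mono_exponent hq, un, fun n => ⟨Gn n, h n⟩, id, strictMono_id,
      tendsto_eLpNorm_mono_exponent one_ne_zero hq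
        (fun n => (h n).1.1.1.sub hu.1.1) hun⟩
  · rintro u ⟨hu, un, hun, κ, hκ, hlim⟩
    choose Gn h using hun
    obtain ⟨u', G, hu', hun', hG⟩ :=
      exists_isW0_tendsto_of_isWeakPair_trunc hX hΩ hA hp1 hp hq hq2 hqs hK0 hK hf h
    refine ⟨G, hu'.congr ?_ .rfl, hG⟩
    -- The whole sequence converges to `u'`, so the given subsequential limit `u` agrees with `u'`
    -- almost everywhere and inherits its gradient and bound.
    have h1 := (tendsto_eLpNorm_mono_exponent one_ne_zero hq
      (fun n => (h n).1.1.1.sub hu'.1.1) hun').comp hκ.tendsto_atTop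
    have h2 : Tendsto (fun n => eLpNorm (fun x => u' x - un (κ n) x) 1 (volume.restrict Ω)) atTop
        (𝓝 0) := h1.congr fun n => eLpNorm_sub_comm (un (κ n)) u' 1 _
    have h3 := tendsto_eLpNorm_sub_trans le_rfl (fun _ => hu'.1.1) (fun n => (h (κ n)).1.1.1)
      hu.1 h2 hlim
    have h4 := tendsto_nhds_unique tendsto_const_nhds h3
    filter_upwards [(eLpNorm_eq_zero_iff (hu'.1.1.sub hu.1) one_ne_zero).1 h4] with x hx
    exact sub_eq_zero.1 hx

end Approximation

end XElliptic

/-! ### The theorem: choice of the exponents. -/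

theorem theorem4p5 {N m : ℕ} (hN : 2 ≤ N)
    (X : Fin m → XElliptic.E N → XElliptic.E N) (hX : ∀ j, LocallyLipschitz (X j))
    (Ω : Set (XElliptic.E N)) (hΩ : IsOpen Ω) (hΩb : Bornology.IsBounded Ω)
    (U : Set (XElliptic.E N)) (hU : IsOpen U) (hΩU : U = Ω ∨ closure Ω ⊆ U)
    (Q : ℝ) (hQ : 2 < Q) (hadm : XElliptic.IsAdmissible X U Q)
    (p : ℝ) (hp1 : 1 < p) (hp2 : p < 2 * Q / (Q + 2))
    (α : ℝ) (hα : 0 < α) :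
    ∃ C : ℝ, 0 < C ∧
      ∀ (β : ℝ) (_ : α < β) (A : XElliptic.E N → Matrix (Fin m) (Fin m) ℝ)
        (_ : XElliptic.IsElliptic Ω α β A)
        (f : XElliptic.E N → ℝ) (_ : MemLp f (ENNReal.ofReal p) (volume.restrict Ω)),
        (∃ u : XElliptic.E N → ℝ, XElliptic.IsApproxSol X Ω A f u) ∧
        ∀ u : XElliptic.E N → ℝ, XElliptic.IsApproxSol X Ω A f u →
          ∃ G : XElliptic.E N → XElliptic.E m,
            XElliptic.IsW0 X Ω (ENNReal.ofReal (p * Q / (Q - p))) u G ∧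
            eLpNorm G (ENNReal.ofReal (p * Q / (Q - p))) (volume.restrict Ω) ≤
              ENNReal.ofReal C * eLpNorm f (ENNReal.ofReal p) (volume.restrict Ω) := by
  have hV : volume Ω ≠ ⊤ := hΩb.measure_lt_top.ne
  have : IsFiniteMeasure (volume.restrict Ω) := isFiniteMeasure_restrict.2 hV
  rw [lt_div_iff₀ (by linarith)] at hp2
  have hQ2 : 0 < Q - 2 := by linarith
  have hpQ : 0 < Q - 2 * p := by nlinarith
  have hpQ' : 0 < Q - p := by linarith
  have hp10 : 0 < p - 1 := by linarith
  have hden : 0 < 2 * Q - 2 * p - p * Q := by linarith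
  obtain ⟨S, hS0, hS⟩ :=
    XElliptic.exists_eLpNorm_le_mul_eLpNorm_xGrad (by omega) hX hΩ hΩb hU hΩU hQ hadm
  have hSob : ∀ (u : XElliptic.E N → ℝ) (G : XElliptic.E N → XElliptic.E m),
      XElliptic.IsW0 X Ω 2 u G →
      eLpNorm u (ENNReal.ofReal (2 * Q / (Q - 2))) (volume.restrict Ω) ≤
        ENNReal.ofReal S * eLpNorm G 2 (volume.restrict Ω) := fun u G h =>
    h.eLpNorm_le hX (by norm_num) ENNReal.ofReal_ne_top hS
  set V := volume.restrict Ω univ ^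
    (1 / (2 : ℝ≥0∞).toReal - 1 / (ENNReal.ofReal (2 * Q / (Q - 2))).toReal) with hVdef
  have h2a : (2 : ℝ) ≤ 2 * Q / (Q - 2) := by
    rw [le_div_iff₀ hQ2]
    linarith
  have hVt : V ≠ ⊤ := by
    refine ENNReal.rpow_ne_top_of_nonneg ?_ (measure_ne_top _ _)
    rw [ENNReal.toReal_ofReal (by linarith), ENNReal.toReal_ofNat, sub_nonneg]
    exact one_div_le_one_div_of_le two_pos h2a
  -- Hölder's inequality on the finite measure space `Ω` lowers the Sobolev exponent to `2`, giving
  -- the coercivity that Lax–Milgram needs.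
  have hPoin : ∀ (u : XElliptic.E N → ℝ) (G : XElliptic.E N → XElliptic.E m),
      XElliptic.IsW0 X Ω 2 u G → eLpNorm u 2 (volume.restrict Ω) ≤
        ENNReal.ofReal (S * V.toReal) * eLpNorm G 2 (volume.restrict Ω) := fun u G h => by
    have h2 : (2 : ℝ≥0∞) ≤ ENNReal.ofReal (2 * Q / (Q - 2)) := by
      rw [← ENNReal.ofReal_ofNat]
      exact ENNReal.ofReal_le_ofReal h2a
    refine (eLpNorm_le_eLpNorm_mul_rpow_measure_univ h2 h.1.1).trans ?_
    rw [ENNReal.ofReal_mul hS0.le, ENNReal.ofReal_toReal hVt, mul_right_comm]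
    exact mul_le_mul_left (hSob u G h) V
  -- With `a = 2Q/(Q-2)`, the equation `γ a = (2γ - 1) p'` forces this `γ`, and then `s` and `q` are
  -- determined. The side conditions translate back to the range of `p`: `γ > 1/2` to `p > 1`, `γ ≤
  -- 1` and `q < 2` to the upper bound `2Q/(Q+2)`, and `a/(2p') < 1` to `2p < Q`.
  obtain ⟨K, hK0, hK⟩ := XElliptic.exists_eLpNorm_le_mul_of_isWeakPair
    (γ := p * (Q - 2) / (2 * (Q - 2 * p))) (s := p * Q / (Q - 2 * p)) (p := p)
    (p' := p / (p - 1)) (q := p * Q / (Q - p)) hX hV hSob hα (by linarith)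
    (by rw [lt_div_iff₀ (by positivity)]; nlinarith)
    (by rw [div_le_one (by positivity)]; linarith)
    (Real.HolderConjugate.conjExponent hp1)
    (by
      rw [div_div, ← mul_div_assoc, ← mul_div_assoc, div_div_eq_mul_div, div_lt_one (by positivity)]
      nlinarith)
    (by field_simp) (by field_simp; ring) (by positivity)
    (by rw [div_lt_iff₀ hpQ']; linarith)
    (by
      have : 2 - p * Q / (Q - p) = (2 * Q - 2 * p - p * Q) / (Q - p) := by field_simp
      have h' : 1 - p * (Q - 2) / (2 * (Q - 2 * p)) =
          (2 * Q - 2 * p - p * Q) / (2 * (Q - 2 * p)) := by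
        rw [eq_div_iff (by positivity), sub_mul, div_mul_cancel₀ _ (by positivity)]
        ring
      rw [this, h']
      field_simp
      exact div_self (by linarith))
  refine ⟨K, hK0, fun β _ A hA f hf => ?_⟩
  have hqs : p * Q / (Q - p) ≤ p * Q / (Q - 2 * p) :=
    div_le_div_of_nonneg_left (by positivity) hpQ (by linarith)
  refine XElliptic.exists_isApproxSol_and_forall_isW0 hX hV hα hA ?_ ENNReal.ofReal_ne_top ?_ ?_
    (ENNReal.ofReal_le_ofReal hqs) ENNReal.ofReal_ne_top hPoin (hK β A hA) hf
  · rw [ENNReal.one_le_ofReal]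
    exact hp1.le
  · rw [ENNReal.one_le_ofReal, le_div_iff₀ hpQ']
    nlinarith
  · rw [← ENNReal.ofReal_ofNat]
    refine ENNReal.ofReal_le_ofReal ?_
    rw [div_le_iff₀ hpQ']
    linarith
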